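/- Let $\mathfrak{M}_{1,6}$ be the moduli space over $\mathbb{C}$ of ordered six-tuples of distinct points of $\mathbb{P}^1$ modulo $PGL_2$, and $\mathfrak{M}_{3,6}$ the moduli space of ordered six-tuples of hyperplanes in general position in $\mathbb{P}^3$ (no four of them meet in a point) modulo $PGL_4$. Let $T\subset\mathbb{A}^3_{\mathbb{C}}$ be the open subvariety of triples $(a,b,c)$ of distinct elements of $\mathbb{C}\setminus\{0,1\}$. Then $T$, with the family of points $(0,1,\infty,a,b,c)$, is $\mathfrak{M}_{1,6}$, and $T$, with the family of hyperplanes $$H_i: X_i=0\ (0\le i\le 3),\qquad H_4: \sum_{i=0}^{3} X_i=0,\qquad H_5: X_0+aX_1+bX_2+cX_3=0,$$ is $\mathfrak{M}_{3,6}$; in both cases every six-tuple as above over a $\mathbb{C}$-algebra $B$, given by a matrix whose maximal minors are units, is equivalent, up to a coordinate change in $GL$ and rescaling of the columns by units, to the pull-back of this family along exactly one morphism $\operatorname{Spec} B\to T$. Let $\omega$ be a primitive cube root of unity. For $(a,b,c)\in T$ let $W_{a,b,c}$ be the surface $$y_1^3+y_2^3+x_0x_1(x_1-x_0)(x_1-ax_0)(x_1-bx_0)(x_1-cx_0)=0$$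 in the weighted projective space in which $x_0,x_1$ have weight $1$ and $y_1,y_2$ have weight $2$, let $F\subset\mathbb{P}^2$ be the Fermat curve $z_0^3+z_1^3+z_2^3=0$, and let $G=\mathbb{Z}/3\mathbb{Z}$ act diagonally on $W_{a,b,c}\times F$, a generator acting by $[x_0:x_1:y_1:y_2]\mapsto[x_0:x_1:\omega y_1:\omega y_2]$ and $[z_0:z_1:z_2]\mapsto[\omega z_0:z_1:z_2]$. Let $\mathcal{X}'\to\mathfrak{M}_{1,6}$ be Rohde's family, with fibres $(W_{a,b,c}\times F)/G$. Let $\mathcal{X}_{AR}\to\mathfrak{M}_{3,6}$ be the universal family of cyclic triple covers of $\mathbb{P}^3$ branched along $H_0+\dots+H_5$, that is, the family of hypersurfaces $y^3=X_0X_1X_2X_3(X_0+X_1+X_2+X_3)(X_0+aX_1+bX_2+cX_3)$ in $\mathbb{P}(1,1,1,1,2)$. Then the two families are birationally equivalent: over the isomorphism $\mathfrak{M}_{1,6}\cong\mathfrak{M}_{3,6}$ which identifies the coordinates $(a,b,c)$ there is an isomorphism from an open subset of $\mathcal{X}'$ onto an open subset of $\mathcal{X}_{AR}$, compatible with the projections,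 where these open subsets are dense in the total spaces and in every fibre. -/

import Mathlib

open CategoryTheory CategoryTheory.Limits AlgebraicGeometry TopologicalSpace

noncomputable section

namespace RohdeCY

section ProjMap

variable {R A : Type} [CommRing R] [CommRing A] [Algebra R A]
  {𝒜 : ℕ → Submodule R A} [GradedAlgebra 𝒜] (g : GradedRingHom 𝒜 𝒜)
  (hg : HomogeneousIdeal.irrelevant 𝒜 ≤ (HomogeneousIdeal.irrelevant 𝒜).map g)

/-- A degree-preserving endomorphism fixing the scalars induces a morphism of `Proj` over the
base; first on the standard affine charts. -/
lemma projMap_toBase_chart (h : ∀ r : R, g (algebraMap R A r) = algebraMap R A r)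
    {m : ℕ} (hm : 0 < m) {s : A} (hs : s ∈ 𝒜 m) :
    Proj.awayι 𝒜 (g s) (g.map_mem hs) hm ≫ Proj.map g hg ≫ Proj.toSpecZero 𝒜 ≫
        Spec.map (CommRingCat.ofHom (algebraMap R (𝒜 0))) =
      Proj.awayι 𝒜 (g s) (g.map_mem hs) hm ≫ Proj.toSpecZero 𝒜 ≫
        Spec.map (CommRingCat.ofHom (algebraMap R (𝒜 0))) := by
  have h1 := Proj.awayι_comp_map g hg hm s hs
  have h2 := Proj.awayι_toSpecZero 𝒜 s hs hm
  have h3 := Proj.awayι_toSpecZero 𝒜 (g s) (g.map_mem hs) hm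
  rw [reassoc_of% h1, reassoc_of% h2, reassoc_of% h3, ← Spec.map_comp, ← Spec.map_comp,
    ← Spec.map_comp]
  congr 1
  ext r
  change Localization.mk (g (algebraMap R A r)) ⟨g 1, _⟩ = Localization.mk (algebraMap R A r) 1
  rw [h]
  congr 1
  exact Subtype.ext (map_one g)

lemma projMap_toBase (h : ∀ r : R, g (algebraMap R A r) = algebraMap R A r) :
    Proj.map g hg ≫ Proj.toSpecZero 𝒜 ≫ Spec.map (CommRingCat.ofHom (algebraMap R (𝒜 0))) =
      Proj.toSpecZero 𝒜 ≫ Spec.map (CommRingCat.ofHom (algebraMap R (𝒜 0))) :=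
  (Proj.mapAffineOpenCover g hg).openCover.hom_ext _ _ fun s =>
    projMap_toBase_chart g hg h s.1.2 s.2.2

end ProjMap

/-! ### Hypersurfaces in weighted projective spaces -/

section Hypersurface

variable {ι R : Type} [CommRing R] (w : ι → ℕ) (f : MvPolynomial ι R)

/-- The homogeneous coordinate ring `R[x_i] / (f)`. -/
abbrev HRing : Type := MvPolynomial ι R ⧸ Ideal.span {f}

/-- The degree `n` part of `R[x_i] / (f)`, where `x_i` has degree `w i`. -/
def hGrading (n : ℕ) : Submodule R (HRing f) :=
  (MvPolynomial.weightedHomogeneousSubmodule R w n).map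
    (Ideal.Quotient.mkₐ R (Ideal.span {f})).toLinearMap

lemma mk_mem_hGrading {n : ℕ} {p : MvPolynomial ι R}
    (hp : p ∈ MvPolynomial.weightedHomogeneousSubmodule R w n) :
    (Ideal.Quotient.mk (Ideal.span {f}) p) ∈ hGrading w f n :=
  ⟨p, hp, rfl⟩

instance hGrading_gradedMonoid : SetLike.GradedMonoid (hGrading w f) where
  one_mem := ⟨1, MvPolynomial.isWeightedHomogeneous_one R w,
    map_one (Ideal.Quotient.mk (Ideal.span {f}))⟩
  mul_mem := by
    rintro i j _ _ ⟨p, hp, rfl⟩ ⟨q, hq, rfl⟩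
    exact ⟨p * q, MvPolynomial.IsWeightedHomogeneous.mul hp hq,
      map_mul (Ideal.Quotient.mk (Ideal.span {f})) _ _⟩

attribute [local instance] MvPolynomial.weightedGradedAlgebra

/-- The quotient map on direct sums of graded pieces. -/
def hSum : DirectSum ℕ (fun n => MvPolynomial.weightedHomogeneousSubmodule R w n) →ₐ[R]
    DirectSum ℕ (fun n => hGrading w f n) :=
  DirectSum.toAlgebra R (fun n => MvPolynomial.weightedHomogeneousSubmodule R w n)
    (fun n => (DirectSum.lof R ℕ (fun n => hGrading w f n) n).comp
      ((Ideal.Quotient.mkₐ R (Ideal.span {f})).toLinearMap.restrict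
        (fun _ hp => mk_mem_hGrading w f hp)))
    (by rfl)
    (by
      intro i j a b
      simp only [LinearMap.comp_apply]
      erw [DirectSum.of_mul_of]
      rfl)

lemma hSum_of {n : ℕ} (p : MvPolynomial.weightedHomogeneousSubmodule R w n) :
    hSum w f (DirectSum.of (fun n => MvPolynomial.weightedHomogeneousSubmodule R w n) n p) =
      DirectSum.of (fun n => hGrading w f n) n
        ⟨Ideal.Quotient.mk (Ideal.span {f}) p, mk_mem_hGrading w f p.2⟩ := by
  change DirectSum.toModule R ℕ _ (fun n => (DirectSum.lof R ℕ (fun n => hGrading w f n) n).comp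
    ((Ideal.Quotient.mkₐ R (Ideal.span {f})).toLinearMap.restrict
      (fun _ hp => mk_mem_hGrading w f hp))) (DirectSum.lof R ℕ _ n p) = _
  rw [DirectSum.toModule_lof]
  rfl

/-- The map from `R[x_i]` to the direct sum of the graded pieces of `R[x_i] / (f)`. -/
def hSplit : MvPolynomial ι R →ₐ[R] DirectSum ℕ (fun n => hGrading w f n) :=
  (hSum w f).comp
    (DirectSum.decomposeAlgEquiv (MvPolynomial.weightedHomogeneousSubmodule R w)).toAlgHom

lemma hSplit_of_mem {n : ℕ} {p : MvPolynomial ι R}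
    (hp : p ∈ MvPolynomial.weightedHomogeneousSubmodule R w n) :
    hSplit w f p = DirectSum.of (fun n => hGrading w f n) n
      ⟨Ideal.Quotient.mk (Ideal.span {f}) p, mk_mem_hGrading w f hp⟩ := by
  have h : hSplit w f p =
    hSum w f (DirectSum.decompose (MvPolynomial.weightedHomogeneousSubmodule R w) p) := rfl
  rw [h, DirectSum.decompose_of_mem _ hp, hSum_of]

variable {w f}

/-- If `f` is weighted homogeneous, then `R[x_i] / (f)` is a graded `R`-algebra. -/
@[reducible] def hGradedAlgebra {d : ℕ} (hf : f.IsWeightedHomogeneous w d) : GradedAlgebra (hGrading w f) :=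
  GradedAlgebra.ofAlgHom (hGrading w f)
    (Ideal.Quotient.liftₐ (Ideal.span {f}) (hSplit w f) (by
      intro a ha
      obtain ⟨b, rfl⟩ := Ideal.mem_span_singleton'.mp ha
      have h0 : hSplit w f f = 0 := by
        rw [hSplit_of_mem w f hf]
        have : (⟨Ideal.Quotient.mk (Ideal.span {f}) f, mk_mem_hGrading w f hf⟩ :
            hGrading w f d) = 0 := by
          ext
          simp
        rw [this, map_zero]
      rw [map_mul, h0, mul_zero]))
    (by
      apply Ideal.Quotient.algHom_ext
      apply AlgHom.ext
      intro p
      induction p using MvPolynomial.induction_on' with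
      | monomial u a =>
        have hm : MvPolynomial.monomial u a ∈
            MvPolynomial.weightedHomogeneousSubmodule R w (Finsupp.weight w u) :=
          MvPolynomial.isWeightedHomogeneous_monomial w u a rfl
        change DirectSum.coeAlgHom (hGrading w f) (hSplit w f (MvPolynomial.monomial u a)) = _
        rw [hSplit_of_mem w f hm, DirectSum.coeAlgHom_of]
        rfl
      | add p q hp hq => rw [map_add, hp, hq, map_add])
    (by
      rintro i ⟨_, p, hp, rfl⟩
      exact hSplit_of_mem w f hp)

/-- The hypersurface `f = 0` in the weighted projective space over `R` with weights `w`. -/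
def hypersurface {d : ℕ} (hf : f.IsWeightedHomogeneous w d) : Scheme.{0} :=
  letI := hGradedAlgebra hf
  Proj (hGrading w f)

/-- The structure morphism of the hypersurface `f = 0`. -/
def hypersurfaceToBase {d : ℕ} (hf : f.IsWeightedHomogeneous w d) :
    hypersurface hf ⟶ Spec (CommRingCat.of R) :=
  letI := hGradedAlgebra hf
  Proj.toSpecZero (hGrading w f) ≫
    Spec.map (CommRingCat.ofHom (algebraMap R (hGrading w f 0)))

/-- The substitution `x_i ↦ ζ_i x_i`. -/
def diagSubst (ζ : ι → Rˣ) : MvPolynomial ι R →ₐ[R] MvPolynomial ι R :=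
  MvPolynomial.aeval fun i => MvPolynomial.C (ζ i : R) * MvPolynomial.X i

lemma diagSubst_mem (w : ι → ℕ) (ζ : ι → Rˣ) {n : ℕ} {p : MvPolynomial ι R}
    (hp : p ∈ MvPolynomial.weightedHomogeneousSubmodule R w n) :
    diagSubst ζ p ∈ MvPolynomial.weightedHomogeneousSubmodule R w n := by
  classical
  have hp' : p.IsWeightedHomogeneous w n := hp
  rw [p.as_sum, map_sum]
  refine Submodule.sum_mem _ fun u hu => ?_
  have hwu : Finsupp.weight w u = n := hp' (MvPolynomial.mem_support_iff.mp hu)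
  have h : diagSubst ζ (MvPolynomial.monomial u (p.coeff u)) =
      MvPolynomial.monomial u (p.coeff u * u.prod fun i k => (ζ i : R) ^ k) := by
    rw [diagSubst, MvPolynomial.aeval_monomial, MvPolynomial.monomial_eq (s := u),
      map_mul MvPolynomial.C]
    simp only [mul_pow, Finsupp.prod_mul, MvPolynomial.algebraMap_eq, mul_assoc]
    congr 2
    simp [Finsupp.prod, map_prod]
  rw [h]
  exact MvPolynomial.isWeightedHomogeneous_monomial w u _ hwu

lemma diagSubst_inv (ζ : ι → Rˣ) (p : MvPolynomial ι R) :
    diagSubst ζ (diagSubst ζ⁻¹ p) = p := by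
  have h : (diagSubst ζ).comp (diagSubst ζ⁻¹) = AlgHom.id R (MvPolynomial ι R) := by
    apply MvPolynomial.algHom_ext
    intro i
    change diagSubst ζ (diagSubst ζ⁻¹ (MvPolynomial.X i)) = MvPolynomial.X i
    have hX : ∀ ξ : ι → Rˣ, diagSubst ξ (MvPolynomial.X i) =
        MvPolynomial.C (ξ i : R) * MvPolynomial.X i := fun ξ => MvPolynomial.aeval_X _ i
    have hC : ∀ r : R, diagSubst ζ (MvPolynomial.C r : MvPolynomial ι R) = MvPolynomial.C r :=
      fun r => MvPolynomial.aeval_C _ r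
    rw [hX, map_mul, hC, hX, ← mul_assoc, ← map_mul, Pi.inv_apply, Units.inv_mul, map_one,
      one_mul]
  exact DFunLike.congr_fun h p

variable {d : ℕ}

/-- The graded endomorphism of `R[x_i] / (f)` induced by `x_i ↦ ζ_i x_i`, when this fixes `f`. -/
def hDiag (w : ι → ℕ) (ζ : ι → Rˣ) (hζ : diagSubst ζ f = f) :
    GradedRingHom (hGrading w f) (hGrading w f) where
  toRingHom := Ideal.quotientMap (Ideal.span {f}) (diagSubst ζ).toRingHom (by
    rw [Ideal.span_singleton_le_iff_mem, Ideal.mem_comap]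
    change diagSubst ζ f ∈ _
    rw [hζ]
    exact Ideal.mem_span_singleton_self f)
  map_mem := by
    rintro n _ ⟨p, hp, rfl⟩
    exact mk_mem_hGrading w f (diagSubst_mem w ζ hp)

lemma irrelevant_le_map_hDiag (hf : f.IsWeightedHomogeneous w d) (ζ : ι → Rˣ)
    (hζ : diagSubst ζ f = f) :
    letI := hGradedAlgebra hf
    HomogeneousIdeal.irrelevant (hGrading w f) ≤
      (HomogeneousIdeal.irrelevant (hGrading w f)).map (hDiag w ζ hζ) := by
  let _ := hGradedAlgebra hf
  change HomogeneousIdeal.irrelevant (hGrading w f) ≤ _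
  rw [HomogeneousIdeal.irrelevant_le]
  rintro n hn _ ⟨p, hp, rfl⟩
  refine Ideal.subset_span ⟨Ideal.Quotient.mk _ (diagSubst ζ⁻¹ p), ?_, ?_⟩
  · exact HomogeneousIdeal.mem_irrelevant_of_mem _ hn
      (mk_mem_hGrading w f (diagSubst_mem w ζ⁻¹ hp))
  · change Ideal.Quotient.mk (Ideal.span {f}) (diagSubst ζ (diagSubst ζ⁻¹ p)) = _
    rw [diagSubst_inv]
    rfl

/-- The automorphism `[x_i] ↦ [ζ_i x_i]` of the hypersurface `f = 0`. -/
def hypersurfaceDiag (hf : f.IsWeightedHomogeneous w d) (ζ : ι → Rˣ)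
    (hζ : diagSubst ζ f = f) : hypersurface hf ⟶ hypersurface hf :=
  letI := hGradedAlgebra hf
  Proj.map (hDiag w ζ hζ) (irrelevant_le_map_hDiag hf ζ hζ)

lemma hypersurfaceDiag_toBase (hf : f.IsWeightedHomogeneous w d) (ζ : ι → Rˣ)
    (hζ : diagSubst ζ f = f) :
    hypersurfaceDiag hf ζ hζ ≫ hypersurfaceToBase hf = hypersurfaceToBase hf := by
  let _ := hGradedAlgebra hf
  exact projMap_toBase (hDiag w ζ hζ) (irrelevant_le_map_hDiag hf ζ hζ) fun r =>
    congrArg (Ideal.Quotient.mk (Ideal.span {f})) (MvPolynomial.aeval_C _ r)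

end Hypersurface

/-! ### Point and hyperplane configurations and their moduli -/

section Moduli

variable {k m : ℕ} {A : Type} [CommRing A]

/-- The columns of `N` are the equations of `m` hyperplanes (equivalently, by duality, the
homogeneous coordinates of `m` points) in the projective space of dimension `k - 1` over `A`.
They are in general position if no `k` of them are linearly dependent, in every fibre. For
`k = 2` this says that the `m` points of the projective line are pairwise disjoint. -/
def GeneralPosition (N : Matrix (Fin k) (Fin m) A) : Prop :=
  ∀ e : Fin k ↪o Fin m, IsUnit (N.submatrix id e).det

/-- Two configurations are equivalent if they differ by a projective coordinate change; the
columns are only defined up to scaling. -/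
def ConfigEquiv (N N' : Matrix (Fin k) (Fin m) A) : Prop :=
  ∃ (g : GL (Fin k) A) (t : Fin m → Aˣ),
    N' = (g : Matrix (Fin k) (Fin k) A) * N * Matrix.diagonal fun j => (t j : A)

/-- `Spec A` is the (fine) moduli space of ordered `m`-tuples in general position in the projective
space of dimension `k - 1` over `ℂ`, with universal configuration `N`. -/
def IsModuliSpace [Algebra ℂ A] (N : Matrix (Fin k) (Fin m) A) : Prop :=
  GeneralPosition N ∧
    ∀ (B : Type) [CommRing B] [Algebra ℂ B] (N' : Matrix (Fin k) (Fin m) B),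
      GeneralPosition N' → ∃! φ : A →ₐ[ℂ] B, ConfigEquiv (N.map φ) N'

/-- The product of all maximal minors. -/
def minorProd (N : Matrix (Fin k) (Fin m) A) : A :=
  ∏ e : Fin k ↪o Fin m, (N.submatrix id e).det

/-- The points `0, 1, ∞, a, b, c` of the projective line, `x` being written `[1 : x]`. -/
def points (a b c : A) : Matrix (Fin 2) (Fin 6) A :=
  !![1, 1, 0, 1, 1, 1;
     0, 1, 1, a, b, c]

/-- The hyperplanes `X₀ = 0`, `X₁ = 0`, `X₂ = 0`, `X₃ = 0`, `X₀ + X₁ + X₂ + X₃ = 0` and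
`X₀ + a X₁ + b X₂ + c X₃ = 0` of projective three-space. -/
def planes (a b c : A) : Matrix (Fin 4) (Fin 6) A :=
  !![1, 0, 0, 0, 1, 1;
     0, 1, 0, 0, 1, a;
     0, 0, 1, 0, 1, b;
     0, 0, 0, 1, 1, c]

/-- The polynomial ring `ℂ[a, b, c]`. -/
abbrev Param : Type := MvPolynomial (Fin 3) ℂ

/-- The coordinate ring of the space of all `(a, b, c)` for which the points `0, 1, ∞, a, b, c`
are distinct. -/
abbrev PtRing : Type :=
  Localization.Away
    (minorProd (points (MvPolynomial.X 0 : Param) (MvPolynomial.X 1) (MvPolynomial.X 2)))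

/-- The coordinate ring of the space of all `(a, b, c)` for which the six hyperplanes
`planes a b c` are in general position. -/
abbrev PlRing : Type :=
  Localization.Away
    (minorProd (planes (MvPolynomial.X 0 : Param) (MvPolynomial.X 1) (MvPolynomial.X 2)))

/-- The coordinate functions `a, b, c` in an algebra over `ℂ[a, b, c]`. -/
def coord (A : Type) [CommRing A] [Algebra Param A] (i : Fin 3) : A :=
  algebraMap Param A (MvPolynomial.X i)

/-- The moduli space of six ordered distinct points on the projective line. -/
def MPt : Scheme.{0} := Spec (CommRingCat.of PtRing)

/-- The moduli space of six ordered hyperplanes in general position in projective three-space. -/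
def MPl : Scheme.{0} := Spec (CommRingCat.of PlRing)

/-- The universal six points. -/
def univPoints : Matrix (Fin 2) (Fin 6) PtRing :=
  points (coord PtRing 0) (coord PtRing 1) (coord PtRing 2)

/-- The universal six hyperplanes. -/
def univPlanes : Matrix (Fin 4) (Fin 6) PlRing :=
  planes (coord PlRing 0) (coord PlRing 1) (coord PlRing 2)

/-- The morphism of moduli spaces given by an isomorphism of coordinate rings over `ℂ[a, b, c]`,
that is, the isomorphism which preserves the coordinates `a, b, c`. -/
def moduliMap (e : PlRing ≃ₐ[Param] PtRing) : MPt ⟶ MPl :=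
  Spec.map (CommRingCat.ofHom e.toRingEquiv.toRingHom)

end Moduli

/-! ### Cyclic triple covers of projective three-space -/

section Cover

variable {A : Type} [CommRing A]

/-- The equation `y³ = ∏ ℓⱼ(X₀, …, X₃)`, where `ℓⱼ` is the linear form given by the `j`-th column
of `H`; the variables are `X₀, X₁, X₂, X₃, y`, in this order. -/
def coverPoly (H : Matrix (Fin 4) (Fin 6) A) : MvPolynomial (Fin 5) A :=
  MvPolynomial.X 4 ^ 3 -
    ∏ j : Fin 6, ∑ i : Fin 4, MvPolynomial.C (H i j) * MvPolynomial.X i.castSucc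

lemma coverPoly_homogeneous (H : Matrix (Fin 4) (Fin 6) A) :
    (coverPoly H).IsWeightedHomogeneous ![1, 1, 1, 1, 2] 6 := by
  have hl : ∀ j : Fin 6, (∑ i : Fin 4, MvPolynomial.C (H i j) *
      MvPolynomial.X i.castSucc : MvPolynomial (Fin 5) A).IsWeightedHomogeneous
        ![1, 1, 1, 1, 2] 1 := by
    intro j
    refine Submodule.sum_mem (MvPolynomial.weightedHomogeneousSubmodule A ![1, 1, 1, 1, 2] 1)
      fun i _ => ?_
    have h := (MvPolynomial.isWeightedHomogeneous_C (R := A) ![1, 1, 1, 1, 2] (H i j)).mul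
      (MvPolynomial.isWeightedHomogeneous_X A ![1, 1, 1, 1, 2] i.castSucc)
    fin_cases i <;> exact h
  refine Submodule.sub_mem
    (MvPolynomial.weightedHomogeneousSubmodule A ![1, 1, 1, 1, 2] 6) ?_ ?_
  · exact (MvPolynomial.isWeightedHomogeneous_X A ![1, 1, 1, 1, 2] 4).pow 3
  · exact MvPolynomial.IsWeightedHomogeneous.prod Finset.univ _ (fun _ => 1) fun j _ => hl j

/-- The cyclic triple cover of projective three-space over `A` branched along the six hyperplanes
given by the columns of `H`: the hypersurface `y³ = ∏ ℓⱼ` in `ℙ(1,1,1,1,2)`, which maps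
to projective three-space by forgetting `y`. -/
def tripleCover (H : Matrix (Fin 4) (Fin 6) A) : Scheme.{0} :=
  hypersurface (coverPoly_homogeneous H)

/-- The universal family of cyclic triple covers of projective three-space branched along six
hyperplanes in general position. -/
def coverFamily : tripleCover univPlanes ⟶ MPl :=
  hypersurfaceToBase (coverPoly_homogeneous univPlanes)

end Cover

/-! ### Rohde's family -/

section Rohde

variable {A : Type} [CommRing A]

/-- The equation `y₁³ + y₂³ + x₀x₁(x₁ - x₀)(x₁ - ax₀)(x₁ - bx₀)(x₁ - cx₀) = 0` in the variables
`x₀, x₁, y₁, y₂`, in this order. -/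
def surfacePoly (a b c : A) : MvPolynomial (Fin 4) A :=
  MvPolynomial.X 2 ^ 3 + MvPolynomial.X 3 ^ 3 +
    MvPolynomial.X 0 * MvPolynomial.X 1 * (MvPolynomial.X 1 - MvPolynomial.X 0) *
      (MvPolynomial.X 1 - MvPolynomial.C a * MvPolynomial.X 0) *
      (MvPolynomial.X 1 - MvPolynomial.C b * MvPolynomial.X 0) *
      (MvPolynomial.X 1 - MvPolynomial.C c * MvPolynomial.X 0)

lemma surfacePoly_homogeneous (a b c : A) :
    (surfacePoly a b c).IsWeightedHomogeneous ![1, 1, 2, 2] 6 := by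
  have hX : ∀ i : Fin 4, (MvPolynomial.X i : MvPolynomial (Fin 4) A).IsWeightedHomogeneous
      ![1, 1, 2, 2] (![1, 1, 2, 2] i) := MvPolynomial.isWeightedHomogeneous_X A _
  have h0 : (MvPolynomial.X 0 : MvPolynomial (Fin 4) A).IsWeightedHomogeneous
    ![1, 1, 2, 2] 1 := hX 0
  have h1 : (MvPolynomial.X 1 : MvPolynomial (Fin 4) A).IsWeightedHomogeneous
    ![1, 1, 2, 2] 1 := hX 1
  have hl : ∀ t : A, (MvPolynomial.X 1 - MvPolynomial.C t * MvPolynomial.X 0 :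
      MvPolynomial (Fin 4) A).IsWeightedHomogeneous ![1, 1, 2, 2] 1 := fun t =>
    Submodule.sub_mem (MvPolynomial.weightedHomogeneousSubmodule A ![1, 1, 2, 2] 1) h1
      ((MvPolynomial.isWeightedHomogeneous_C _ t).mul h0)
  have hl1 : (MvPolynomial.X 1 - MvPolynomial.X 0 :
      MvPolynomial (Fin 4) A).IsWeightedHomogeneous ![1, 1, 2, 2] 1 :=
    Submodule.sub_mem (MvPolynomial.weightedHomogeneousSubmodule A ![1, 1, 2, 2] 1) h1 h0
  exact Submodule.add_mem (MvPolynomial.weightedHomogeneousSubmodule A ![1, 1, 2, 2] 6)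
    (Submodule.add_mem (MvPolynomial.weightedHomogeneousSubmodule A ![1, 1, 2, 2] 6)
      ((hX 2).pow 3) ((hX 3).pow 3))
    (((((h0.mul h1).mul hl1).mul (hl a)).mul (hl b)).mul (hl c))

/-- The equation `z₀³ + z₁³ + z₂³ = 0` of the Fermat cubic. -/
def fermatPoly : MvPolynomial (Fin 3) ℂ :=
  MvPolynomial.X 0 ^ 3 + MvPolynomial.X 1 ^ 3 + MvPolynomial.X 2 ^ 3

lemma fermatPoly_homogeneous : fermatPoly.IsWeightedHomogeneous (fun _ => 1) 3 := by
  have hX : ∀ i : Fin 3, (MvPolynomial.X i ^ 3 : MvPolynomial (Fin 3) ℂ).IsWeightedHomogeneous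
      (fun _ => 1) 3 := fun i =>
    (MvPolynomial.isWeightedHomogeneous_X ℂ (fun _ => 1) i).pow 3
  exact Submodule.add_mem (MvPolynomial.weightedHomogeneousSubmodule ℂ (fun _ => 1) 3)
    (Submodule.add_mem (MvPolynomial.weightedHomogeneousSubmodule ℂ (fun _ => 1) 3)
      (hX 0) (hX 1)) (hX 2)

/-- The family of surfaces `W` in the weighted projective space with coordinates `x₀, x₁` of
weight one and `y₁, y₂` of weight two, over the moduli space of six points. -/
def surface : Scheme.{0} :=
  hypersurface (surfacePoly_homogeneous (coord PtRing 0) (coord PtRing 1) (coord PtRing 2))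

/-- The structure morphism of the family of surfaces. -/
def surfaceToBase : surface ⟶ MPt :=
  hypersurfaceToBase
    (surfacePoly_homogeneous (coord PtRing 0) (coord PtRing 1) (coord PtRing 2))

/-- The Fermat cubic curve `F` over `ℂ`. -/
def fermat : Scheme.{0} := hypersurface fermatPoly_homogeneous

/-- The structure morphism of the Fermat cubic. -/
def fermatToBase : fermat ⟶ Spec (CommRingCat.of ℂ) := hypersurfaceToBase fermatPoly_homogeneous

/-- The structure morphism `MPt ⟶ Spec ℂ`. -/
def MPtToC : MPt ⟶ Spec (CommRingCat.of ℂ) := Spec.map (CommRingCat.ofHom (algebraMap ℂ PtRing))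

variable {ω : ℂ} (hω : IsPrimitiveRoot ω 3)

/-- The unit of a `ℂ`-algebra given by a primitive third root of unity. -/
def rootUnit (hω : IsPrimitiveRoot ω 3) (A : Type) [CommRing A] [Algebra ℂ A] : Aˣ :=
  Units.map (algebraMap ℂ A).toMonoidHom (hω.isUnit (by norm_num)).unit

lemma rootUnit_pow (A : Type) [CommRing A] [Algebra ℂ A] : (rootUnit hω A : A) ^ 3 = 1 := by
  change (algebraMap ℂ A ω) ^ 3 = 1
  rw [← map_pow, hω.pow_eq_one, map_one]

lemma surfacePoly_invariant [Algebra ℂ A] (a b c : A) :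
    diagSubst ![1, 1, rootUnit hω A, rootUnit hω A] (surfacePoly a b c) = surfacePoly a b c := by
  have h : (MvPolynomial.C (rootUnit hω A : A) : MvPolynomial (Fin 4) A) ^ 3 = 1 := by
    rw [← map_pow, rootUnit_pow, map_one]
  simp [surfacePoly, diagSubst, mul_pow, h]

lemma fermatPoly_invariant :
    diagSubst ![rootUnit hω ℂ, 1, 1] fermatPoly = fermatPoly := by
  have h : (MvPolynomial.C (rootUnit hω ℂ : ℂ) : MvPolynomial (Fin 3) ℂ) ^ 3 = 1 := by
    rw [← map_pow, rootUnit_pow, map_one]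
  simp [fermatPoly, diagSubst, mul_pow, h]

/-- The automorphism `[x₀ : x₁ : y₁ : y₂] ↦ [x₀ : x₁ : ωy₁ : ωy₂]` of the family of surfaces. -/
def surfaceAut : surface ⟶ surface :=
  hypersurfaceDiag
    (surfacePoly_homogeneous (coord PtRing 0) (coord PtRing 1) (coord PtRing 2))
    ![1, 1, rootUnit hω PtRing, rootUnit hω PtRing] (surfacePoly_invariant hω _ _ _)

lemma surfaceAut_toBase : surfaceAut hω ≫ surfaceToBase = surfaceToBase :=
  hypersurfaceDiag_toBase _ _ _

/-- The automorphism `[z₀ : z₁ : z₂] ↦ [ωz₀ : z₁ : z₂]` of the Fermat cubic. -/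
def fermatAut : fermat ⟶ fermat :=
  hypersurfaceDiag fermatPoly_homogeneous ![rootUnit hω ℂ, 1, 1] (fermatPoly_invariant hω)

lemma fermatAut_toBase : fermatAut hω ≫ fermatToBase = fermatToBase :=
  hypersurfaceDiag_toBase _ _ _

/-- The total space of the family of threefolds `W × F`. -/
def productFamily : Scheme.{0} := pullback (surfaceToBase ≫ MPtToC) fermatToBase

/-- The structure morphism of the family of threefolds `W × F`. -/
def productToBase : productFamily ⟶ MPt := pullback.fst _ _ ≫ surfaceToBase

lemma productAut_condition :
    (pullback.fst (surfaceToBase ≫ MPtToC) fermatToBase ≫ surfaceAut hω) ≫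
        surfaceToBase ≫ MPtToC =
      (pullback.snd (surfaceToBase ≫ MPtToC) fermatToBase ≫ fermatAut hω) ≫ fermatToBase := by
  rw [Category.assoc, Category.assoc, fermatAut_toBase, ← Category.assoc (surfaceAut hω),
    surfaceAut_toBase, pullback.condition]

/-- The diagonal action of the chosen generator of `ℤ/3` on `W × F`. -/
def productAut : productFamily ⟶ productFamily :=
  pullback.lift (pullback.fst _ _ ≫ surfaceAut hω) (pullback.snd _ _ ≫ fermatAut hω) 
    (productAut_condition hω)

lemma productAut_fst : productAut hω ≫ pullback.fst (surfaceToBase ≫ MPtToC) fermatToBase =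
    pullback.fst (surfaceToBase ≫ MPtToC) fermatToBase ≫ surfaceAut hω :=
  pullback.lift_fst _ _ _

lemma productAut_toBase : productAut hω ≫ productToBase = productToBase := by
  have h := congrArg (· ≫ surfaceToBase) (productAut_fst hω)
  refine (Category.assoc _ _ _).symm.trans (h.trans ((Category.assoc _ _ _).trans ?_))
  rw [surfaceAut_toBase]
  rfl

/-- The total space of Rohde's family, the quotient `(W × F) / (ℤ/3)`. Being the coequalizer of
the generator of the group and of the identity, it is the space of orbits together with the
sheaf of invariant functions. -/
def rohdeTotal : LocallyRingedSpace.{0} :=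
  coequalizer (productAut hω).toLRSHom (𝟙 productFamily.toLocallyRingedSpace)

/-- The structure morphism of Rohde's family. -/
def rohdeFamily : rohdeTotal hω ⟶ MPt.toLocallyRingedSpace :=
  coequalizer.desc productToBase.toLRSHom
    ((congrArg Scheme.Hom.toLRSHom (productAut_toBase hω)).trans (Category.id_comp _).symm)

end Rohde

/-! ### Birational equivalence of families -/

/-- The families `p : X ⟶ B` and `q : Y ⟶ B'` are birationally equivalent along `φ : B ⟶ B'`
(in practice an isomorphism): there are open subspaces of `X` and `Y`, dense in the total
spaces and in every fibre, and an isomorphism between them over `φ`. -/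
def BirationalFamilies {X B Y B' : LocallyRingedSpace.{0}} (p : X ⟶ B) (q : Y ⟶ B')
    (φ : B ⟶ B') : Prop :=
  ∃ (U : Opens X.toTopCat) (V : Opens Y.toTopCat)
    (f : X.restrict U.isOpenEmbedding ≅ Y.restrict V.isOpenEmbedding),
    Dense (U : Set X.toTopCat) ∧ Dense (V : Set Y.toTopCat) ∧
    (∀ b : B.toTopCat, p.base ⁻¹' {b} ⊆ closure ((U : Set X.toTopCat) ∩ p.base ⁻¹' {b})) ∧
    (∀ b : B'.toTopCat, q.base ⁻¹' {b} ⊆ closure ((V : Set Y.toTopCat) ∩ q.base ⁻¹' {b})) ∧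
    f.hom ≫ Y.ofRestrict V.isOpenEmbedding ≫ q = X.ofRestrict U.isOpenEmbedding ≫ p ≫ φ

end RohdeCY
end

/-!
# Rohde's family and the family of triple covers of `ℙ³` are birationally equivalent

**Moduli.** A configuration in general position is brought to the form `points a b c` or
`planes a b c` by inverting one of its maximal square submatrices and rescaling, and a coordinate
change between two such normal forms is a scalar, so that `a, b, c` are unique. Hence the
localization of `ℂ[a, b, c]` at the product of the maximal minors represents the moduli problem
(`isModuliSpace_of_normalForm`). In both cases general position means that the differences of
`0, 1, a, b, c` are invertible, and the two moduli spaces agree (`exists_algEquiv_moduli`).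

**The birational map.** On the triple cover put `x = (X₀ + a X₁ + b X₂) / (X₀ + X₁ + X₂)`. The six
linear forms which define the branch locus then split into two triples, each with one linear
relation: `(1 - x) X₀ + (a - x) X₁ + (b - x) X₂ = 0` and
`(x - c) X₃ - x (X₀ + X₁ + X₂ + X₃) + (X₀ + a X₁ + b X₂ + c X₃) = 0`. Three elements with sum zero
are of the form `p + q`, `ω p + ω² q`, `ω² p + ω q`, and the product of these is `p³ + q³`. So the
first triple is given, up to a common factor, by `p = 1` and a coordinate `q = v`, and the second
one by two coordinates `y₁, y₂`. The product of the six coefficients is, up to sign, the branch form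
`x (x - 1) (x - a) (x - b) (x - c)` of the surface `W`. The equation of `W` and the equation
`u³ + 1 + v³ = 0` of the Fermat curve therefore imply that the product of the six linear forms is
the cube of a function `Y` (`IsRohdePoint.isCoverPoint`). Conversely a point of the triple cover
determines `x` and `v`, hence also the function `κ = -(1 + v³)`, and `y₁, y₂` are determined by the
choice of a cube root `u` of `κ` (`IsCoverPoint.exists_corresponds`). The three choices form an
orbit of the group.

These computations hold for points with values in any ring. On suitable affine open subsets the
coordinate ring `R` of `W × F` and the coordinate ring `S` of the triple cover represent such points
(`IsUniversalRohde`, `IsUniversalCover`). It follows that `R = S[u] / (u³ - κ)`, with the group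
acting on `u` by multiplication with `ω`, and that `S` is the ring of invariants of `R`
(`IsUniversalRohde.exists_invariants`).

**The quotient.** The total space of Rohde's family is a coequalizer of locally ringed spaces, that
is, it carries the quotient topology and the sheaf of invariant functions. The image of a stable
affine open subset `Spec R` is the spectrum of the ring of invariants (`exists_quotient_iso`), as
the fibres of `Spec R ⟶ Spec S` are orbits and invariants commute with localization. Thus an open
subspace of Rohde's family is isomorphic to `Spec S`.

**Density.** A set is dense in all fibres and in the total space if every point is a specialization
of a point of the set in the same fibre (`dense_of_specializes`). In a hypersurface over an affine
base, such generizations outside the zeros of a polynomial `g` exist if `g` is not a zero divisor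
modulo the equation over the residue ring of any point of the base, as a minimal prime consists of
zero divisors (`exists_specializes_hypersurface`). The equations in question are monic in one of the
variables, and modulo such an equation the nonzero polynomials without this variable are regular
(`regularMod_of_monic`). In `W × F` one passes to a more general point of `W` first, by going down
for the flat projection `W × F ⟶ W`, and then to a more general point of the fibre of this
projection (`exists_prime_le_tensor`).
-/

noncomputable section

namespace RohdeCY

open Opposite

/-! ### Coequalizers of locally ringed spaces -/

/-- A section over an open subset of the colimit of a parallel pair `Z ⇉ X` is determined by its
pullback to `X`. -/
lemma colimit_sections_injective (D : WalkingParallelPair ⥤ PresheafedSpace.{_,_,0} CommRingCat.{0})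
    (O : Opens (colimit D).carrier) :
    Function.Injective ((colimit.ι D WalkingParallelPair.one).c.app (op O)) := by
  rw [← PresheafedSpace.colimitPresheafObjIsoComponentwiseLimit_hom_π]
  intro s t hst
  have h2 : Function.Injective (PresheafedSpace.colimitPresheafObjIsoComponentwiseLimit D O).hom :=
    (ConcreteCategory.bijective_of_isIso _).1
  apply h2
  apply Concrete.limit_ext
  intro j
  induction j using Opposite.rec with | op j =>
  cases j with
  | one => exact hst
  | zero =>
    have := limit.w (PresheafedSpace.componentwiseDiagram D O)
      (Quiver.Hom.op WalkingParallelPairHom.left)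
    rw [← this]
    exact congrArg ((PresheafedSpace.componentwiseDiagram D O).map
      (Quiver.Hom.op WalkingParallelPairHom.left)) hst

/-- A section on `X` with equal pullbacks along the two morphisms of a parallel pair `Z ⇉ X`
descends to the colimit. -/
lemma colimit_sections_lift (D : WalkingParallelPair ⥤ PresheafedSpace.{_,_,0} CommRingCat.{0})
    (O : Opens (colimit D).carrier)
    (s : (PresheafedSpace.componentwiseDiagram D O).obj (op WalkingParallelPair.one))
    (hs : (PresheafedSpace.componentwiseDiagram D O).map
        (Quiver.Hom.op WalkingParallelPairHom.left) s =
      (PresheafedSpace.componentwiseDiagram D O).map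
        (Quiver.Hom.op WalkingParallelPairHom.right) s) :
    ∃ t, ((colimit.ι D WalkingParallelPair.one).c.app (op O)) t = s := by
  let F := PresheafedSpace.componentwiseDiagram D O
  let e := Types.isLimitEquivSections (isLimitOfPreserves (forget CommRingCat) (limit.isLimit F))
  let v : ∀ j, (F ⋙ forget CommRingCat).obj j := fun j => match j with
      | ⟨.one⟩ => s
      | ⟨.zero⟩ => F.map (Quiver.Hom.op WalkingParallelPairHom.left) s
  have hv : ∀ {j' j : WalkingParallelPair} (f : WalkingParallelPairHom j' j),
      (F ⋙ forget CommRingCat).map (Quiver.Hom.op (f : j' ⟶ j)) (v (op j)) = v (op j') := by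
    intro j' j f
    cases f with
    | left => rfl
    | right => exact hs.symm
    | id =>
      have h : Quiver.Hom.op (WalkingParallelPairHom.id j' : j' ⟶ j') = 𝟙 (op j') := rfl
      rw [h, CategoryTheory.Functor.map_id]
      rfl
  let sec : (F ⋙ forget CommRingCat).sections :=
    ⟨v, fun {j j'} f => hv f.unop⟩
  refine ⟨(PresheafedSpace.colimitPresheafObjIsoComponentwiseLimit D O).inv (e.symm sec), ?_⟩
  rw [← CommRingCat.comp_apply, PresheafedSpace.colimitPresheafObjIsoComponentwiseLimit_inv_ι_app]
  exact Types.isLimitEquivSections_symm_apply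
    (isLimitOfPreserves (forget CommRingCat) (limit.isLimit F)) sec (op .one)

/-- The morphism `ρ` is the quotient by the endomorphism `τ` in the naive sense: it is
`τ`-invariant, the target has the quotient topology, and its sections are the `τ`-invariant sections
upstairs. Nothing is said about the fibres of `ρ`. The inclusion `hO`, a consequence of `invariant`,
is only needed to write down the restriction in the condition that `s` is invariant. -/
structure IsQuot {Z W : LocallyRingedSpace.{0}} (τ : Z ⟶ Z) (ρ : Z ⟶ W) : Prop where
  invariant : τ ≫ ρ = ρ
  isQuotientMap : Topology.IsQuotientMap ρ.base
  injective (O : Opens W.toTopCat) : Function.Injective (ρ.c.app (op O))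
  lift (O : Opens W.toTopCat) (s : Z.presheaf.obj (op ((Opens.map ρ.base).obj O)))
    (hO : (Opens.map τ.base).obj ((Opens.map ρ.base).obj O) ≤ (Opens.map ρ.base).obj O)
    (hs : τ.c.app (op ((Opens.map ρ.base).obj O)) s = Z.presheaf.map (homOfLE hO).op s) :
    ∃ t, ρ.c.app (op O) t = s

variable {Z : LocallyRingedSpace.{0}} (τ : Z ⟶ Z)

/-- The forgetful functor from locally ringed spaces to presheafed spaces, where colimits are
computed componentwise. -/
abbrev toPSh : LocallyRingedSpace.{0} ⥤ PresheafedSpace CommRingCat.{0} :=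
  LocallyRingedSpace.forgetToSheafedSpace ⋙ SheafedSpace.forgetToPresheafedSpace

instance : PreservesColimit (parallelPair τ (𝟙 Z)) toPSh := inferInstance

/-- The presheafed space underlying the coequalizer of `τ` and the identity is the colimit of the
underlying presheafed spaces. -/
def coeqIso : colimit (parallelPair τ (𝟙 Z) ⋙ toPSh) ≅ toPSh.obj (coequalizer τ (𝟙 Z)) :=
  (preservesColimitIso toPSh (parallelPair τ (𝟙 Z))).symm

lemma ι_coeqIso_hom :
    colimit.ι (parallelPair τ (𝟙 Z) ⋙ toPSh) WalkingParallelPair.one ≫ (coeqIso τ).hom =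
      toPSh.map (coequalizer.π τ (𝟙 Z)) :=
  ι_preservesColimitIso_inv _ _ _

lemma presheaf_map_map {X : TopCat.{0}} (F : X.Presheaf CommRingCat.{0}) {U V W : (Opens X)ᵒᵖ}
    (i : U ⟶ V) (j : V ⟶ W) (k : U ⟶ W) (s : F.obj U) : F.map j (F.map i s) = F.map k s := by
  rw [← CommRingCat.comp_apply, ← F.map_comp]
  rfl

lemma coequalizer_injective (O : Opens (coequalizer τ (𝟙 Z)).toTopCat) :
    Function.Injective ((coequalizer.π τ (𝟙 Z)).c.app (op O)) := by
  have key : ∀ {Y : PresheafedSpace CommRingCat.{0}}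
      (α : colimit (parallelPair τ (𝟙 Z) ⋙ toPSh) ≅ Y)
      (g : Z.toPresheafedSpace ⟶ Y), colimit.ι (parallelPair τ (𝟙 Z) ⋙ toPSh) .one ≫ α.hom = g →
      ∀ O : Opens Y.carrier, Function.Injective (g.c.app (op O)) := by
    rintro Y α _ rfl O
    rw [PresheafedSpace.comp_c_app]
    have : IsIso α.hom.c := inferInstance
    exact (colimit_sections_injective _ _).comp (ConcreteCategory.bijective_of_isIso _).1
  exact key (coeqIso τ) _ (ι_coeqIso_hom τ) O

lemma coequalizer_lift (O : Opens (coequalizer τ (𝟙 Z)).toTopCat)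
    (s : Z.presheaf.obj (op ((Opens.map (coequalizer.π τ (𝟙 Z)).base).obj O)))
    (hO : (Opens.map τ.base).obj ((Opens.map (coequalizer.π τ (𝟙 Z)).base).obj O) ≤
      (Opens.map (coequalizer.π τ (𝟙 Z)).base).obj O)
    (hs : τ.c.app (op ((Opens.map (coequalizer.π τ (𝟙 Z)).base).obj O)) s =
      Z.presheaf.map (homOfLE hO).op s) :
    ∃ t, (coequalizer.π τ (𝟙 Z)).c.app (op O) t = s := by
  have key : ∀ {Y : PresheafedSpace CommRingCat.{0}}
      (α : colimit (parallelPair τ (𝟙 Z) ⋙ toPSh) ≅ Y)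
      (g : Z.toPresheafedSpace ⟶ Y), colimit.ι (parallelPair τ (𝟙 Z) ⋙ toPSh) .one ≫ α.hom = g →
      ∀ (O : Opens Y.carrier) (s : Z.presheaf.obj (op ((Opens.map g.base).obj O)))
        (hO : (Opens.map τ.base).obj ((Opens.map g.base).obj O) ≤ (Opens.map g.base).obj O)
        (_ : τ.c.app (op ((Opens.map g.base).obj O)) s = Z.presheaf.map (homOfLE hO).op s),
        ∃ t, g.c.app (op O) t = s := by
    rintro Y α _ rfl O s hO hs
    obtain ⟨t, ht⟩ := colimit_sections_lift (parallelPair τ (𝟙 Z) ⋙ toPSh)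
      ((Opens.map α.hom.base).obj O) s (by
        change Z.presheaf.map _ (τ.c.app _ s) = Z.presheaf.map _ s
        erw [hs]
        exact presheaf_map_map Z.presheaf _ _ _ s)
    have : IsIso α.hom.c := inferInstance
    obtain ⟨t', rfl⟩ := (ConcreteCategory.bijective_of_isIso (α.hom.c.app (op O))).2 t
    exact ⟨t', ht⟩
  exact key (coeqIso τ) _ (ι_coeqIso_hom τ) O s hO hs

lemma isColimit_coequalizer_map {C : Type*} [Category C] (F : LocallyRingedSpace.{0} ⥤ C)
    [PreservesColimit (parallelPair τ (𝟙 Z)) F] :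
    Nonempty (IsColimit (Cofork.ofπ (F.map (coequalizer.π τ (𝟙 Z)))
      (by rw [← F.map_comp, coequalizer.condition, F.map_comp]) :
        Cofork (F.map τ) (F.map (𝟙 Z)))) :=
  ⟨isColimitCoforkMapOfIsColimit F _ (coequalizerIsCoequalizer τ (𝟙 Z))⟩

lemma coequalizer_isQuotientMap : Topology.IsQuotientMap (coequalizer.π τ (𝟙 Z)).base := by
  let F := LocallyRingedSpace.forgetToSheafedSpace ⋙ SheafedSpace.forget CommRingCat.{0}
  obtain ⟨h⟩ := isColimit_coequalizer_map τ F
  have : Epi (F.map (coequalizer.π τ (𝟙 Z))) := epi_of_isColimit_cofork h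
  rw [Topology.isQuotientMap_iff]
  exact ⟨⟨TopologicalSpace.ext_iff.2 fun U => TopCat.isOpen_iff_of_isColimit_cofork _ h U⟩,
    (TopCat.epi_iff_surjective _).1 this⟩

lemma coequalizer_preimage_image (V : Set Z.toTopCat) (hV : τ.base ⁻¹' V = V) :
    (coequalizer.π τ (𝟙 Z)).base ⁻¹' ((coequalizer.π τ (𝟙 Z)).base '' V) = V := by
  let F := LocallyRingedSpace.forgetToSheafedSpace ⋙ SheafedSpace.forget CommRingCat.{0} ⋙
    forget TopCat
  obtain ⟨h⟩ := isColimit_coequalizer_map τ F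
  refine Types.coequalizer_preimage_image_eq_of_preimage_eq (F.map τ) (F.map (𝟙 Z)) _ _ h V ?_
  exact hV

lemma isQuot_coequalizer : IsQuot τ (coequalizer.π τ (𝟙 Z)) where
  invariant := by rw [coequalizer.condition, Category.id_comp]
  isQuotientMap := coequalizer_isQuotientMap τ
  injective := coequalizer_injective τ
  lift := coequalizer_lift τ

/-! ### Quotients by an endomorphism -/

section
variable {X Y Z : LocallyRingedSpace.{0}}

lemma c_app_congr {f g : X ⟶ Y} (h : f = g) (O : Opens Y.toTopCat) (s : Y.presheaf.obj (op O)) :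
    X.presheaf.map (eqToHom (by rw [h]) :
        op ((Opens.map f.base).obj O) ⟶ op ((Opens.map g.base).obj O)) (f.c.app (op O) s) =
      g.c.app (op O) s := by
  subst h
  simp

lemma c_app_naturality (f : X ⟶ Y) {O O' : (Opens Y.toTopCat)ᵒᵖ} (i : O ⟶ O')
    (s : Y.presheaf.obj O) :
    f.c.app O' (Y.presheaf.map i s) =
      X.presheaf.map ((Opens.map f.base).op.map i) (f.c.app O s) :=
  ConcreteCategory.congr_hom (f.c.naturality i) s

lemma presheaf_map_isIso {T : TopCat.{0}} (F : T.Presheaf CommRingCat.{0}) {U V : (Opens T)ᵒᵖ}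
    (h : U = V) (i : U ⟶ V) : IsIso (F.map i) := by
  have : i = eqToHom h := Subsingleton.elim _ _
  rw [this]
  infer_instance

lemma presheaf_map_map_map {T : TopCat.{0}} (F : T.Presheaf CommRingCat.{0})
    {U V W V' W' : (Opens T)ᵒᵖ} (i : U ⟶ V) (j : V ⟶ W) (k : W ⟶ W') (i' : U ⟶ V') (j' : V' ⟶ W')
    (s : F.obj U) : F.map k (F.map j (F.map i s)) = F.map j' (F.map i' s) := by
  simp only [← CommRingCat.comp_apply, ← F.map_comp]
  rfl

lemma isIso_c_app_of_range_le (f : X ⟶ Y) [hf : LocallyRingedSpace.IsOpenImmersion f]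
    (O : Opens Y.toTopCat)
    (hO : (O : Set Y.toTopCat) ⊆ Set.range f.base) : IsIso (f.c.app (op O)) := by
  have h := LocallyRingedSpace.IsOpenImmersion.app_inv_app' f O hO
  have : IsIso (f.c.app (op O) ≫ hf.invApp _ ((Opens.map f.base).obj O)) := by
    rw [h]
    have e : O = hf.base_open.isOpenMap.functor.obj ((Opens.map f.base).obj O) :=
      SetLike.coe_injective (le_antisymm (fun x hx => by
        obtain ⟨y, rfl⟩ := hO hx
        exact ⟨y, hx, rfl⟩) (Set.image_preimage_subset f.base O.1))
    exact presheaf_map_isIso Y.presheaf (congrArg op e) _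
  exact IsIso.of_isIso_comp_right _ (hf.invApp _ ((Opens.map f.base).obj O))

lemma presheaf_map_injective {T : TopCat.{0}} (F : T.Presheaf CommRingCat.{0}) {U V : (Opens T)ᵒᵖ}
    (h : U = V) (i : U ⟶ V) : Function.Injective (F.map i) := by
  have := presheaf_map_isIso F h i
  exact (ConcreteCategory.bijective_of_isIso _).1

/-- Quotients restrict to open subspaces: if `j` is a `τ`-equivariant open immersion with saturated
range, then its source has as quotient the open image of that range. -/
lemma IsQuot.restrict {Q : LocallyRingedSpace.{0}} {σ : X ⟶ X} {π : X ⟶ Q} (h : IsQuot σ π)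
    (j : Z ⟶ X) [LocallyRingedSpace.IsOpenImmersion j] {τ : Z ⟶ Z} (hτ : τ ≫ j = j ≫ σ)
    (hsat : π.base ⁻¹' (π.base '' Set.range j.base) = Set.range j.base)
    (U : Opens Q.toTopCat) (hU : (U : Set Q.toTopCat) = π.base '' Set.range j.base)
    (ρ : Z ⟶ Q.restrict U.isOpenEmbedding)
    (hρ : ρ ≫ Q.ofRestrict U.isOpenEmbedding = j ≫ π) : IsQuot τ ρ := by
  let ι := Q.ofRestrict U.isOpenEmbedding
  have hι : Set.range ι.base = (U : Set Q.toTopCat) := Subtype.range_coe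
  have hιj : Function.Injective ι.base := U.isOpenEmbedding.injective
  have hb : ∀ z, ι.base (ρ.base z) = π.base (j.base z) := fun z =>
    ConcreteCategory.congr_hom (congrArg (fun f => f.base) hρ) z
  have hO : ∀ O : Opens (Q.restrict U.isOpenEmbedding).toTopCat, ∃ N : Opens Q.toTopCat,
      O = (Opens.map ι.base).obj N ∧ N ≤ U := by
    intro O
    refine ⟨U.isOpenEmbedding.isOpenMap.functor.obj O, ?_, ?_⟩
    · ext x
      constructor
      · intro hx
        exact ⟨x, hx, rfl⟩
      · rintro ⟨y, hy, hyx⟩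
        rwa [← hιj hyx]
    · rintro _ ⟨x, _, rfl⟩
      exact x.2
  have hinv : τ ≫ ρ = ρ := by
    have : Mono ι := inferInstance
    rw [← cancel_mono ι]
    rw [Category.assoc, hρ, ← Category.assoc, hτ, Category.assoc, h.invariant]
  have hjN : ∀ N : Opens Q.toTopCat, N ≤ U →
      ((((Opens.map π.base).obj N)) : Set X.toPresheafedSpace) ⊆ Set.range j.base := by
    intro N hN x hx
    rw [← hsat]
    have : π.base x ∈ (U : Set Q.toTopCat) := hN hx
    rw [hU] at this
    exact this
  have hc : ∀ (N : Opens Q.toTopCat) (t : Q.presheaf.obj (op N)),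
      Z.presheaf.map (eqToHom (by
        change op ((Opens.map (ρ ≫ ι).base).obj N) = op ((Opens.map (j ≫ π).base).obj N)
        rw [hρ]) : op ((Opens.map ρ.base).obj ((Opens.map ι.base).obj N)) ⟶
          op ((Opens.map j.base).obj ((Opens.map π.base).obj N)))
        (ρ.c.app (op ((Opens.map ι.base).obj N)) (ι.c.app (op N) t)) =
      j.c.app (op ((Opens.map π.base).obj N)) (π.c.app (op N) t) := fun N t =>
    c_app_congr hρ N t
  refine ⟨hinv, ?_, ?_, ?_⟩
  · rw [Topology.isQuotientMap_iff]
    refine ⟨.of_isOpen_preimage_iff_isOpen fun V => ⟨fun hV => ?_,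
      fun hV => hV.preimage ρ.base.hom.continuous⟩, ?_⟩
    · have h1 : IsOpen (j.base '' (ρ.base ⁻¹' V)) :=
        (‹LocallyRingedSpace.IsOpenImmersion j›.base_open).isOpenMap _ hV
      have h2 : j.base '' (ρ.base ⁻¹' V) = π.base ⁻¹' (ι.base '' V) := by
        ext x
        constructor
        · rintro ⟨z, hz, rfl⟩
          exact ⟨ρ.base z, hz, hb z⟩
        · rintro ⟨v, hv, hvx⟩
          have : x ∈ Set.range j.base := by
            rw [← hsat]
            have h4 : π.base x ∈ Set.range ι.base := ⟨v, hvx⟩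
            rw [hι, hU] at h4
            exact h4
          obtain ⟨z, rfl⟩ := this
          refine ⟨z, ?_, rfl⟩
          rw [← hb] at hvx
          change ρ.base z ∈ V
          rwa [← hιj hvx]
      rw [h2, h.isQuotientMap.isOpen_preimage] at h1
      have h3 : V = ι.base ⁻¹' (ι.base '' V) := (Set.preimage_image_eq _ hιj).symm
      rw [h3]
      exact h1.preimage ι.base.hom.continuous
    · intro w
      have : ι.base w ∈ (U : Set Q.toTopCat) := by rw [← hι]; exact ⟨w, rfl⟩
      rw [hU] at this
      obtain ⟨_, ⟨z, rfl⟩, hz⟩ := this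
      exact ⟨z, hιj ((hb z).trans hz)⟩
  · intro O
    obtain ⟨N, rfl, hN⟩ := hO O
    have i1 := isIso_c_app_of_range_le ι N (by rw [hι]; exact hN)
    have i2 := isIso_c_app_of_range_le j _ (hjN N hN)
    intro a b hab
    obtain ⟨a, rfl⟩ := (ConcreteCategory.bijective_of_isIso (ι.c.app (op N))).2 a
    obtain ⟨b, rfl⟩ := (ConcreteCategory.bijective_of_isIso (ι.c.app (op N))).2 b
    have h1 := hc N a
    rw [hab, hc N b] at h1
    rw [h.injective N ((ConcreteCategory.bijective_of_isIso (j.c.app (op _))).1 h1)]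
  · intro O s hle hs
    obtain ⟨N, rfl, hN⟩ := hO O
    have i2 := isIso_c_app_of_range_le j _ (hjN N hN)
    have hE : (Opens.map ρ.base).obj ((Opens.map ι.base).obj N) =
        (Opens.map j.base).obj ((Opens.map π.base).obj N) := by
      change ((Opens.map (ρ ≫ ι).base).obj N) = ((Opens.map (j ≫ π).base).obj N)
      rw [hρ]
    obtain ⟨s', hs'⟩ := (ConcreteCategory.bijective_of_isIso
      (j.c.app (op ((Opens.map π.base).obj N)))).2
      (Z.presheaf.map (eqToHom (congrArg op hE)) s)
    have hσ : (Opens.map σ.base).obj ((Opens.map π.base).obj N) = (Opens.map π.base).obj N := by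
      change (Opens.map (σ ≫ π).base).obj N = _
      rw [h.invariant]
    have i3 := isIso_c_app_of_range_le j ((Opens.map σ.base).obj ((Opens.map π.base).obj N))
      (by rw [hσ]; exact hjN N hN)
    obtain ⟨t, ht⟩ := h.lift N s' hσ.le (by
      apply (ConcreteCategory.bijective_of_isIso
        (j.c.app (op ((Opens.map σ.base).obj ((Opens.map π.base).obj N))))).1
      rw [c_app_naturality]
      have e1 := c_app_congr hτ ((Opens.map π.base).obj N) s'
      have e2 : (j ≫ σ).c.app (op ((Opens.map π.base).obj N)) s' =
        j.c.app (op ((Opens.map σ.base).obj ((Opens.map π.base).obj N)))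
          (σ.c.app (op ((Opens.map π.base).obj N)) s') := rfl
      have e3 : (τ ≫ j).c.app (op ((Opens.map π.base).obj N)) s' =
        τ.c.app (op ((Opens.map j.base).obj ((Opens.map π.base).obj N)))
          (j.c.app (op ((Opens.map π.base).obj N)) s') := rfl
      rw [e2, e3, hs', c_app_naturality, hs] at e1
      rw [← e1, hs']
      exact presheaf_map_map_map Z.presheaf _ _ _ _ _ s)
    refine ⟨ι.c.app (op N) t, presheaf_map_injective Z.presheaf (congrArg op hE)
      (eqToHom (congrArg op hE)) ?_⟩
    rw [hc, ht, hs']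

lemma c_app_of_comp_eq {W : LocallyRingedSpace.{0}} {τ : Z ⟶ Z} {ρ : Z ⟶ W} (h : τ ≫ ρ = ρ)
    (O : Opens W.toTopCat) (t : W.presheaf.obj (op O))
    (hO : (Opens.map τ.base).obj ((Opens.map ρ.base).obj O) ≤ (Opens.map ρ.base).obj O) :
    τ.c.app (op ((Opens.map ρ.base).obj O)) (ρ.c.app (op O) t) =
      Z.presheaf.map (homOfLE hO).op (ρ.c.app (op O) t) := by
  have h1 := c_app_congr h O t
  apply presheaf_map_injective Z.presheaf
    (congrArg op (congrArg (fun f => (Opens.map f.base).obj O) h))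
    (eqToHom (congrArg op (congrArg (fun f => (Opens.map f.base).obj O) h)))
  refine h1.trans ?_
  refine Eq.trans ?_ (presheaf_map_map Z.presheaf _ _ (𝟙 _) _).symm
  rw [Z.presheaf.map_id]
  rfl

/-- Recognition of a quotient: a morphism `g` from the quotient is an isomorphism if its composition
`p` with the quotient map is a topological quotient map which does not identify points with
different images in the quotient, and if the sections over a basis of open subsets are the invariant
ones. -/
lemma IsQuot.isIso {W Y : LocallyRingedSpace.{0}} {τ : Z ⟶ Z} {ρ : Z ⟶ W} (h : IsQuot τ ρ)
    (g : W ⟶ Y) (p : Z ⟶ Y) (hp : ρ ≫ g = p) (hq : Topology.IsQuotientMap p.base)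
    (hfib : ∀ z z', p.base z = p.base z' → ρ.base z = ρ.base z')
    {ι : Type} {B : ι → Opens Y.toTopCat} (hB : Opens.IsBasis (Set.range B))
    (hinj : ∀ i, Function.Injective (p.c.app (op (B i))))
    (hlift : ∀ i (s : Z.presheaf.obj (op ((Opens.map p.base).obj (B i))))
      (hO : (Opens.map τ.base).obj ((Opens.map p.base).obj (B i)) ≤ (Opens.map p.base).obj (B i)),
      τ.c.app (op ((Opens.map p.base).obj (B i))) s = Z.presheaf.map (homOfLE hO).op s →
      ∃ t, p.c.app (op (B i)) t = s) : IsIso g := by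
  subst hp
  have hginj : Function.Injective g.base := by
    intro w w' hw
    obtain ⟨z, rfl⟩ := h.isQuotientMap.surjective w
    obtain ⟨z', rfl⟩ := h.isQuotientMap.surjective w'
    exact hfib z z' hw
  have hgq : Topology.IsQuotientMap g.base :=
    Topology.IsQuotientMap.of_comp_isQuotientMap (f := ρ.base) h.isQuotientMap hq
  have h1 : IsIso g.base := by
    rw [TopCat.isIso_iff_isHomeomorph]
    exact ⟨g.base.hom.continuous, by
      intro V hV
      rw [← hgq.isOpen_preimage]
      erw [Set.preimage_image_eq _ hginj]
      exact hV, hginj, hgq.surjective⟩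
  have h2 : IsIso g.c := by
    have h3 : ∀ i, IsIso (g.c.app (op (B i))) := by
      intro i
      rw [ConcreteCategory.isIso_iff_bijective]
      refine ⟨fun a b hab => hinj i (congrArg (ρ.c.app _) hab), fun t => ?_⟩
      obtain ⟨y, hy⟩ := hlift i (ρ.c.app _ t) (by
          change (Opens.map (τ ≫ ρ).base).obj ((Opens.map g.base).obj (B i)) ≤ _
          rw [h.invariant]
          exact le_rfl) (by
        exact c_app_of_comp_eq h.invariant _ t _)
      exact ⟨y, h.injective _ hy⟩
    let φ : Y.𝒪 ⟶ (TopCat.Sheaf.pushforward _ g.base).obj W.𝒪 := ⟨g.c⟩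
    have : IsIso φ := TopCat.Sheaf.isIso_iff_isIso_basis hB h3
    exact Functor.map_isIso (TopCat.Sheaf.forget _ _) φ
  have h4 : @IsIso (PresheafedSpace CommRingCat.{0}) _ W.toPresheafedSpace
      Y.toPresheafedSpace g.toHom :=
    @PresheafedSpace.isIso_of_components _ _ _ _ g.toHom h1 h2
  have h5 : IsIso (toPSh.map g) := h4
  exact isIso_of_reflects_iso g toPSh

lemma exists_commRingCat_lift {R S T : CommRingCat.{0}} (a : S ⟶ T) (r : R ⟶ T)
    (hr : Function.Injective r) (ha : ∀ x, ∃ t, r t = a x) : ∃ b : S ⟶ R, b ≫ r = a := by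
  choose b hb using ha
  refine ⟨CommRingCat.ofHom
    { toFun := b
      map_one' := hr (by rw [hb, map_one, map_one])
      map_mul' := fun x y => hr (by rw [hb, map_mul, map_mul, hb, hb])
      map_zero' := hr (by rw [hb, map_zero, map_zero])
      map_add' := fun x y => hr (by rw [hb, map_add, map_add, hb, hb]) }, ?_⟩
  ext x
  exact hb x

/-- Invariant morphisms to affine schemes factor through the quotient, as they are given by global
functions. -/
lemma IsQuot.exists_desc_spec {W : LocallyRingedSpace.{0}} {τ : Z ⟶ Z} {ρ : Z ⟶ W} (h : IsQuot τ ρ)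
    (S : CommRingCat.{0}) (p : Z ⟶ (Spec S).toLocallyRingedSpace) (hp : τ ≫ p = p) :
    ∃ g : W ⟶ (Spec S).toLocallyRingedSpace, ρ ≫ g = p := by
  let adj := ΓSpec.locallyRingedSpaceAdjunction.{0}
  let p' : LocallyRingedSpace.Γ.rightOp.obj Z ⟶ op S := (adj.homEquiv Z (op S)).symm p
  have hp' : LocallyRingedSpace.Γ.rightOp.map τ ≫ p' = p' := by
    exact (adj.homEquiv_naturality_left_symm τ p).symm.trans
      (congrArg (adj.homEquiv Z (op S)).symm hp)
  let a : S ⟶ LocallyRingedSpace.Γ.obj (op Z) := p'.unop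
  let r : LocallyRingedSpace.Γ.obj (op W) ⟶ LocallyRingedSpace.Γ.obj (op Z) :=
    LocallyRingedSpace.Γ.map ρ.op
  have hr : Function.Injective r := h.injective ⊤
  have ha : ∀ x, ∃ t, r t = a x := by
    intro x
    have := ConcreteCategory.congr_hom (congrArg Quiver.Hom.unop hp') x
    refine h.lift ⊤ (a x) le_rfl ?_
    refine Eq.trans this ?_
    exact (ConcreteCategory.congr_hom (Z.presheaf.map_id _) _).symm
  obtain ⟨b', hb'⟩ := exists_commRingCat_lift a r hr ha
  let b'' : LocallyRingedSpace.Γ.rightOp.obj W ⟶ op S := b'.op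
  refine ⟨adj.homEquiv W (op S) b'', ?_⟩
  have : LocallyRingedSpace.Γ.rightOp.map ρ ≫ b'' = p' := congrArg Quiver.Hom.op hb'
  have h6 := adj.homEquiv_naturality_left ρ b''
  rw [this] at h6
  exact h6.symm.trans ((adj.homEquiv Z (op S)).apply_symm_apply p)

end

/-! ### Affine quotients by an automorphism of order three -/

lemma away_map_injective {S R S' R' : Type} [CommRing S] [CommRing R] [CommRing S'] [CommRing R']
    [Algebra S S'] [Algebra R R'] {φ : S →+* R} (hφ : Function.Injective φ) (s : S)
    [IsLocalization.Away s S'] [IsLocalization.Away (φ s) R'] (p : S' →+* R')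
    (hp : ∀ x, p (algebraMap S S' x) = algebraMap R R' (φ x)) : Function.Injective p := by
  rw [injective_iff_map_eq_zero]
  intro a ha
  obtain ⟨n, x, hx⟩ := IsLocalization.Away.surj s a
  have h1 : algebraMap R R' (φ x) = algebraMap R R' 0 := by
    rw [← hp, ← hx, map_mul, ha, zero_mul, map_zero]
  obtain ⟨m, hm⟩ := IsLocalization.Away.exists_of_eq (φ s) h1
  rw [mul_zero, ← map_pow, ← map_mul, ← map_zero φ] at hm
  have h2 : algebraMap S S' (s ^ m * x) = 0 := by rw [hφ hm, map_zero]
  rw [map_mul, map_pow, ← hx] at h2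
  have hu : IsUnit (algebraMap S S' s) := IsLocalization.Away.algebraMap_isUnit s
  rwa [(hu.pow m).mul_right_eq_zero, (hu.pow n).mul_left_eq_zero] at h2

/-- Taking the invariants of `σ` commutes with localization at an invariant element; `R'` and `R''`
are two models of the same localization of `R`. -/
lemma away_map_lift {S R S' R' R'' : Type} [CommRing S] [CommRing R] [CommRing S'] [CommRing R']
    [CommRing R''] [Algebra S S'] [Algebra R R'] [Algebra R R''] {φ : S →+* R} (s : S)
    [IsLocalization.Away s S'] [IsLocalization.Away (φ s) R'] [IsLocalization.Away (φ s) R'']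
    (p : S' →+* R') (hp : ∀ x, p (algebraMap S S' x) = algebraMap R R' (φ x))
    (σ : R →+* R) (hσ : ∀ x, σ (φ x) = φ x) (hinv : ∀ r, σ r = r → ∃ x, φ x = r)
    (τ ρ : R' →+* R'') (hτ : ∀ r, τ (algebraMap R R' r) = algebraMap R R'' (σ r))
    (hρ : ∀ r, ρ (algebraMap R R' r) = algebraMap R R'' r) (a : R') (ha : τ a = ρ a) :
    ∃ t, p t = a := by
  obtain ⟨n, y, hy⟩ := IsLocalization.Away.surj (φ s) a
  have h1 : algebraMap R R'' (σ y) = algebraMap R R'' y := by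
    rw [← hτ, ← hρ, ← hy, map_mul, map_mul, ha, map_pow, map_pow, hτ, hρ, hσ]
  obtain ⟨m, hm⟩ := IsLocalization.Away.exists_of_eq (φ s) h1
  obtain ⟨x, hx⟩ := hinv (φ s ^ m * y) (by rw [map_mul, map_pow, hσ, hm])
  have hu : IsUnit (algebraMap S S' s) := IsLocalization.Away.algebraMap_isUnit s
  have hu' : IsUnit (algebraMap R R' (φ s)) := IsLocalization.Away.algebraMap_isUnit (φ s)
  obtain ⟨v, hv⟩ := (hu.pow (n + m)).exists_left_inv
  refine ⟨v * algebraMap S S' x, ?_⟩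
  apply (hu'.pow (n + m)).mul_left_injective
  have hv' := congrArg p hv
  simp only [map_mul, map_pow, hp, map_one] at hv' ⊢
  calc _ = (p v * algebraMap R R' (φ s) ^ (n + m)) * algebraMap R R' (φ x) := by ring
    _ = _ := by rw [hv', hx, map_mul, ← hy, map_pow]; ring

lemma spec_map_c_app_algebraMap {R S : CommRingCat.{0}} (φ : S ⟶ R) (U : (Spec S).Opens) (s : S) :
    (Spec.map φ).c.app (op U) (algebraMap S ((Spec S).presheaf.obj (op U)) s) =
      algebraMap R ((Spec R).presheaf.obj (op ((Opens.map (Spec.map φ).base).obj U))) (φ s) := by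
  exact ConcreteCategory.congr_hom (StructureSheaf.toOpen_comp_comap φ.hom U) s

/-- The principal open subset of a spectrum, as an open subset of the scheme. -/
abbrev specBasic {R : CommRingCat.{0}} (f : R) : (Spec R).Opens := PrimeSpectrum.basicOpen f

lemma isLocalization_specBasic {R : CommRingCat.{0}} (f : R) :
    IsLocalization.Away f ((Spec R).presheaf.obj (op (specBasic f))) :=
  StructureSheaf.IsLocalization.to_basicOpen R f

lemma isLocalization_specBasic' {R : CommRingCat.{0}} (f : R) (U : (Spec R).Opens)
    (hU : U = specBasic f) : IsLocalization.Away f ((Spec R).presheaf.obj (op U)) := by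
  subst hU
  exact isLocalization_specBasic f

open Pointwise in
/-- If `S` is the ring of invariants of an automorphism of `R` of order dividing three, then `R` is
integral over `S`, and the fibres of `Spec R ⟶ Spec S` are orbits. -/
lemma exists_pow_comap_eq {R S : Type} [CommRing R] [CommRing S] (φ : S →+* R) (σ : R ≃+* R)
    (h3 : σ ^ 3 = 1) (hσ : ∀ x, σ (φ x) = φ x) (hinv : ∀ r, σ r = r → ∃ x, φ x = r) :
    φ.IsIntegral ∧ ∀ P Q : PrimeSpectrum R, P.comap φ = Q.comap φ →
      ∃ n : ℕ, P = (PrimeSpectrum.comap (σ : R →+* R))^[n] Q := by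
  let _ := φ.toAlgebra
  let G := Subgroup.zpowers σ
  have hG : ∀ g : G, ∃ n : ℕ, (g : R ≃+* R) = σ ^ n := by
    rintro ⟨g, hg⟩
    have := (isOfFinOrder_iff_pow_eq_one.2 ⟨3, by norm_num, h3⟩).mem_powers_iff_mem_zpowers.2 hg
    obtain ⟨n, hn⟩ := this
    exact ⟨n, hn.symm⟩
  have hGf : Finite G := by
    have := (isOfFinOrder_iff_pow_eq_one.2 ⟨3, by norm_num, h3⟩)
    exact Nat.finite_of_card_ne_zero (by
      rw [Nat.card_zpowers]; exact this.orderOf_pos.ne')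
  have hsm : ∀ (g : G) (r : R), g • r = (g : R ≃+* R) r := fun _ _ => rfl
  have hfix : ∀ (n : ℕ) (r : R), σ r = r → (σ ^ n) r = r := by
    intro n r hr
    induction n with
    | zero => rfl
    | succ n ih => rw [pow_succ, RingAut.mul_apply, hr, ih]
  have : SMulCommClass G S R := ⟨fun g s r => by
    rw [Algebra.smul_def, Algebra.smul_def, smul_mul']
    congr 1
    obtain ⟨n, hn⟩ := hG g
    rw [hsm, hn]
    exact hfix n _ (hσ s)⟩
  have hI : Algebra.IsInvariant S R G := ⟨fun b hb => hinv b (hb ⟨σ, Subgroup.mem_zpowers σ⟩)⟩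
  refine ⟨fun r => (Algebra.IsInvariant.isIntegral S R G).isIntegral r, fun P Q hPQ => ?_⟩
  obtain ⟨g, hg⟩ := Algebra.IsInvariant.exists_smul_of_under_eq S R G P.asIdeal Q.asIdeal
    (congrArg PrimeSpectrum.asIdeal hPQ)
  obtain ⟨n, hn⟩ := hG g
  refine ⟨n, ?_⟩
  have hit : ∀ (n : ℕ) (Q : PrimeSpectrum R) (r : R),
      r ∈ ((PrimeSpectrum.comap (σ : R →+* R))^[n] Q).asIdeal ↔ (σ ^ n) r ∈ Q.asIdeal := by
    intro n
    induction n with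
    | zero => exact fun _ _ => Iff.rfl
    | succ n ih =>
      intro Q r
      rw [Function.iterate_succ_apply, ih, pow_succ', RingAut.mul_apply]
      rfl
  ext r
  rw [hit, hg, ← hn, ← hsm, Ideal.smul_mem_pointwise_smul_iff]

/-- Let `Spec R` be an affine open subscheme of `X` which is stable under `τ`, and let `S` be the
ring of invariants of `R`. Then the coequalizer of `τ` and the identity contains `Spec S`, as the
open image of `Spec R`. -/
lemma exists_quotient_iso {R S : CommRingCat.{0}} (φ : S ⟶ R) (hφ : Function.Injective φ)
    (σ : (R : Type) ≃+* R) (h3 : σ ^ 3 = 1) (hσ : ∀ x, σ (φ x) = φ x)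
    (hinv : ∀ r, σ r = r → ∃ x, φ x = r) {X : Scheme.{0}} (τ : X ⟶ X) (j : Spec R ⟶ X)
    [IsOpenImmersion j] (hj : Spec.map (CommRingCat.ofHom (σ : R →+* R)) ≫ j = j ≫ τ)
    (hrange : τ.base ⁻¹' Set.range j.base = Set.range j.base) :
    ∃ (U : Opens (coequalizer τ.toLRSHom (𝟙 X.toLocallyRingedSpace)).toTopCat)
      (g : (coequalizer τ.toLRSHom (𝟙 X.toLocallyRingedSpace)).restrict U.isOpenEmbedding ≅
        (Spec S).toLocallyRingedSpace)
      (ρ : (Spec R).toLocallyRingedSpace ⟶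
        (coequalizer τ.toLRSHom (𝟙 X.toLocallyRingedSpace)).restrict U.isOpenEmbedding),
      (U : Set (coequalizer τ.toLRSHom (𝟙 X.toLocallyRingedSpace)).toTopCat) =
        (coequalizer.π τ.toLRSHom (𝟙 X.toLocallyRingedSpace)).base '' Set.range j.base ∧
      ρ ≫ LocallyRingedSpace.ofRestrict _ _ = j.toLRSHom ≫ coequalizer.π _ _ ∧
      ρ ≫ g.hom = (Spec.map φ).toLRSHom := by
  let Q := coequalizer τ.toLRSHom (𝟙 X.toLocallyRingedSpace)
  let π : X.toLocallyRingedSpace ⟶ Q := coequalizer.π τ.toLRSHom (𝟙 X.toLocallyRingedSpace)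
  have hπ : IsQuot τ.toLRSHom π := isQuot_coequalizer τ.toLRSHom
  have hsat : π.base ⁻¹' (π.base '' Set.range j.base) = Set.range j.base :=
    coequalizer_preimage_image τ.toLRSHom _ hrange
  have hopen : IsOpen (π.base '' Set.range j.base) := by
    rw [← hπ.isQuotientMap.isOpen_preimage, hsat]
    exact j.isOpenEmbedding.isOpen_range
  let U : Opens Q.toTopCat := ⟨_, hopen⟩
  have : LocallyRingedSpace.IsOpenImmersion j.toLRSHom := ‹IsOpenImmersion j›
  let ρ : (Spec R).toLocallyRingedSpace ⟶ Q.restrict U.isOpenEmbedding :=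
    LocallyRingedSpace.IsOpenImmersion.lift (Q.ofRestrict U.isOpenEmbedding) (j.toLRSHom ≫ π) (by
      rintro _ ⟨z, rfl⟩
      exact ⟨⟨_, ⟨_, ⟨z, rfl⟩, rfl⟩⟩, rfl⟩)
  have hρ : ρ ≫ Q.ofRestrict U.isOpenEmbedding = j.toLRSHom ≫ π :=
    LocallyRingedSpace.IsOpenImmersion.lift_fac _ _ _
  let t := Spec.map (CommRingCat.ofHom (σ : R →+* R))
  have hq : IsQuot t.toLRSHom ρ :=
    hπ.restrict j.toLRSHom (congrArg Scheme.Hom.toLRSHom hj) hsat U rfl ρ hρ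
  have htp : t ≫ Spec.map φ = Spec.map φ := by
    rw [← Spec.map_comp]
    congr 1
    ext x
    exact hσ x
  obtain ⟨hint, hfib⟩ := exists_pow_comap_eq φ.hom σ h3 hσ hinv
  obtain ⟨g, hg⟩ := hq.exists_desc_spec S (Spec.map φ).toLRSHom (congrArg Scheme.Hom.toLRSHom htp)
  have hB : Opens.IsBasis (Set.range (fun s : S => specBasic s)) :=
    PrimeSpectrum.isBasis_basic_opens
  have hiso : IsIso g := by
    refine hq.isIso g (Spec.map φ).toLRSHom hg ?_ ?_ hB ?_ ?_
    · exact (PrimeSpectrum.isClosedMap_comap_of_isIntegral φ.hom hint).isQuotientMap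
        (PrimeSpectrum.continuous_comap _) (RingHom.IsIntegral.comap_surjective hint hφ)
    · intro z z' hz
      obtain ⟨n, rfl⟩ := hfib z z' hz
      clear hz
      induction n with
      | zero => rfl
      | succ n ih =>
        refine (congrArg ρ.base (Function.iterate_succ_apply' _ n z')).trans (Eq.trans ?_ ih)
        exact ConcreteCategory.congr_hom (congrArg (fun f => f.base) hq.invariant) _
    · intro s
      have i1 := isLocalization_specBasic s
      have i2 : IsLocalization.Away (φ s) _ :=
        isLocalization_specBasic' (φ s) ((Opens.map (Spec.map φ).base).obj (specBasic s)) rfl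
      exact away_map_injective (φ := φ.hom) (S' := (Spec S).presheaf.obj (op (specBasic s)))
        (R' := (Spec R).presheaf.obj (op ((Opens.map (Spec.map φ).base).obj (specBasic s)))) hφ s
        ((Spec.map φ).c.app (op (specBasic s))).hom
        (spec_map_c_app_algebraMap φ _)
    · intro s a hO ha
      have i1 := isLocalization_specBasic s
      have i2 : IsLocalization.Away (φ.hom s) _ :=
        isLocalization_specBasic' (φ s) ((Opens.map (Spec.map φ).base).obj (specBasic s)) rfl
      have i3 : IsLocalization.Away (φ.hom s) _ :=
        isLocalization_specBasic' (φ s) ((Opens.map t.base).obj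
          ((Opens.map (Spec.map φ).base).obj (specBasic s))) (by
            change (Opens.map (t ≫ Spec.map φ).base).obj (specBasic s) = _
            rw [htp]
            rfl)
      refine away_map_lift (φ := φ.hom) (S' := (Spec S).presheaf.obj (op (specBasic s)))
        (R' := (Spec R).presheaf.obj (op ((Opens.map (Spec.map φ).base).obj (specBasic s))))
        (R'' := (Spec R).presheaf.obj (op ((Opens.map t.base).obj
          ((Opens.map (Spec.map φ).base).obj (specBasic s))))) s
        ((Spec.map φ).c.app (op (specBasic s))).hom
        (spec_map_c_app_algebraMap φ _) (σ : R →+* R) hσ hinv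
        (t.c.app (op ((Opens.map (Spec.map φ).base).obj (specBasic s)))).hom
        ((Spec R).presheaf.map (homOfLE hO).op).hom ?_ (fun _ => rfl) a ha
      exact spec_map_c_app_algebraMap (CommRingCat.ofHom (σ : R →+* R)) _
  exact ⟨U, asIso g, ρ, rfl, hρ, hg⟩

/-! ### Normal forms of configurations and their moduli -/

section
variable {k m : ℕ} {A B : Type} [CommRing A] [CommRing B]

lemma isUnit_minorProd_iff (N : Matrix (Fin k) (Fin m) A) :
    IsUnit (minorProd N) ↔ GeneralPosition N := by
  simp [minorProd, GeneralPosition]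

lemma map_minorProd (f : A →+* B) (N : Matrix (Fin k) (Fin m) A) :
    f (minorProd N) = minorProd (N.map f) := by
  simp only [minorProd, map_prod, RingHom.map_det]
  rfl

lemma ConfigEquiv.generalPosition {N N' : Matrix (Fin k) (Fin m) A} (h : ConfigEquiv N N')
    (hN : GeneralPosition N) : GeneralPosition N' := by
  obtain ⟨g, t, rfl⟩ := h
  intro e
  have h1 : ((g : Matrix (Fin k) (Fin k) A) * N *
      Matrix.diagonal fun j => (t j : A)).submatrix id e =
      (g : Matrix (Fin k) (Fin k) A) * N.submatrix id e *
        Matrix.diagonal fun j => (t (e j) : A) := by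
    ext i j
    rw [Matrix.submatrix_apply, Matrix.mul_diagonal, Matrix.mul_diagonal, Matrix.mul_apply,
      Matrix.mul_apply]
    rfl
  rw [h1, Matrix.det_mul, Matrix.det_mul, Matrix.det_diagonal]
  exact ((Matrix.isUnits_det_units g).mul (hN e)).mul
    ((IsUnit.prod_univ_iff).2 fun j => (t (e j)).isUnit)

lemma ConfigEquiv.symm {N N' : Matrix (Fin k) (Fin m) A} (h : ConfigEquiv N N') :
    ConfigEquiv N' N := by
  obtain ⟨g, t, rfl⟩ := h
  refine ⟨g⁻¹, t⁻¹, ?_⟩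
  rw [← Matrix.mul_assoc, ← Matrix.mul_assoc, ← Units.val_mul, inv_mul_cancel, Units.val_one,
    Matrix.one_mul, Matrix.mul_assoc, Matrix.diagonal_mul_diagonal]
  simp

lemma ConfigEquiv.trans {N N' N'' : Matrix (Fin k) (Fin m) A} (h : ConfigEquiv N N')
    (h' : ConfigEquiv N' N'') : ConfigEquiv N N'' := by
  obtain ⟨g, t, rfl⟩ := h
  obtain ⟨g', t', rfl⟩ := h'
  refine ⟨g' * g, t * t', ?_⟩
  simp only [Units.val_mul, Matrix.mul_assoc, Matrix.diagonal_mul_diagonal, Pi.mul_apply]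

lemma configEquiv_inv_mul (g : GL (Fin k) A) (N : Matrix (Fin k) (Fin m) A) :
    ConfigEquiv N (((g⁻¹ : GL (Fin k) A) : Matrix (Fin k) (Fin k) A) * N) :=
  ⟨g⁻¹, 1, by simp⟩

end

section

/-- A normal form `F A a b c` for configurations, compatible with base change, yields a moduli space
if every configuration in general position has a normal form, and the parameters `a, b, c` are
unique. -/
theorem isModuliSpace_of_normalForm {k : ℕ}
    (F : ∀ (A : Type) [CommRing A], A → A → A → Matrix (Fin k) (Fin 6) A)
    (hmap : ∀ (A B : Type) [CommRing A] [CommRing B] (f : A →+* B) (a b c : A),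
      (F A a b c).map f = F B (f a) (f b) (f c))
    (hex : ∀ (A : Type) [CommRing A] (N : Matrix (Fin k) (Fin 6) A), GeneralPosition N →
      ∃ a b c, ConfigEquiv (F A a b c) N)
    (huniq : ∀ (A : Type) [CommRing A] (a b c a' b' c' : A),
      ConfigEquiv (F A a b c) (F A a' b' c') → a = a' ∧ b = b' ∧ c = c')
    (L : Type) [CommRing L] [Algebra Param L] [Algebra ℂ L] [IsScalarTower ℂ Param L]
    [IsLocalization.Away
      (minorProd (F Param (MvPolynomial.X 0) (MvPolynomial.X 1) (MvPolynomial.X 2))) L] :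
    IsModuliSpace (F L (coord L 0) (coord L 1) (coord L 2)) := by
  have hgen : (F Param (MvPolynomial.X 0) (MvPolynomial.X 1) (MvPolynomial.X 2)).map
      (algebraMap Param L) = F L (coord L 0) (coord L 1) (coord L 2) := hmap _ _ _ _ _ _
  set d := minorProd (F Param (MvPolynomial.X 0) (MvPolynomial.X 1) (MvPolynomial.X 2)) with hd
  refine ⟨?_, ?_⟩
  · rw [← isUnit_minorProd_iff, ← hgen, ← map_minorProd]
    exact IsLocalization.Away.algebraMap_isUnit d
  · intro B _ _ N' hN'
    obtain ⟨a, b, c, habc⟩ := hex B N' hN'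
    let ψ : Param →ₐ[ℂ] B := MvPolynomial.aeval ![a, b, c]
    have hψ : IsUnit (ψ d) := by
      change IsUnit ((ψ : Param →+* B) d)
      rw [hd, map_minorProd, hmap, isUnit_minorProd_iff]
      simpa [ψ] using habc.symm.generalPosition hN'
    let φ : L →+* B := IsLocalization.Away.lift d (g := (ψ : Param →+* B)) hψ
    have hφ : ∀ x, φ (algebraMap Param L x) = ψ x := IsLocalization.Away.lift_eq d hψ
    let φ' : L →ₐ[ℂ] B := { φ with
      commutes' := fun r => by
        change φ _ = _
        rw [IsScalarTower.algebraMap_apply ℂ Param L, hφ]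
        exact ψ.commutes r }
    have hmapL : ∀ f : L →ₐ[ℂ] B, (F L (coord L 0) (coord L 1) (coord L 2)).map f =
        F B (f (coord L 0)) (f (coord L 1)) (f (coord L 2)) := fun f => hmap _ _ (f : L →+* B) _ _ _
    have hφ'c : ∀ i, φ' (coord L i) = ![a, b, c] i := fun i => by
      change φ _ = _
      rw [coord, hφ]
      exact MvPolynomial.aeval_X _ _
    refine ⟨φ', ?_, ?_⟩
    · change ConfigEquiv _ _
      rw [hmapL, hφ'c, hφ'c, hφ'c]
      exact habc
    · intro χ hχ
      change ConfigEquiv _ _ at hχ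
      rw [hmapL] at hχ
      obtain ⟨h0, h1, h2⟩ := huniq _ _ _ _ _ _ _ (hχ.trans habc.symm)
      have : (χ : L →+* B) = φ' := by
        apply IsLocalization.ringHom_ext (Submonoid.powers d)
        have h3 : (χ : L →ₐ[ℂ] B).comp (IsScalarTower.toAlgHom ℂ Param L) =
            φ'.comp (IsScalarTower.toAlgHom ℂ Param L) := by
          apply MvPolynomial.algHom_ext
          intro i
          change χ (coord L i) = φ' (coord L i)
          rw [hφ'c]
          fin_cases i
          · exact h0
          · exact h1
          · exact h2
        ext x
        · exact DFunLike.congr_fun h3 _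
        · exact DFunLike.congr_fun h3 _
      ext x
      exact DFunLike.congr_fun this x
end

section
variable {A : Type} [CommRing A]

/-- A chosen frame of a configuration in general position can be moved to the standard one. -/
lemma exists_configEquiv_frame {k m : ℕ} (f : Fin k ↪o Fin m) (N : Matrix (Fin k) (Fin m) A)
    (hN : GeneralPosition N) :
    ∃ N' : Matrix (Fin k) (Fin m) A, ConfigEquiv N' N ∧ N'.submatrix id f = 1 := by
  have hu : IsUnit (N.submatrix id f) := (Matrix.isUnit_iff_isUnit_det _).2 (hN f)
  obtain ⟨g, hg⟩ := hu
  refine ⟨_, (configEquiv_inv_mul g N).symm, ?_⟩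
  have : (((g⁻¹ : GL (Fin k) A) : Matrix (Fin k) (Fin k) A) * N).submatrix id f =
      ((g⁻¹ : GL (Fin k) A) : Matrix (Fin k) (Fin k) A) * N.submatrix id f := by
    ext i j
    simp [Matrix.mul_apply]
  rw [this, ← hg, ← Units.val_mul, inv_mul_cancel, Units.val_one]

/-- The order embedding given by an increasing pair. -/
def pairEmb {m : ℕ} (i j : Fin m) (h : i < j) : Fin 2 ↪o Fin m :=
  OrderEmbedding.ofStrictMono ![i, j] (by
    intro x y hxy
    fin_cases x <;> fin_cases y <;> simp_all)

/-- The order embedding given by an increasing quadruple. -/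
def quadEmb {m : ℕ} (i j k l : Fin m) (h : i < j) (h' : j < k) (h'' : k < l) : Fin 4 ↪o Fin m :=
  OrderEmbedding.ofStrictMono ![i, j, k, l] (by
    rw [Fin.strictMono_iff_lt_succ]
    intro x
    fin_cases x
    exacts [h, h', h''])

lemma GeneralPosition.isUnit_pair {m : ℕ} {N : Matrix (Fin 2) (Fin m) A} (h : GeneralPosition N)
    (i j : Fin m) (hij : i < j) : IsUnit (N 0 i * N 1 j - N 0 j * N 1 i) := by
  have := h (pairEmb i j hij)
  rwa [Matrix.det_fin_two] at this

lemma generalPosition_of_pairs {m : ℕ} {N : Matrix (Fin 2) (Fin m) A}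
    (h : ∀ i j : Fin m, i < j → IsUnit (N 0 i * N 1 j - N 0 j * N 1 i)) : GeneralPosition N := by
  intro e
  rw [Matrix.det_fin_two]
  exact h _ _ (e.strictMono (by decide))

/-- The elements `0, 1, a, b, c` have invertible differences; the invertible difference `1 - 0` is
omitted. -/
def Separated (a b c : A) : Prop :=
  IsUnit a ∧ IsUnit b ∧ IsUnit c ∧ IsUnit (a - 1) ∧ IsUnit (b - 1) ∧ IsUnit (c - 1) ∧
    IsUnit (b - a) ∧ IsUnit (c - a) ∧ IsUnit (c - b)

lemma generalPosition_points_iff (a b c : A) :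
    GeneralPosition (points a b c) ↔ Separated a b c := by
  constructor
  · intro h
    refine ⟨?_, ?_, ?_, ?_, ?_, ?_, ?_, ?_, ?_⟩
    · simpa [points] using h.isUnit_pair 0 3 (by decide)
    · simpa [points] using h.isUnit_pair 0 4 (by decide)
    · simpa [points] using h.isUnit_pair 0 5 (by decide)
    · simpa [points] using h.isUnit_pair 1 3 (by decide)
    · simpa [points] using h.isUnit_pair 1 4 (by decide)
    · simpa [points] using h.isUnit_pair 1 5 (by decide)
    · simpa [points] using h.isUnit_pair 3 4 (by decide)
    · simpa [points] using h.isUnit_pair 3 5 (by decide)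
    · simpa [points] using h.isUnit_pair 4 5 (by decide)
  · rintro ⟨h1, h2, h3, h4, h5, h6, h7, h8, h9⟩
    refine generalPosition_of_pairs fun i j hij => ?_
    fin_cases i <;> fin_cases j <;> first
      | exact absurd hij (by decide)
      | (simp [points]; done)
      | simpa [points]

lemma points_map {B : Type} [CommRing B] (f : A →+* B) (a b c : A) :
    (points a b c).map f = points (f a) (f b) (f c) := by
  ext i j
  fin_cases i <;> fin_cases j <;> simp [points]

lemma planes_map {B : Type} [CommRing B] (f : A →+* B) (a b c : A) :
    (planes a b c).map f = planes (f a) (f b) (f c) := by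
  ext i j
  fin_cases i <;> fin_cases j <;> simp [planes]

set_option maxRecDepth 4000 in
lemma quadruple_cases : ∀ i j k l : Fin 6, i < j → j < k → k < l → ![i, j, k, l] ∈
    ([![0, 1, 2, 3], ![0, 1, 2, 4], ![0, 1, 2, 5], ![0, 1, 3, 4], ![0, 1, 3, 5], ![0, 1, 4, 5],
      ![0, 2, 3, 4], ![0, 2, 3, 5], ![0, 2, 4, 5], ![0, 3, 4, 5], ![1, 2, 3, 4], ![1, 2, 3, 5],
      ![1, 2, 4, 5], ![1, 3, 4, 5], ![2, 3, 4, 5]] : List (Fin 4 → Fin 6)) := by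
  decide

lemma GeneralPosition.isUnit_quad {m : ℕ} {N : Matrix (Fin 4) (Fin m) A} (h : GeneralPosition N)
    (i j k l : Fin m) (hij : i < j) (hjk : j < k) (hkl : k < l) :
    IsUnit (N.submatrix id ![i, j, k, l]).det :=
  h (quadEmb i j k l hij hjk hkl)

lemma isUnit_of_eq_or_eq_neg {x y : A} (h : IsUnit x) (e : y = x ∨ y = -x) : IsUnit y := by
  rcases e with rfl | rfl
  exacts [h, h.neg]

/-- The invertible diagonal matrix with the given units on the diagonal. -/
def diagonalUnit {k : ℕ} (u : Fin k → Aˣ) : GL (Fin k) A :=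
  ⟨Matrix.diagonal fun i => (u i : A), Matrix.diagonal fun i => ((u i)⁻¹ : Aˣ), by simp, by simp⟩

lemma diagonalUnit_coe {k : ℕ} (u : Fin k → Aˣ) :
    (diagonalUnit u : Matrix (Fin k) (Fin k) A) = Matrix.diagonal fun i => (u i : A) := rfl

/-- The nontrivial maximal minors of `planes a b c` are, up to sign, the differences of
`0, 1, a, b, c`. -/
lemma generalPosition_planes_iff (a b c : A) :
    GeneralPosition (planes a b c) ↔ Separated a b c := by
  constructor
  · intro h
    have hd := fun i j k l hij hjk hkl => h.isUnit_quad i j k l hij hjk hkl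
    have h1 := hd 0 2 3 5 (by decide) (by decide) (by decide)
    have h2 := hd 0 1 3 5 (by decide) (by decide) (by decide)
    have h3 := hd 0 1 2 5 (by decide) (by decide) (by decide)
    have h4 := hd 2 3 4 5 (by decide) (by decide) (by decide)
    have h5 := hd 1 3 4 5 (by decide) (by decide) (by decide)
    have h6 := hd 1 2 4 5 (by decide) (by decide) (by decide)
    have h7 := hd 0 3 4 5 (by decide) (by decide) (by decide)
    have h8 := hd 0 2 4 5 (by decide) (by decide) (by decide)
    have h9 := hd 0 1 4 5 (by decide) (by decide) (by decide)
    clear hd h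
    refine ⟨isUnit_of_eq_or_eq_neg h1 ?_, isUnit_of_eq_or_eq_neg h2 ?_,
      isUnit_of_eq_or_eq_neg h3 ?_, isUnit_of_eq_or_eq_neg h4 ?_, isUnit_of_eq_or_eq_neg h5 ?_,
      isUnit_of_eq_or_eq_neg h6 ?_, isUnit_of_eq_or_eq_neg h7 ?_, isUnit_of_eq_or_eq_neg h8 ?_,
      isUnit_of_eq_or_eq_neg h9 ?_⟩
    all_goals
      simp [Matrix.det_succ_row_zero, planes, Fin.sum_univ_succ, Fin.succAbove]
      first | done | (left; ring1) | (right; ring1)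
  · rintro ⟨h1, h2, h3, h4, h5, h6, h7, h8, h9⟩ e
    have he : (e : Fin 4 → Fin 6) = ![e 0, e 1, e 2, e 3] := by
      ext i; fin_cases i <;> rfl
    have hm := quadruple_cases (e 0) (e 1) (e 2) (e 3) (e.strictMono (by decide))
      (e.strictMono (by decide)) (e.strictMono (by decide))
    rw [← he] at hm
    simp only [List.mem_cons, List.not_mem_nil, or_false] at hm
    rcases hm with h | h | h | h | h | h | h | h | h | h | h | h | h | h | h
    all_goals
      rw [h]
      simp [Matrix.det_succ_row_zero, planes, Fin.sum_univ_succ, Fin.succAbove]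
    all_goals first
      | assumption
      | exact isUnit_of_eq_or_eq_neg h4 (.inl (by ring1))
      | exact isUnit_of_eq_or_eq_neg h5 (.inr (by ring1))
      | exact isUnit_of_eq_or_eq_neg h6 (.inl (by ring1))
      | exact isUnit_of_eq_or_eq_neg h7 (.inl (by ring1))
      | exact isUnit_of_eq_or_eq_neg h8 (.inr (by ring1))
      | exact isUnit_of_eq_or_eq_neg h9 (.inl (by ring1))

lemma mul_units_cancel (x : A) (u v w : Aˣ) :
    (v : A) * (x * (↑w⁻¹ * ↑v⁻¹ * ↑u)) * (↑w * ↑u⁻¹) = x := by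
  linear_combination x * (↑w * ↑w⁻¹ * ↑u * ↑u⁻¹) * v.mul_inv + x * (↑u * ↑u⁻¹) * w.mul_inv +
    x * u.mul_inv

/-- The points `0` and `∞` are moved to the standard frame; then the two coordinates are rescaled
such that the second point becomes `1`. -/
lemma exists_configEquiv_points (N : Matrix (Fin 2) (Fin 6) A) (hN : GeneralPosition N) :
    ∃ a b c, ConfigEquiv (points a b c) N := by
  obtain ⟨M, hM, h1⟩ := exists_configEquiv_frame (pairEmb 0 2 (by decide)) N hN
  have hMg := hM.symm.generalPosition hN
  have e1 : M 0 0 = 1 := congrFun₂ h1 0 0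
  have e2 : M 1 0 = 0 := congrFun₂ h1 1 0
  have e3 : M 0 2 = 0 := congrFun₂ h1 0 1
  have e4 : M 1 2 = 1 := congrFun₂ h1 1 1
  have u1 : IsUnit (M 0 1) := by simpa [e3, e4] using hMg.isUnit_pair 1 2 (by decide)
  have u3 : IsUnit (M 0 3) := by simpa [e3, e4] using hMg.isUnit_pair 2 3 (by decide)
  have u4 : IsUnit (M 0 4) := by simpa [e3, e4] using hMg.isUnit_pair 2 4 (by decide)
  have u5 : IsUnit (M 0 5) := by simpa [e3, e4] using hMg.isUnit_pair 2 5 (by decide)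
  have v1 : IsUnit (M 1 1) := by simpa [e1, e2] using hMg.isUnit_pair 0 1 (by decide)
  obtain ⟨u1, hu1⟩ := u1
  obtain ⟨u3, hu3⟩ := u3
  obtain ⟨u4, hu4⟩ := u4
  obtain ⟨u5, hu5⟩ := u5
  obtain ⟨v1, hv1⟩ := v1
  refine ⟨M 1 3 * ↑(u3⁻¹ * v1⁻¹ * u1), M 1 4 * ↑(u4⁻¹ * v1⁻¹ * u1), M 1 5 * ↑(u5⁻¹ * v1⁻¹ * u1),
    ConfigEquiv.trans ⟨diagonalUnit ![u1, v1],
      ![u1⁻¹, 1, v1⁻¹, u3 * u1⁻¹, u4 * u1⁻¹, u5 * u1⁻¹], ?_⟩ hM⟩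
  ext i j
  rw [Matrix.mul_diagonal, diagonalUnit_coe, Matrix.diagonal_mul]
  fin_cases i <;> fin_cases j <;> simp [points, e1, e2, e3, e4, ← hu1, ← hu3, ← hu4, ← hu5, ← hv1]
  all_goals first
    | rw [mul_left_comm, Units.mul_inv, mul_one]
    | rw [mul_units_cancel]

/-- The first four hyperplanes are moved to the coordinate hyperplanes; then the coordinates are
rescaled such that the fifth becomes `X₀ + X₁ + X₂ + X₃ = 0`. -/
lemma exists_configEquiv_planes (N : Matrix (Fin 4) (Fin 6) A) (hN : GeneralPosition N) :
    ∃ a b c, ConfigEquiv (planes a b c) N := by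
  obtain ⟨M, hM, h1⟩ := exists_configEquiv_frame
    (quadEmb 0 1 2 3 (by decide) (by decide) (by decide)) N hN
  have hMg := hM.symm.generalPosition hN
  have e : ∀ i j, M i ((![0, 1, 2, 3] : Fin 4 → Fin 6) j) = (1 : Matrix (Fin 4) (Fin 4) A) i j :=
    fun i j => congrFun₂ h1 i j
  have hM' : M = !![1, 0, 0, 0, M 0 4, M 0 5; 0, 1, 0, 0, M 1 4, M 1 5; 0, 0, 1, 0, M 2 4, M 2 5;
      0, 0, 0, 1, M 3 4, M 3 5] := by
    ext i j
    fin_cases j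
    · exact (e i 0).trans (by fin_cases i <;> rfl)
    · exact (e i 1).trans (by fin_cases i <;> rfl)
    · exact (e i 2).trans (by fin_cases i <;> rfl)
    · exact (e i 3).trans (by fin_cases i <;> rfl)
    · fin_cases i <;> rfl
    · fin_cases i <;> rfl
  generalize M 0 4 = p0, M 1 4 = p1, M 2 4 = p2, M 3 4 = p3, M 0 5 = q0, M 1 5 = q1, M 2 5 = q2,
    M 3 5 = q3 at hM'
  rw [hM'] at hM hMg
  have h0 := hMg.isUnit_quad 1 2 3 4 (by decide) (by decide) (by decide)
  have h1 := hMg.isUnit_quad 0 2 3 4 (by decide) (by decide) (by decide)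
  have h2 := hMg.isUnit_quad 0 1 3 4 (by decide) (by decide) (by decide)
  have h3 := hMg.isUnit_quad 0 1 2 4 (by decide) (by decide) (by decide)
  have h5 := hMg.isUnit_quad 1 2 3 5 (by decide) (by decide) (by decide)
  simp [Matrix.det_succ_row_zero, Fin.sum_univ_succ, Fin.succAbove] at h0 h1 h2 h3 h5
  obtain ⟨u0, rfl⟩ := h0
  obtain ⟨u1, rfl⟩ := h1
  obtain ⟨u2, rfl⟩ := h2
  obtain ⟨u3, rfl⟩ := h3
  obtain ⟨v, rfl⟩ := h5
  refine ⟨q1 * ↑(v⁻¹ * u1⁻¹ * u0), q2 * ↑(v⁻¹ * u2⁻¹ * u0), q3 * ↑(v⁻¹ * u3⁻¹ * u0),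
    ConfigEquiv.trans ⟨diagonalUnit ![u0, u1, u2, u3],
      ![u0⁻¹, u1⁻¹, u2⁻¹, u3⁻¹, 1, v * u0⁻¹], ?_⟩ hM⟩
  ext i j
  rw [Matrix.mul_diagonal, diagonalUnit_coe, Matrix.diagonal_mul]
  fin_cases i <;> fin_cases j <;> simp [planes]
  all_goals first
    | rw [mul_left_comm, Units.mul_inv, mul_one]
    | rw [mul_units_cancel]

/-- A coordinate change which fixes `0`, `∞` and `1` is a scalar. -/
lemma points_unique (a b c a' b' c' : A) (h : ConfigEquiv (points a b c) (points a' b' c')) :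
    a = a' ∧ b = b' ∧ c = c' := by
  obtain ⟨g, t, h⟩ := h
  have e : ∀ i j, points a' b' c' i j =
      (g i 0 * points a b c 0 j + g i 1 * points a b c 1 j) * t j := by
    intro i j
    rw [h, Matrix.mul_diagonal, Matrix.mul_apply, Fin.sum_univ_two]
  have g10 : g 1 0 = 0 := by simpa [points] using (e 1 0).symm
  have g01 : g 0 1 = 0 := by simpa [points] using (e 0 2).symm
  have h01 : g 0 0 * (t 1 : A) = 1 := by simpa [points, g01] using (e 0 1).symm
  have h11 : g 1 1 * (t 1 : A) = 1 := by simpa [points, g10] using (e 1 1).symm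
  have hg : g 1 1 = g 0 0 := (t 1).isUnit.mul_left_injective (h11.trans h01.symm)
  have key : ∀ x x' : A, ∀ s : A, 1 = g 0 0 * s → x' = g 0 0 * x * s → x = x' := by
    intro x x' s h1 h2
    rw [h2, mul_right_comm, ← h1, one_mul]
  refine ⟨key _ _ (t 3) ?_ ?_, key _ _ (t 4) ?_ ?_, key _ _ (t 5) ?_ ?_⟩
  · simpa [points, g01] using e 0 3
  · simpa [points, g10, hg] using e 1 3
  · simpa [points, g01] using e 0 4
  · simpa [points, g10, hg] using e 1 4
  · simpa [points, g01] using e 0 5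
  · simpa [points, g10, hg] using e 1 5

/-- A coordinate change which fixes the first five hyperplanes is a scalar. -/
lemma planes_unique (a b c a' b' c' : A) (h : ConfigEquiv (planes a b c) (planes a' b' c')) :
    a = a' ∧ b = b' ∧ c = c' := by
  obtain ⟨g, t, h⟩ := h
  have e : ∀ i j, planes a' b' c' i j = (∑ l, g i l * planes a b c l j) * t j := by
    intro i j
    rw [h, Matrix.mul_diagonal, Matrix.mul_apply]
  have hoff : ∀ i j : Fin 4, i ≠ j → g i j = 0 := by
    intro i j hij
    have := e i (j.castLE (by decide))
    fin_cases i <;> fin_cases j <;> first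
      | exact absurd rfl hij
      | simpa [planes, Fin.sum_univ_succ] using this.symm
  have hd : ∀ (i : Fin 4) (x : Fin 4 → A), ∑ l, g i l * x l = g i i * x i := fun i x =>
    Finset.sum_eq_single_of_mem i (Finset.mem_univ _) fun j _ hj => by
      rw [hoff i j hj.symm, zero_mul]
  have e' : ∀ i j, g i i * planes a b c i j * t j = planes a' b' c' i j := fun i j => by
    rw [e, hd]
  have h4 : ∀ i, g i i * (t 4 : A) = 1 := by
    intro i
    have := e' i 4
    fin_cases i <;> simpa [planes] using this
  have hg : ∀ i, g i i = g 0 0 := fun i =>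
    (t 4).isUnit.mul_left_injective ((h4 i).trans (h4 0).symm)
  have h5 : g 0 0 * (t 5 : A) = 1 := by simpa [planes] using e' 0 5
  have key : ∀ x x' : A, g 0 0 * x * t 5 = x' → x = x' := by
    intro x x' h2
    rw [← h2, mul_right_comm, h5, one_mul]
  refine ⟨key _ _ ?_, key _ _ ?_, key _ _ ?_⟩
  · rw [← hg 1]
    exact e' 1 5
  · rw [← hg 2]
    exact e' 2 5
  · rw [← hg 3]
    exact e' 3 5

end

theorem isModuliSpace_univPoints : IsModuliSpace univPoints :=
  isModuliSpace_of_normalForm (fun _ _ => points) (fun _ _ _ _ => points_map)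
    (fun _ _ => exists_configEquiv_points) (fun _ _ => points_unique) PtRing

theorem isModuliSpace_univPlanes : IsModuliSpace univPlanes :=
  isModuliSpace_of_normalForm (fun _ _ => planes) (fun _ _ _ _ => planes_map)
    (fun _ _ => exists_configEquiv_planes) (fun _ _ => planes_unique) PlRing

/-- The two moduli spaces are the same open subset of the space of all `(a, b, c)`. -/
theorem exists_algEquiv_moduli : Nonempty (PlRing ≃ₐ[Param] PtRing) := by
  have h : ∀ {L : Type} [CommRing L] [Algebra Param L],
      IsUnit (algebraMap Param L (minorProd
        (points (MvPolynomial.X 0 : Param) (MvPolynomial.X 1) (MvPolynomial.X 2)))) ↔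
      IsUnit (algebraMap Param L (minorProd
        (planes (MvPolynomial.X 0 : Param) (MvPolynomial.X 1) (MvPolynomial.X 2)))) := by
    intro L _ _
    rw [map_minorProd, map_minorProd, isUnit_minorProd_iff, isUnit_minorProd_iff, points_map,
      planes_map, generalPosition_points_iff, generalPosition_planes_iff]
  let f : PlRing →ₐ[Param] PtRing := IsLocalization.liftAlgHom (M := Submonoid.powers
    (minorProd (planes (MvPolynomial.X 0 : Param) (MvPolynomial.X 1) (MvPolynomial.X 2))))
    (f := Algebra.ofId Param PtRing) (by
      rintro ⟨_, n, rfl⟩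
      rw [map_pow]
      exact (h.1 (IsLocalization.Away.algebraMap_isUnit _)).pow n)
  let g : PtRing →ₐ[Param] PlRing := IsLocalization.liftAlgHom (M := Submonoid.powers
    (minorProd (points (MvPolynomial.X 0 : Param) (MvPolynomial.X 1) (MvPolynomial.X 2))))
    (f := Algebra.ofId Param PlRing) (by
      rintro ⟨_, n, rfl⟩
      rw [map_pow]
      exact (h.2 (IsLocalization.Away.algebraMap_isUnit _)).pow n)
  have := IsLocalization.algHom_subsingleton (R := Param) (S := PlRing) (P := PlRing)
    (Submonoid.powers
    (minorProd (planes (MvPolynomial.X 0 : Param) (MvPolynomial.X 1) (MvPolynomial.X 2))))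
  have := IsLocalization.algHom_subsingleton (R := Param) (S := PtRing) (P := PtRing)
    (Submonoid.powers
    (minorProd (points (MvPolynomial.X 0 : Param) (MvPolynomial.X 1) (MvPolynomial.X 2))))
  exact ⟨AlgEquiv.ofAlgHom f g (Subsingleton.elim _ _) (Subsingleton.elim _ _)⟩

/-! ### Charts of `Proj` at elements of degree one -/

section Dehomogenization

variable {R A : Type} [CommRing R] [CommRing A] [Algebra R A]
  (𝒜 : ℕ → Submodule R A) [GradedAlgebra 𝒜]

/-- The dehomogenization `A / (s - 1)` of a graded ring at an element `s`. -/
abbrev Dehomog (s : A) : Type := A ⧸ Ideal.span {s - 1}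

/-- The class of an element in the dehomogenization. -/
abbrev dehomog (s : A) : A →+* Dehomog s := Ideal.Quotient.mk _

lemma dehomog_self (s : A) : dehomog s s = 1 := by
  rw [← sub_eq_zero, ← map_one (dehomog s), ← map_sub]
  exact Ideal.Quotient.eq_zero_iff_mem.2 (Ideal.mem_span_singleton_self _)

/-- The comparison map from the degree zero part of the localization to the dehomogenization; it is
bijective for `s` of degree one (`awayToDehomog_bijective`). -/
def awayToDehomog (s : A) : HomogeneousLocalization.Away 𝒜 s →+* Dehomog s :=
  (Localization.awayLift (dehomog s) s (by rw [dehomog_self]; exact isUnit_one)).comp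
    (algebraMap (HomogeneousLocalization.Away 𝒜 s) (Localization.Away s))

variable {𝒜} {s : A} (hs : s ∈ 𝒜 1)

lemma awayToDehomog_mk (n : ℕ) (x : A) (hx : x ∈ 𝒜 (n • 1)) :
    awayToDehomog 𝒜 s (HomogeneousLocalization.Away.mk 𝒜 hs n x hx) = dehomog s x := by
  rw [awayToDehomog, RingHom.comp_apply, HomogeneousLocalization.algebraMap_apply,
    HomogeneousLocalization.Away.val_mk, Localization.awayLift_mk (v := 1), one_pow, mul_one]
  rw [dehomog_self, one_mul]

/-- The homomorphism from a graded ring to its localization at an element `s` of degree one which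
divides a homogeneous element by the power of `s` of the same degree. -/
def divHom : A →+* Localization.Away s :=
  (DirectSum.toSemiring (fun n => (AddMonoidHom.mulRight (IsLocalization.Away.invSelf s ^ n)).comp
      ((algebraMap A (Localization.Away s)).toAddMonoidHom.comp (𝒜 n).subtype.toAddMonoidHom))
    (by simp [GradedMonoid.GOne.one])
    (by
      intro i j x y
      change algebraMap A (Localization.Away s) (x * y) * _ =
        (algebraMap A (Localization.Away s) x * _) * (algebraMap A (Localization.Away s) y * _)
      rw [map_mul, pow_add]
      ring)).comp (DirectSum.decomposeRingEquiv 𝒜).toRingHom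

lemma divHom_apply {n : ℕ} {x : A} (hx : x ∈ 𝒜 n) :
    divHom (𝒜 := 𝒜) (s := s) x =
      algebraMap A (Localization.Away s) x * IsLocalization.Away.invSelf s ^ n := by
  have h : DirectSum.decomposeRingEquiv 𝒜 x = DirectSum.of (fun n => 𝒜 n) n ⟨x, hx⟩ :=
    DirectSum.decompose_of_mem _ hx
  rw [divHom, RingHom.comp_apply, RingEquiv.toRingHom_eq_coe, RingEquiv.coe_toRingHom, h,
    DirectSum.toSemiring_of]
  rfl

lemma awayToDehomog_bijective (hs : s ∈ 𝒜 1) : Function.Bijective (awayToDehomog 𝒜 s) := by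
  have h1 : divHom (𝒜 := 𝒜) (s := s) s = 1 := by
    rw [divHom_apply hs, pow_one, IsLocalization.Away.mul_invSelf]
  let h : Dehomog s →+* Localization.Away s := Ideal.Quotient.lift _ (divHom (𝒜 := 𝒜)) (by
    intro a ha
    obtain ⟨b, rfl⟩ := Ideal.mem_span_singleton'.1 ha
    rw [map_mul, map_sub, h1, map_one, sub_self, mul_zero])
  constructor
  · have hval : ∀ z, h (awayToDehomog 𝒜 s z) = z.val := by
      intro z
      obtain ⟨n, x, hx, rfl⟩ := HomogeneousLocalization.Away.mk_surjective 𝒜 hs z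
      rw [awayToDehomog_mk, HomogeneousLocalization.Away.val_mk]
      change divHom x = _
      rw [divHom_apply hx, Localization.mk_eq_mk', IsLocalization.eq_mk'_iff_mul_eq, mul_assoc]
      simp only [map_pow, smul_eq_mul, mul_one]
      rw [← mul_pow, mul_comm (IsLocalization.Away.invSelf s), IsLocalization.Away.mul_invSelf,
        one_pow, mul_one]
    intro z z' hzz
    rw [HomogeneousLocalization.ext_iff_val, ← hval, hzz, hval]
  · intro c
    obtain ⟨p, rfl⟩ := Ideal.Quotient.mk_surjective c
    induction p using DirectSum.Decomposition.inductionOn 𝒜 with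
    | zero => exact ⟨0, by simp⟩
    | @homogeneous i m =>
      exact ⟨HomogeneousLocalization.Away.mk 𝒜 hs i m (by simp),
        awayToDehomog_mk _ _ _ _⟩
    | add p q hp hq =>
      obtain ⟨x, hx⟩ := hp
      obtain ⟨y, hy⟩ := hq
      exact ⟨x + y, by rw [map_add, hx, hy, map_add]⟩

/-- The standard affine chart `Spec A/(s - 1)` of `Proj A`. -/
def dehomogChart : Spec (.of (Dehomog s)) ⟶ Proj 𝒜 :=
  Spec.map (CommRingCat.ofHom (awayToDehomog 𝒜 s)) ≫ Proj.awayι 𝒜 s hs one_pos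

lemma isIso_spec_awayToDehomog (hs : s ∈ 𝒜 1) :
    IsIso (Spec.map (CommRingCat.ofHom (awayToDehomog 𝒜 s))) := by
  have : IsIso (CommRingCat.ofHom (awayToDehomog 𝒜 s)) :=
    (ConcreteCategory.isIso_iff_bijective _).2 (awayToDehomog_bijective hs)
  infer_instance

instance : IsOpenImmersion (dehomogChart hs) := by
  have := isIso_spec_awayToDehomog hs
  rw [dehomogChart]
  infer_instance

lemma opensRange_dehomogChart : (dehomogChart hs).opensRange = Proj.basicOpen 𝒜 s := by
  have := isIso_spec_awayToDehomog hs
  exact (Scheme.Hom.opensRange_comp_of_isIso _ _).trans (Proj.opensRange_awayι _ _ _ _)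

lemma dehomogChart_preimage_basicOpen {g : A} {n : ℕ} (hn : 0 < n) (hg : g ∈ 𝒜 n) :
    dehomogChart hs ⁻¹ᵁ Proj.basicOpen 𝒜 g = PrimeSpectrum.basicOpen (dehomog s g) := by
  rw [dehomogChart, Scheme.Hom.comp_preimage, Proj.awayι_preimage_basicOpen 𝒜 hs one_pos hg hn]
  have : awayToDehomog 𝒜 s (HomogeneousLocalization.Away.isLocalizationElem hs hg) =
      dehomog s g := by
    rw [HomogeneousLocalization.Away.isLocalizationElem, awayToDehomog_mk, pow_one]
  rw [← this]
  rfl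

lemma dehomogChart_toBase :
    dehomogChart hs ≫ Proj.toSpecZero 𝒜 ≫ Spec.map (CommRingCat.ofHom (algebraMap R (𝒜 0))) =
      Spec.map (CommRingCat.ofHom (algebraMap R (Dehomog s))) := by
  rw [dehomogChart, Category.assoc, Proj.awayι_toSpecZero_assoc, ← Spec.map_comp, ← Spec.map_comp]
  congr 1
  ext r
  have h : HomogeneousLocalization.fromZeroRingHom 𝒜 (Submonoid.powers s) (algebraMap R (𝒜 0) r) =
      HomogeneousLocalization.Away.mk 𝒜 hs 0 (algebraMap R A r)
        (by rw [zero_smul]; exact (algebraMap R (𝒜 0) r).2) := by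
    rw [HomogeneousLocalization.ext_iff_val, HomogeneousLocalization.Away.val_mk]
    change Localization.mk _ _ = Localization.mk _ _
    congr 1
    ext
    simp
  change awayToDehomog 𝒜 s (HomogeneousLocalization.fromZeroRingHom 𝒜 _ (algebraMap R (𝒜 0) r)) = _
  rw [h, awayToDehomog_mk]
  rfl

/-- A graded endomorphism `g` with `g s = s'` maps the chart at `s'` to the chart at `s`. -/
lemma dehomogChart_comp_map (g : GradedRingHom 𝒜 𝒜)
    (hg : HomogeneousIdeal.irrelevant 𝒜 ≤ (HomogeneousIdeal.irrelevant 𝒜).map g)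
    {s' : A} (hs' : s' ∈ 𝒜 1) (hgs : g s = s') (γ : Dehomog s →+* Dehomog s')
    (hγ : ∀ x, γ (dehomog s x) = dehomog s' (g x)) :
    dehomogChart hs' ≫ Proj.map g hg = Spec.map (CommRingCat.ofHom γ) ≫ dehomogChart hs := by
  subst hgs
  have h := Proj.awayι_comp_map g hg one_pos s hs
  rw [dehomogChart, Category.assoc, h, dehomogChart, ← Category.assoc, ← Category.assoc,
    ← Spec.map_comp, ← Spec.map_comp]
  congr 2
  ext z
  obtain ⟨n, x, hx, rfl⟩ := HomogeneousLocalization.Away.mk_surjective 𝒜 hs z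
  change awayToDehomog 𝒜 (g s) (HomogeneousLocalization.Away.map g s _) =
    γ (awayToDehomog 𝒜 s _)
  rw [HomogeneousLocalization.Away.map_mk, awayToDehomog_mk, awayToDehomog_mk, hγ]

end Dehomogenization

/-! ### Generizations in the fibres of a hypersurface -/

section Monic

variable {K : Type} [CommRing K]

lemma dvd_of_dvd_C_mul_of_monic {B : Type} [CommRing B] [IsDomain B]
    {F P : Polynomial B} (hF : F.Monic)
    {a : B} (ha : a ≠ 0) (h : F ∣ Polynomial.C a * P) : F ∣ P := by
  rw [← Polynomial.modByMonic_eq_zero_iff_dvd hF] at h ⊢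
  rw [← Polynomial.smul_eq_C_mul, Polynomial.smul_modByMonic] at h
  exact (smul_eq_zero.1 h).resolve_left ha

/-- The polynomial ring as a polynomial ring in one variable over the ring in the other ones. -/
def splitVar {ι : Type} [DecidableEq ι] (k : ι) :
    MvPolynomial ι K ≃ₐ[K] Polynomial (MvPolynomial {i // i ≠ k} K) :=
  (MvPolynomial.renameEquiv K (Equiv.optionSubtypeNe k).symm).trans
    (MvPolynomial.optionEquivLeft K _)

lemma splitVar_X_self {ι : Type} [DecidableEq ι] (k : ι) :
    splitVar k (MvPolynomial.X k : MvPolynomial ι K) = Polynomial.X := by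
  simp [splitVar]

lemma splitVar_rename {ι : Type} [DecidableEq ι] (k : ι) (r : MvPolynomial {i // i ≠ k} K) :
    splitVar k (MvPolynomial.rename Subtype.val r) = Polynomial.C r := by
  induction r using MvPolynomial.induction_on with
  | C a => simp [splitVar]
  | add p q hp hq => rw [map_add, map_add, hp, hq, map_add]
  | mul_X p i hp =>
    rw [map_mul, map_mul, hp, map_mul]
    congr 1
    simp [splitVar, Equiv.optionSubtypeNe_symm_of_ne i.2]

/-- Over a domain, a nonzero polynomial which does not involve the variable `x_k` is not a zero
divisor modulo a polynomial which is monic in `x_k`. -/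
lemma dvd_of_dvd_mul_of_monic [IsDomain K] {ι : Type} [DecidableEq ι] (k : ι)
    {r n : MvPolynomial {i // i ≠ k} K} (hn : n ≠ 0) {p : MvPolynomial ι K}
    (h : MvPolynomial.X k ^ 3 + MvPolynomial.rename Subtype.val r ∣
      MvPolynomial.rename Subtype.val n * p) :
    MvPolynomial.X k ^ 3 + MvPolynomial.rename Subtype.val r ∣ p := by
  rw [← map_dvd_iff (splitVar k)] at h ⊢
  rw [map_mul] at h
  simp only [map_add, map_pow, splitVar_X_self, splitVar_rename] at h ⊢
  exact dvd_of_dvd_C_mul_of_monic (Polynomial.monic_X_pow_add_C r three_ne_zero) hn h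

end Monic

section Density

variable {ι A : Type} [CommRing A] {w : ι → ℕ} {f : MvPolynomial ι A} {d : ℕ}

/-- The polynomial `g` is not a zero divisor modulo `f`. -/
def RegularMod {D : Type} [CommRing D] (f g : MvPolynomial ι D) : Prop := ∀ p, f ∣ g * p → f ∣ p

lemma RegularMod.mul {D : Type} [CommRing D] {f g g' : MvPolynomial ι D} (h : RegularMod f g)
    (h' : RegularMod f g') : RegularMod f (g * g') := fun p hp =>
  h' p (h _ (by rwa [mul_assoc] at hp))

/-- The polynomial `g` is not a zero divisor modulo `f`, over the residue ring of every point of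
`Spec A`. -/
def FibrewiseRegular (f g : MvPolynomial ι A) : Prop :=
  ∀ (b : Ideal A) [b.IsPrime],
    RegularMod (f.map (Ideal.Quotient.mk b)) (g.map (Ideal.Quotient.mk b))

/-- Reduction of the homogeneous coordinate ring modulo an ideal of the base. -/
def hReduce (f : MvPolynomial ι A) (b : Ideal A) :
    HRing f →+* HRing (f.map (Ideal.Quotient.mk b)) :=
  Ideal.quotientMap _ (MvPolynomial.map (Ideal.Quotient.mk b)) (by
    rw [Ideal.span_singleton_le_iff_mem, Ideal.mem_comap]
    exact Ideal.mem_span_singleton_self _)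

lemma hReduce_mk (b : Ideal A) (p : MvPolynomial ι A) :
    hReduce f b (Ideal.Quotient.mk _ p) =
      Ideal.Quotient.mk _ (p.map (Ideal.Quotient.mk b)) := rfl

lemma hReduce_surjective (b : Ideal A) : Function.Surjective (hReduce f b) := by
  intro y
  obtain ⟨q, rfl⟩ := Ideal.Quotient.mk_surjective y
  obtain ⟨p, rfl⟩ := MvPolynomial.map_surjective _ (Ideal.Quotient.mk_surjective (I := b)) q
  exact ⟨Ideal.Quotient.mk _ p, rfl⟩

lemma ker_hReduce_le (b : Ideal A) : RingHom.ker (hReduce f b) ≤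
    b.map (algebraMap A (HRing f)) := by
  intro x hx
  obtain ⟨p, rfl⟩ := Ideal.Quotient.mk_surjective x
  rw [RingHom.mem_ker, hReduce_mk, Ideal.Quotient.eq_zero_iff_mem, Ideal.mem_span_singleton] at hx
  obtain ⟨q, hq⟩ := hx
  obtain ⟨q, rfl⟩ := MvPolynomial.map_surjective _ (Ideal.Quotient.mk_surjective (I := b)) q
  have h : p - f * q ∈
      RingHom.ker (MvPolynomial.map (Ideal.Quotient.mk b) : MvPolynomial ι A →+* _) := by
    rw [RingHom.mem_ker, map_sub, map_mul, hq, sub_self]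
  rw [MvPolynomial.ker_map, Ideal.mk_ker] at h
  have h2 := Ideal.mem_map_of_mem (Ideal.Quotient.mk (Ideal.span {f})) h
  rw [Ideal.map_map] at h2
  have h3 : Ideal.Quotient.mk (Ideal.span {f}) (p - f * q) =
      Ideal.Quotient.mk (Ideal.span {f}) p := by
    rw [map_sub, map_mul, Ideal.Quotient.eq_zero_iff_mem.2 (Ideal.mem_span_singleton_self f),
      zero_mul, sub_zero]
  rwa [h3] at h2

/-- A homogeneous prime contains another one over the same prime of the base which avoids a given
fibrewise regular element. -/
lemma exists_homogeneous_prime_le (hf : f.IsWeightedHomogeneous w d) {g : MvPolynomial ι A}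
    (hg : FibrewiseRegular f g) (p : Ideal (HRing f)) [p.IsPrime] :
    letI := hGradedAlgebra hf
    ∃ q : HomogeneousIdeal (hGrading w f), q.toIdeal.IsPrime ∧ q.toIdeal ≤ p ∧
      q.toIdeal.comap (algebraMap A (HRing f)) = p.comap (algebraMap A (HRing f)) ∧
      Ideal.Quotient.mk _ g ∉ q.toIdeal := by
  let _ := hGradedAlgebra hf
  let b := p.comap (algebraMap A (HRing f))
  -- A minimal prime of the fibre over `b` avoids `g`, as it consists of zero divisors; its
  -- homogeneous core is still prime.
  let χ := hReduce f b
  have hχ : Function.Surjective χ := hReduce_surjective b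
  have hker : RingHom.ker χ ≤ p := (ker_hReduce_le b).trans (Ideal.map_comap_le)
  have hp' : (p.map χ).IsPrime := Ideal.map_isPrime_of_surjective hχ hker
  obtain ⟨q', hq', hq'p⟩ := Ideal.exists_minimalPrimes_le (I := ⊥) (J := p.map χ) bot_le
  have hq'prime : q'.IsPrime := hq'.1.1
  have hle : q'.comap χ ≤ p := by
    refine (Ideal.comap_mono hq'p).trans ?_
    rw [Ideal.comap_map_of_surjective χ hχ]
    exact sup_le le_rfl hker
  have hcore := Ideal.toIdeal_homogeneousCore_le (hGrading w f) (q'.comap χ)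
  refine ⟨Ideal.homogeneousCore (hGrading w f) (q'.comap χ),
    Ideal.IsPrime.homogeneousCore (hq'prime.comap χ), hcore.trans hle,
    le_antisymm (Ideal.comap_mono (hcore.trans hle)) ?_, ?_⟩
  · intro a ha
    refine Ideal.mem_homogeneousCore_of_homogeneous_of_mem (⟨0, ?_⟩) ?_
    · exact (algebraMap A (hGrading w f 0) a).2
    · rw [Ideal.mem_comap]
      have : χ (algebraMap A (HRing f) a) = 0 := by
        change hReduce f b (Ideal.Quotient.mk _ (MvPolynomial.C a)) = 0
        rw [hReduce_mk, MvPolynomial.map_C, Ideal.Quotient.eq_zero_iff_mem.2 ha, map_zero, map_zero]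
      rw [this]
      exact q'.zero_mem
  · intro hmem
    have hmem' : χ (Ideal.Quotient.mk _ g) ∈ q' := hcore hmem
    refine Set.disjoint_left.1 (Ideal.disjoint_nonZeroDivisors_of_mem_minimalPrimes hq') hmem' ?_
    refine mem_nonZeroDivisors_iff_right.2 ?_
    intro y hy
    obtain ⟨y, rfl⟩ := Ideal.Quotient.mk_surjective y
    change Ideal.Quotient.mk _ y * Ideal.Quotient.mk _ (g.map _) = 0 at hy
    rw [← map_mul, Ideal.Quotient.eq_zero_iff_mem, Ideal.mem_span_singleton, mul_comm] at hy
    rw [Ideal.Quotient.eq_zero_iff_mem, Ideal.mem_span_singleton]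
    exact hg b _ hy

end Density

section ProjPoints

variable {R A : Type} [CommRing R] [CommRing A] [Algebra R A]
  (𝒜 : ℕ → Submodule R A) [GradedAlgebra 𝒜]

lemma mem_toBase_awayι_iff {m : ℕ} {s : A} (hs : s ∈ 𝒜 m) (hm : 0 < m)
    (z : Spec (.of (HomogeneousLocalization.Away 𝒜 s))) (r : R) :
    r ∈ ((Proj.toSpecZero 𝒜 ≫ Spec.map (CommRingCat.ofHom (algebraMap R (𝒜 0)))).base
        ((Proj.awayι 𝒜 s hs hm).base z)).asIdeal ↔
      algebraMap R A r ∈ ((Proj.awayι 𝒜 s hs hm).base z).asHomogeneousIdeal.toIdeal := by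
  let z' : PrimeSpectrum (HomogeneousLocalization.Away 𝒜 s) := z
  have h1 : r ∈ ((Proj.toSpecZero 𝒜 ≫ Spec.map (CommRingCat.ofHom (algebraMap R (𝒜 0)))).base
      ((Proj.awayι 𝒜 s hs hm).base z)).asIdeal ↔
      HomogeneousLocalization.fromZeroRingHom 𝒜 (Submonoid.powers s) (algebraMap R (𝒜 0) r) ∈
        z'.asIdeal := by
    have h := congrArg (fun k => r ∈ PrimeSpectrum.asIdeal (k.base z))
      (Proj.awayι_toSpecZero_assoc 𝒜 s hs hm
        (Spec.map (CommRingCat.ofHom (algebraMap R (𝒜 0)))))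
    exact iff_of_eq h
  have hsx : s ∉ ((Proj.awayι 𝒜 s hs hm).base z).asHomogeneousIdeal.toIdeal := by
    have h : (Proj.awayι 𝒜 s hs hm).base z ∈ (Proj.awayι 𝒜 s hs hm).opensRange := ⟨z, rfl⟩
    rw [Proj.opensRange_awayι] at h
    exact h
  have hrs : algebraMap R A r * s ∈ 𝒜 m := by
    rw [← Algebra.smul_def]
    exact (𝒜 m).smul_mem r hs
  have h2 : HomogeneousLocalization.Away.isLocalizationElem hs hrs =
      HomogeneousLocalization.fromZeroRingHom 𝒜 (Submonoid.powers s)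
        (algebraMap R (𝒜 0) r) ^ m := by
    rw [HomogeneousLocalization.ext_iff_val, HomogeneousLocalization.Away.val_mk,
      HomogeneousLocalization.val_pow]
    change _ = (Localization.mk (algebraMap R A r) 1) ^ m
    rw [Localization.mk_pow, Localization.mk_eq_mk_iff, Localization.r_iff_exists]
    refine ⟨1, ?_⟩
    simp only [OneMemClass.coe_one, one_mul, one_pow, mul_pow]
    ring
  have h3 := congrArg (z ∈ ·) (Proj.awayι_preimage_basicOpen 𝒜 hs hm hrs hm)
  have h4 : algebraMap R A r * s ∉
      ((Proj.awayι 𝒜 s hs hm).base z).asHomogeneousIdeal.toIdeal ↔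
      HomogeneousLocalization.Away.isLocalizationElem hs hrs ∉ z'.asIdeal := iff_of_eq h3
  have hp := ((Proj.awayι 𝒜 s hs hm).base z).isPrime
  have hp' := z'.isPrime
  rw [hp.mul_mem_iff_mem_or_mem, or_iff_left hsx, h2, hp'.pow_mem_iff_mem _ hm,
    not_iff_not] at h4
  exact h1.trans h4.symm

/-- The image in the base of a point of `Proj` is the restriction of the homogeneous prime ideal. -/
lemma mem_toBase_iff (x : Proj 𝒜) (r : R) :
    r ∈ ((Proj.toSpecZero 𝒜 ≫ Spec.map (CommRingCat.ofHom (algebraMap R (𝒜 0)))).base x).asIdeal ↔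
      algebraMap R A r ∈ x.asHomogeneousIdeal.toIdeal := by
  obtain ⟨⟨m, s⟩, z, hz⟩ := (Proj.affineOpenCover 𝒜).openCover.exists_eq x
  have hz' : (Proj.awayι 𝒜 (s : A) s.2 m.2).base z = x := hz
  rw [← hz']
  exact mem_toBase_awayι_iff 𝒜 s.2 m.2 z r

/-- Every point of a hypersurface is a specialization of a point in the same fibre over the base
which is not a zero of a given fibrewise regular polynomial `g`. -/
lemma exists_specializes_hypersurface {ι A : Type} [CommRing A] {w : ι → ℕ}
    {f : MvPolynomial ι A} {d : ℕ} (hf : f.IsWeightedHomogeneous w d) {g : MvPolynomial ι A}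
    (hg : FibrewiseRegular f g) (x : hypersurface hf) :
    letI := hGradedAlgebra hf
    ∃ y : hypersurface hf, y ⤳ x ∧
      (hypersurfaceToBase hf).base y = (hypersurfaceToBase hf).base x ∧
      y ∈ Proj.basicOpen (hGrading w f) (Ideal.Quotient.mk _ g) := by
  let _ := hGradedAlgebra hf
  let x' : ProjectiveSpectrum (hGrading w f) := x
  have := x'.isPrime
  obtain ⟨q, hq, hqx, hqb, hqg⟩ := exists_homogeneous_prime_le hf hg x'.asHomogeneousIdeal.toIdeal
  let y : ProjectiveSpectrum (hGrading w f) :=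
    ⟨q, hq, fun h => x'.not_irrelevant_le (h.trans hqx)⟩
  refine ⟨y, ?_, ?_, hqg⟩
  · refine specializes_iff_mem_closure.2 ?_
    exact (ProjectiveSpectrum.le_iff_mem_closure (hGrading w f) y x').1 hqx
  · refine PrimeSpectrum.ext (Ideal.ext fun a => ?_)
    exact (mem_toBase_iff _ _ _).trans ((Ideal.ext_iff.1 hqb a).trans (mem_toBase_iff _ _ _).symm)

end ProjPoints

/-! ### The correspondence between `W × F` and the triple cover -/

section Correspondence

variable {T : Type} [CommRing T]

/-- The binary form of degree five with the roots `0, 1, a, b, c`; multiplied by `x₀`, it is the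
branch form of the surface `W`. -/
def branch (a b c x₀ x₁ : T) : T :=
  x₁ * (x₁ - x₀) * (x₁ - a * x₀) * (x₁ - b * x₀) * (x₁ - c * x₀)

/-- The form `(x - c) p₁ + x p₀` in homogeneous coordinates, where `p₀ = y₁ + y₂` and
`p₁ = w y₁ + w² y₂`. At corresponding points it is proportional to `X₀ + X₁ + X₂`
(`Corresponds.mul_lamForm`). -/
def lamForm (c w x₀ x₁ y₁ y₂ : T) : T :=
  (x₁ - c * x₀) * (w * y₁ + w ^ 2 * y₂) + x₁ * (y₁ + y₂)

/-- The constant coefficient of `mixedForm` as a polynomial in `v`, in homogeneous coordinates; the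
coefficient of `v` is obtained by replacing `w` by `w²`. -/
def alphaForm (a b w x₀ x₁ : T) : T :=
  (a * x₀ - x₁) * (b * x₀ - x₁) + w * ((x₀ - x₁) * (b * x₀ - x₁)) +
    w ^ 2 * ((x₀ - x₁) * (a * x₀ - x₁))

/-- The form whose zeros are removed from the surface `W`. -/
def surfaceForm (a b c w x₀ x₁ y₁ y₂ : T) : T :=
  branch a b c x₀ x₁ * lamForm c w x₀ x₁ y₁ y₂

/-- A form on `W × F`, linear in the coordinate `v` of `F`. At corresponding points it is
proportional to `X₀ + X₁ + X₂` (`Corresponds.mul_eq_mixedForm`). -/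
def mixedForm (a b w x₀ x₁ v : T) : T :=
  alphaForm a b w x₀ x₁ + alphaForm a b (w ^ 2) x₀ x₁ * v

/-- The form whose zeros are removed from the triple cover. In terms of
`x = (X₀ + a X₁ + b X₂) / (X₀ + X₁ + X₂)` its zeros are, besides those of the branch forms other
than `X₀`, the points where `x` is one of `0, 1, ∞, a, b, c`, and the zeros of
`(1 - x) X₀ + w² (a - x) X₁ + w (b - x) X₂`. -/
def coverForm (a b c w X₀ X₁ X₂ X₃ : T) : T :=
  X₁ * X₂ * X₃ * (X₀ + X₁ + X₂) * (X₀ + a * X₁ + b * X₂) * (X₀ + X₁ + X₂ + X₃) *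
    (X₀ + a * X₁ + b * X₂ + c * X₃) *
    ((X₀ + a * X₁ + b * X₂) - (X₀ + X₁ + X₂)) * ((X₀ + a * X₁ + b * X₂) - a * (X₀ + X₁ + X₂)) *
    ((X₀ + a * X₁ + b * X₂) - b * (X₀ + X₁ + X₂)) *
    ((X₀ + a * X₁ + b * X₂) - c * (X₀ + X₁ + X₂)) *
    (((X₀ + X₁ + X₂) - (X₀ + a * X₁ + b * X₂)) * X₀ +
      w ^ 2 * (a * (X₀ + X₁ + X₂) - (X₀ + a * X₁ + b * X₂)) * X₁ +
      w * (b * (X₀ + X₁ + X₂) - (X₀ + a * X₁ + b * X₂)) * X₂)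

/-- The elements are the affine coordinates `x = x₁/x₀`, `y₁/x₀²`, `y₂/x₀²` of a point of the
surface `W_{a,b,c}` and `u = z₀/z₁`, `v = z₂/z₁` of a point of the Fermat curve, and the forms whose
zeros are removed from `W × F` are invertible at this point. -/
structure IsRohdePoint (a b c w x y₁ y₂ u v : T) : Prop where
  surface : y₁ ^ 3 + y₂ ^ 3 + branch a b c 1 x = 0
  fermat : u ^ 3 + 1 + v ^ 3 = 0
  isUnit_surface : IsUnit (surfaceForm a b c w 1 x y₁ y₂)
  isUnit_u : IsUnit u
  isUnit_mixed : IsUnit (mixedForm a b w 1 x v)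

/-- The elements are the affine coordinates `X₁/X₀`, `X₂/X₀`, `X₃/X₀`, `Y = y/X₀²` of a point of the
triple cover at which the form `coverForm` is invertible. -/
structure IsCoverPoint (a b c w X₁ X₂ X₃ Y : T) : Prop where
  cover : Y ^ 3 = X₁ * X₂ * X₃ * (1 + X₁ + X₂ + X₃) * (1 + a * X₁ + b * X₂ + c * X₃)
  isUnit : IsUnit (coverForm a b c w 1 X₁ X₂ X₃)

/-- The equations of the correspondence between `W × F` and the triple cover, with `X₀ = 1`. For
`x = (X₀ + a X₁ + b X₂) / (X₀ + X₁ + X₂)` both `(1 - x) X₀, (a - x) X₁, (b - x) X₂` and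
`(x - c) X₃, -x (X₀ + X₁ + X₂ + X₃), X₀ + a X₁ + b X₂ + c X₃` have sum zero. The first triple is
proportional to `1 + v, w + w² v, w² + w v` and the second one to
`y₁ + y₂, w y₁ + w² y₂, w² y₁ + w y₂`; the variable `Y` fixes the last factor of proportionality.
The equations for the third members are consequences, see `Corresponds.eq_sum`. -/
structure Corresponds (a b c w x y₁ y₂ u v X₁ X₂ X₃ Y : T) : Prop where
  eq_x : x * (1 + X₁ + X₂) = 1 + a * X₁ + b * X₂
  eq_X₁ : (a - x) * X₁ * (1 + v) = (1 - x) * (w + w ^ 2 * v)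
  eq_X₂ : (b - x) * X₂ * (1 + v) = (1 - x) * (w ^ 2 + w * v)
  eq_X₃ : (x - c) * X₃ * (1 - x) * u = Y * (1 + v) * (y₁ + y₂)
  eq_X₃' : -x * (1 + X₁ + X₂ + X₃) * (1 - x) * u = Y * (1 + v) * (w * y₁ + w ^ 2 * y₂)

variable {a b c w x y₁ y₂ u v X₁ X₂ X₃ Y : T}

lemma cube_eq_one_of_sum (hw : 1 + w + w ^ 2 = 0) : w ^ 3 = 1 := by
  linear_combination (w - 1) * hw

/-- Here `w` plays the role of a primitive cube root of unity. -/
lemma mul_forms_eq (hw : 1 + w + w ^ 2 = 0) (p q : T) :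
    (p + q) * (w * p + w ^ 2 * q) * (w ^ 2 * p + w * q) = p ^ 3 + q ^ 3 := by
  grind

lemma exists_mul_eq_of_isUnit {m : T} (h : IsUnit m) (n : T) : ∃ x, m * x = n := by
  obtain ⟨z, hz⟩ := h.dvd (a := n)
  exact ⟨z, hz.symm⟩

lemma isUnit_of_mul_eq {m n z : T} (hn : IsUnit n) (h : m * z = n) : IsUnit z := by
  rw [← h] at hn
  exact isUnit_of_mul_isUnit_right hn

lemma IsRohdePoint.norm_eq (h : IsRohdePoint a b c w x y₁ y₂ u v) (hw : 1 + w + w ^ 2 = 0) :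
    (1 + v) * (w + w ^ 2 * v) * (w ^ 2 + w * v) = -u ^ 3 := by
  have := mul_forms_eq hw 1 v
  linear_combination this + h.fermat

lemma IsRohdePoint.units (h : IsRohdePoint a b c w x y₁ y₂ u v) (hw : 1 + w + w ^ 2 = 0) :
    IsUnit x ∧ IsUnit (x - 1) ∧ IsUnit (x - a) ∧ IsUnit (x - b) ∧ IsUnit (x - c) ∧
      IsUnit (lamForm c w 1 x y₁ y₂) ∧ IsUnit (1 + v) ∧ IsUnit (w + w ^ 2 * v) ∧
      IsUnit (w ^ 2 + w * v) := by
  have h1 := h.isUnit_surface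
  have h2 := h.isUnit_u
  have h3 : IsUnit ((1 + v) * (w + w ^ 2 * v) * (w ^ 2 + w * v)) := by
    rw [h.norm_eq hw]
    exact (h2.pow 3).neg
  simp only [surfaceForm, branch, IsUnit.mul_iff, mul_one] at h1 h3
  tauto

lemma Corresponds.eq_sum (k : Corresponds a b c w x y₁ y₂ u v X₁ X₂ X₃ Y)
    (hw : 1 + w + w ^ 2 = 0) :
    (1 + a * X₁ + b * X₂ + c * X₃) * (1 - x) * u = Y * (1 + v) * (w ^ 2 * y₁ + w * y₂) := by
  linear_combination -k.eq_X₃ - k.eq_X₃' - (1 - x) * u * k.eq_x - Y * (1 + v) * (y₁ + y₂) * hw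

lemma Corresponds.mul_lamForm (k : Corresponds a b c w x y₁ y₂ u v X₁ X₂ X₃ Y) :
    ((1 + v) * lamForm c w 1 x y₁ y₂) * Y = -x * (x - c) * (1 + X₁ + X₂) * (1 - x) * u := by
  rw [lamForm]
  linear_combination -x * k.eq_X₃ - (x - c) * k.eq_X₃'

lemma Corresponds.mul_eq_mixedForm (k : Corresponds a b c w x y₁ y₂ u v X₁ X₂ X₃ Y)
    (hw : 1 + w + w ^ 2 = 0) :
    ((a - x) * (b - x) * (1 + v)) * (1 + X₁ + X₂) = mixedForm a b w 1 x v := by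
  have hw3 := cube_eq_one_of_sum hw
  rw [mixedForm, alphaForm, alphaForm]
  linear_combination (b - x) * k.eq_X₁ + (a - x) * k.eq_X₂ - (1 - x) * (a - x) * v * w * hw3

/-- The equation from which `v` is recovered on the triple cover. -/
lemma Corresponds.mul_scale (k : Corresponds a b c w x y₁ y₂ u v X₁ X₂ X₃ Y)
    (hw : 1 + w + w ^ 2 = 0) :
    (1 + v) * ((1 - x) + w ^ 2 * (a - x) * X₁ + w * (b - x) * X₂) = 3 * (1 - x) := by
  have hw3 := cube_eq_one_of_sum hw
  linear_combination w ^ 2 * k.eq_X₁ + w * k.eq_X₂ + (1 - x) * (2 + v * w) * hw3 + (1 - x) * v * hw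

/-- The product of the five equations of the correspondence gives the equation of the triple cover.
-/
lemma cover_relation_of_products {α β γ s A B v₀ v₁ v₂ p₀ p₁ p₂ : T}
    (k₁ : α * X₁ * v₀ = s * v₁) (k₂ : β * X₂ * v₀ = s * v₂) (k₃ : γ * X₃ * s * u = Y * v₀ * p₀)
    (k₄ : -x * A * s * u = Y * v₀ * p₁) (k₅ : B * s * u = Y * v₀ * p₂)
    (hv : v₀ * v₁ * v₂ = -u ^ 3) (hp : p₀ * p₁ * p₂ = x * s * α * β * γ) :
    x * s * α * β * γ * s ^ 2 * v₀ ^ 2 * u ^ 3 * Y ^ 3 =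
      x * s * α * β * γ * s ^ 2 * v₀ ^ 2 * u ^ 3 * (X₁ * X₂ * X₃ * A * B) := by
  have h : α * X₁ * v₀ * (β * X₂ * v₀) * (γ * X₃ * s * u) * (-x * A * s * u) * (B * s * u) =
      s ^ 2 * v₀ ^ 2 * Y ^ 3 * (v₀ * v₁ * v₂) * (p₀ * p₁ * p₂) := by
    rw [k₁, k₂, k₃, k₄, k₅]
    ring
  rw [hv, hp] at h
  linear_combination h

lemma IsRohdePoint.isCoverPoint (h : IsRohdePoint a b c w x y₁ y₂ u v)
    (k : Corresponds a b c w x y₁ y₂ u v X₁ X₂ X₃ Y)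
    (hw : 1 + w + w ^ 2 = 0) (h3 : IsUnit (3 : T)) : IsCoverPoint a b c w X₁ X₂ X₃ Y := by
  obtain ⟨hx, hx1, hxa, hxb, hxc, hL, hV0, hV1, hV2⟩ := h.units hw
  have hx1' : IsUnit (1 - x) := by rw [← neg_sub]; exact hx1.neg
  have hxa' : IsUnit (a - x) := by rw [← neg_sub]; exact hxa.neg
  have hxb' : IsUnit (b - x) := by rw [← neg_sub]; exact hxb.neg
  have hu := h.isUnit_u
  have hP : (y₁ + y₂) * (w * y₁ + w ^ 2 * y₂) * (w ^ 2 * y₁ + w * y₂) = -branch a b c 1 x := by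
    rw [mul_forms_eq hw]
    linear_combination h.surface
  have hB : IsUnit (branch a b c 1 x) := by
    simp only [branch, mul_one]
    exact (((hx.mul hx1).mul hxa).mul hxb).mul hxc
  have hPu := hB.neg
  rw [← hP] at hPu
  simp only [IsUnit.mul_iff] at hPu
  obtain ⟨⟨hP0, hP1⟩, hP2⟩ := hPu
  have hAA : IsUnit (1 + X₁ + X₂) := isUnit_of_mul_eq h.isUnit_mixed (k.mul_eq_mixedForm hw)
  have hY : IsUnit Y := isUnit_of_mul_eq ((((hx.neg.mul hxc).mul hAA).mul hx1').mul hu)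
    k.mul_lamForm
  constructor
  · have hM : IsUnit (branch a b c 1 x * (1 - x) ^ 2 * (1 + v) ^ 2 * u ^ 3) :=
      ((hB.mul (hx1'.pow 2)).mul (hV0.pow 2)).mul (hu.pow 3)
    refine hM.mul_left_cancel ?_
    have hP' : (y₁ + y₂) * (w * y₁ + w ^ 2 * y₂) * (w ^ 2 * y₁ + w * y₂) =
        x * (1 - x) * (a - x) * (b - x) * (x - c) := by
      rw [hP, branch]
      ring
    have e := cover_relation_of_products k.eq_X₁ k.eq_X₂ k.eq_X₃ k.eq_X₃' (k.eq_sum hw)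
      (h.norm_eq hw) hP'
    have e' : branch a b c 1 x = -(x * (1 - x) * (a - x) * (b - x) * (x - c)) := by
      rw [branch]
      ring
    rw [e']
    linear_combination -e
  · have u1 : IsUnit X₁ := isUnit_of_mul_eq (m := (a - x) * (1 + v)) (hx1'.mul hV1)
      (by linear_combination k.eq_X₁)
    have u2 : IsUnit X₂ := isUnit_of_mul_eq (m := (b - x) * (1 + v)) (hx1'.mul hV2)
      (by linear_combination k.eq_X₂)
    have u3 : IsUnit X₃ := isUnit_of_mul_eq (m := (x - c) * (1 - x) * u) ((hY.mul hV0).mul hP0)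
      (by linear_combination k.eq_X₃)
    have u4 : IsUnit (1 + X₁ + X₂ + X₃) := isUnit_of_mul_eq (m := -x * (1 - x) * u)
      ((hY.mul hV0).mul hP1) (by linear_combination k.eq_X₃')
    have u5 : IsUnit (1 + a * X₁ + b * X₂ + c * X₃) := isUnit_of_mul_eq (m := (1 - x) * u)
      ((hY.mul hV0).mul hP2) (by linear_combination k.eq_sum hw)
    have u6 : IsUnit ((1 - x) + w ^ 2 * (a - x) * X₁ + w * (b - x) * X₂) :=
      isUnit_of_mul_eq (h3.mul hx1') (k.mul_scale hw)
    have e : coverForm a b c w 1 X₁ X₂ X₃ = X₁ * X₂ * X₃ * (1 + X₁ + X₂) * (x * (1 + X₁ + X₂)) *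
        (1 + X₁ + X₂ + X₃) * (1 + a * X₁ + b * X₂ + c * X₃) * ((x - 1) * (1 + X₁ + X₂)) *
        ((x - a) * (1 + X₁ + X₂)) * ((x - b) * (1 + X₁ + X₂)) * ((x - c) * (1 + X₁ + X₂)) *
        ((1 + X₁ + X₂) * ((1 - x) + w ^ 2 * (a - x) * X₁ + w * (b - x) * X₂)) := by
      have f1 : x * (1 + X₁ + X₂) - (1 + X₁ + X₂) = (x - 1) * (1 + X₁ + X₂) := by ring
      have f2 : ∀ t : T, x * (1 + X₁ + X₂) - t * (1 + X₁ + X₂) = (x - t) * (1 + X₁ + X₂) :=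
        fun t => by ring
      have f3 : ((1 + X₁ + X₂) - x * (1 + X₁ + X₂)) * 1 +
          w ^ 2 * (a * (1 + X₁ + X₂) - x * (1 + X₁ + X₂)) * X₁ +
          w * (b * (1 + X₁ + X₂) - x * (1 + X₁ + X₂)) * X₂ =
          (1 + X₁ + X₂) * ((1 - x) + w ^ 2 * (a - x) * X₁ + w * (b - x) * X₂) := by ring
      rw [coverForm, ← k.eq_x, f1, f2, f2, f2, f3]
    rw [e]
    simp only [IsUnit.mul_iff]
    tauto

/-- The morphism from `W × F` to the triple cover. -/
lemma IsRohdePoint.exists_corresponds (h : IsRohdePoint a b c w x y₁ y₂ u v)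
    (hw : 1 + w + w ^ 2 = 0) :
    ∃ X₁ X₂ X₃ Y, Corresponds a b c w x y₁ y₂ u v X₁ X₂ X₃ Y := by
  obtain ⟨hx, hx1, hxa, hxb, hxc, hL, hV0, hV1, hV2⟩ := h.units hw
  have hx1' : IsUnit (1 - x) := by rw [← neg_sub]; exact hx1.neg
  have hxa' : IsUnit (a - x) := by rw [← neg_sub]; exact hxa.neg
  have hxb' : IsUnit (b - x) := by rw [← neg_sub]; exact hxb.neg
  have hw3 := cube_eq_one_of_sum hw
  obtain ⟨X₁, h1⟩ := exists_mul_eq_of_isUnit (hxa'.mul hV0) ((1 - x) * (w + w ^ 2 * v))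
  obtain ⟨X₂, h2⟩ := exists_mul_eq_of_isUnit (hxb'.mul hV0) ((1 - x) * (w ^ 2 + w * v))
  obtain ⟨Y, h4⟩ := exists_mul_eq_of_isUnit (hV0.mul hL)
    (-x * (x - c) * (1 + X₁ + X₂) * (1 - x) * u)
  obtain ⟨X₃, h5⟩ := exists_mul_eq_of_isUnit ((hxc.mul hx1').mul h.isUnit_u)
    (Y * (1 + v) * (y₁ + y₂))
  refine ⟨X₁, X₂, X₃, Y, ?_, ?_, ?_, ?_, ?_⟩
  · refine hV0.mul_left_cancel ?_
    linear_combination -h1 - h2 - (1 - x) * (1 + v) * hw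
  · linear_combination h1
  · linear_combination h2
  · linear_combination h5
  · refine hxc.mul_left_cancel ?_
    rw [lamForm] at h4
    linear_combination -h4 - x * h5

lemma Corresponds.cover_unique {X₁' X₂' X₃' Y' : T} (hw : 1 + w + w ^ 2 = 0)
    (h : IsRohdePoint a b c w x y₁ y₂ u v)
    (k : Corresponds a b c w x y₁ y₂ u v X₁ X₂ X₃ Y)
    (k' : Corresponds a b c w x y₁ y₂ u v X₁' X₂' X₃' Y') :
    X₁ = X₁' ∧ X₂ = X₂' ∧ X₃ = X₃' ∧ Y = Y' := by
  obtain ⟨hx, hx1, hxa, hxb, hxc, hL, hV0, hV1, hV2⟩ := h.units hw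
  have hx1' : IsUnit (1 - x) := by rw [← neg_sub]; exact hx1.neg
  have hxa' : IsUnit (a - x) := by rw [← neg_sub]; exact hxa.neg
  have hxb' : IsUnit (b - x) := by rw [← neg_sub]; exact hxb.neg
  have e1 : X₁ = X₁' := (hxa'.mul hV0).mul_left_cancel (by linear_combination k.eq_X₁ - k'.eq_X₁)
  have e2 : X₂ = X₂' := (hxb'.mul hV0).mul_left_cancel (by linear_combination k.eq_X₂ - k'.eq_X₂)
  subst e1 e2
  have e4 : Y = Y' := (hV0.mul hL).mul_left_cancel (k.mul_lamForm.trans k'.mul_lamForm.symm)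
  subst e4
  refine ⟨rfl, rfl, ((hxc.mul hx1').mul h.isUnit_u).mul_left_cancel ?_, rfl⟩
  linear_combination k.eq_X₃ - k'.eq_X₃

/-- The product of `X₀ + X₁ + X₂` and `(1 - x) X₀ + w² (a - x) X₁ + w (b - x) X₂`, for `X₀ = 1` and
`x` as in `Corresponds`. -/
def scaleForm (a b w X₁ X₂ : T) : T :=
  ((1 + X₁ + X₂) - (1 + a * X₁ + b * X₂)) +
      w ^ 2 * (a * (1 + X₁ + X₂) - (1 + a * X₁ + b * X₂)) * X₁ +
      w * (b * (1 + X₁ + X₂) - (1 + a * X₁ + b * X₂)) * X₂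

/-- The numerator of the invariant function `u³`, with denominator `scaleForm³`, on the triple
cover; see `IsRohdePoint.cube_eq`. -/
def cubeForm (a b X₁ X₂ : T) : T :=
  -(27 * ((1 + X₁ + X₂) - (1 + a * X₁ + b * X₂)) *
      (a * (1 + X₁ + X₂) - (1 + a * X₁ + b * X₂)) *
      (b * (1 + X₁ + X₂) - (1 + a * X₁ + b * X₂)) * X₁ * X₂)

lemma IsCoverPoint.units (h : IsCoverPoint a b c w X₁ X₂ X₃ Y) :
    IsUnit X₁ ∧ IsUnit X₂ ∧ IsUnit X₃ ∧ IsUnit Y ∧ IsUnit (1 + X₁ + X₂) ∧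
    IsUnit (1 + a * X₁ + b * X₂) ∧ IsUnit (1 + X₁ + X₂ + X₃) ∧
    IsUnit (1 + a * X₁ + b * X₂ + c * X₃) ∧
    IsUnit ((1 + a * X₁ + b * X₂) - (1 + X₁ + X₂)) ∧
    IsUnit ((1 + a * X₁ + b * X₂) - a * (1 + X₁ + X₂)) ∧
    IsUnit ((1 + a * X₁ + b * X₂) - b * (1 + X₁ + X₂)) ∧
    IsUnit ((1 + a * X₁ + b * X₂) - c * (1 + X₁ + X₂)) ∧ IsUnit (scaleForm a b w X₁ X₂) := by
  have h1 := h.isUnit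
  have h2 := h.cover
  simp only [coverForm, IsUnit.mul_iff, mul_one] at h1
  have h3 : IsUnit Y := by
    rw [← isUnit_pow_iff (three_ne_zero), h2]
    simp only [IsUnit.mul_iff]
    tauto
  rw [scaleForm]
  tauto

lemma scale_relation_of_products {p q s A n v₀ v₁ v₂ : T}
    (k₁ : p * v₀ = s * v₁) (k₂ : q * v₀ = s * v₂) (hv : v₀ * v₁ * v₂ = -u ^ 3)
    (hn : v₀ * n = 3 * s) :
    v₀ ^ 3 * (u ^ 3 * (A * n) ^ 3) = v₀ ^ 3 * (-27 * A ^ 3 * s * p * q) := by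
  have h : u ^ 3 * A ^ 3 * (v₀ * n) ^ 3 = u ^ 3 * A ^ 3 * (3 * s) ^ 3 := by rw [hn]
  have h' : p * v₀ * (q * v₀) = s * v₁ * (s * v₂) := by rw [k₁, k₂]
  linear_combination h + 27 * A ^ 3 * s * v₀ * h' + 27 * A ^ 3 * s ^ 3 * hv

/-- The product of the five equations of the correspondence gives the equation of the surface. -/
lemma surface_relation_of_products {α β γ s A B v₀ v₁ v₂ p₀ p₁ p₂ : T}
    (k₁ : α * X₁ * v₀ = s * v₁) (k₂ : β * X₂ * v₀ = s * v₂) (k₃ : γ * X₃ * s * u = Y * v₀ * p₀)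
    (k₄ : -x * A * s * u = Y * v₀ * p₁) (k₅ : B * s * u = Y * v₀ * p₂)
    (hv : v₀ * v₁ * v₂ = -u ^ 3) (hY : Y ^ 3 = X₁ * X₂ * X₃ * A * B) :
    s ^ 2 * u ^ 3 * (X₃ * A * B) * (p₀ * p₁ * p₂) =
      s ^ 2 * u ^ 3 * (X₃ * A * B) * (x * s * α * β * γ) := by
  have h₁ : (γ * X₃ * s * u) * (-x * A * s * u) * (B * s * u) =
      Y ^ 3 * v₀ ^ 3 * (p₀ * p₁ * p₂) := by
    rw [k₃, k₄, k₅]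
    ring
  have h₂ : α * X₁ * v₀ * (β * X₂ * v₀) = s * v₁ * (s * v₂) := by rw [k₁, k₂]
  linear_combination α * β * h₁ + α * β * v₀ ^ 3 * (p₀ * p₁ * p₂) * hY +
    X₃ * A * B * v₀ * (p₀ * p₁ * p₂) * h₂ + X₃ * A * B * s ^ 2 * (p₀ * p₁ * p₂) * hv

lemma IsRohdePoint.cube_eq (h : IsRohdePoint a b c w x y₁ y₂ u v)
    (k : Corresponds a b c w x y₁ y₂ u v X₁ X₂ X₃ Y) (hw : 1 + w + w ^ 2 = 0) :
    u ^ 3 * scaleForm a b w X₁ X₂ ^ 3 = cubeForm a b X₁ X₂ := by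
  obtain ⟨hx, hx1, hxa, hxb, hxc, hL, hV0, hV1, hV2⟩ := h.units hw
  refine (hV0.pow 3).mul_left_cancel ?_
  have e1 : scaleForm a b w X₁ X₂ =
      (1 + X₁ + X₂) * ((1 - x) + w ^ 2 * (a - x) * X₁ + w * (b - x) * X₂) := by
    rw [scaleForm, ← k.eq_x]
    ring
  have e2 : cubeForm a b X₁ X₂ = -27 * (1 + X₁ + X₂) ^ 3 * (1 - x) * ((a - x) * X₁) *
      ((b - x) * X₂) := by
    rw [cubeForm, ← k.eq_x]
    ring
  have e3 := k.mul_scale hw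
  rw [e1, e2]
  exact scale_relation_of_products k.eq_X₁ k.eq_X₂ (h.norm_eq hw) e3

/-- A point of the triple cover and a cube root `u` of `cubeForm / scaleForm³` come from a point of
`W × F`. -/
lemma IsCoverPoint.exists_corresponds (h : IsCoverPoint a b c w X₁ X₂ X₃ Y)
    (hw : 1 + w + w ^ 2 = 0) (h3 : IsUnit (3 : T))
    (hu : u ^ 3 * scaleForm a b w X₁ X₂ ^ 3 = cubeForm a b X₁ X₂) :
    ∃ x y₁ y₂ v, Corresponds a b c w x y₁ y₂ u v X₁ X₂ X₃ Y ∧ IsRohdePoint a b c w x y₁ y₂ u v := by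
  obtain ⟨u1, u2, u3, uY, uA, uB, uA3, uB3, ub1, uba, ubb, ubc, uN⟩ := h.units
  have hw3 := cube_eq_one_of_sum hw
  obtain ⟨x, hx⟩ := exists_mul_eq_of_isUnit uA (1 + a * X₁ + b * X₂)
  have ux : IsUnit x := isUnit_of_mul_eq uB hx
  have ux1 : IsUnit (x - 1) := isUnit_of_mul_eq ub1 (m := 1 + X₁ + X₂) (by rw [← hx]; ring)
  have uxa : IsUnit (x - a) := isUnit_of_mul_eq uba (m := 1 + X₁ + X₂) (by rw [← hx]; ring)
  have uxb : IsUnit (x - b) := isUnit_of_mul_eq ubb (m := 1 + X₁ + X₂) (by rw [← hx]; ring)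
  have uxc : IsUnit (x - c) := isUnit_of_mul_eq ubc (m := 1 + X₁ + X₂) (by rw [← hx]; ring)
  have ux1' : IsUnit (1 - x) := by rw [← neg_sub]; exact ux1.neg
  have uxa' : IsUnit (a - x) := by rw [← neg_sub]; exact uxa.neg
  have uxb' : IsUnit (b - x) := by rw [← neg_sub]; exact uxb.neg
  have e1 : scaleForm a b w X₁ X₂ =
      (1 + X₁ + X₂) * ((1 - x) + w ^ 2 * (a - x) * X₁ + w * (b - x) * X₂) := by
    rw [scaleForm, ← hx]
    ring
  have e2 : cubeForm a b X₁ X₂ = -27 * (1 + X₁ + X₂) ^ 3 * (1 - x) * ((a - x) * X₁) *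
      ((b - x) * X₂) := by
    rw [cubeForm, ← hx]
    ring
  have uu : IsUnit u := by
    have : IsUnit (u ^ 3 * scaleForm a b w X₁ X₂ ^ 3) := by
      rw [hu, e2]
      have u27 : IsUnit (-27 : T) := by
        rw [show (-27 : T) = -3 ^ 3 by norm_num]
        exact (h3.pow 3).neg
      exact (((u27.mul (uA.pow 3)).mul ux1').mul (uxa'.mul u1)).mul (uxb'.mul u2)
    exact (isUnit_pow_iff three_ne_zero).1 (isUnit_of_mul_isUnit_left this)
  set n := (1 - x) + w ^ 2 * (a - x) * X₁ + w * (b - x) * X₂ with hn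
  have un : IsUnit n := isUnit_of_mul_eq uN e1.symm
  obtain ⟨V, hV⟩ := exists_mul_eq_of_isUnit un (3 * (1 - x))
  obtain ⟨v, rfl⟩ : ∃ v, V = 1 + v := ⟨V - 1, by ring⟩
  have uV : IsUnit (1 + v) := isUnit_of_mul_eq (h3.mul ux1') hV
  -- The linear form `n` is three times the factor of proportionality of the first triple. This
  -- determines `v`, and as the sum of the triple is zero, the other two members follow.
  have hE : (a - x) * X₁ + (b - x) * X₂ + (1 - x) = 0 := by linear_combination -hx
  have hn1 : n * (w + w ^ 2 * v) = 3 * ((a - x) * X₁) := by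
    linear_combination w ^ 2 * hV + (w - w ^ 2) * w * hE +
      (w * (1 - x) + (-w ^ 2 + 3 * w - 3) * ((a - x) * X₁)) * hw
  have hn2 : n * (w ^ 2 + w * v) = 3 * ((b - x) * X₂) := by
    linear_combination w * hV + (w ^ 2 - w) * w ^ 2 * hE +
      ((-w ^ 2 + 2 * w) * (1 - x) + (-w ^ 2 + 3 * w - 3) * ((b - x) * X₂)) * hw
  have k1 : (a - x) * X₁ * (1 + v) = (1 - x) * (w + w ^ 2 * v) := by
    refine un.mul_left_cancel ?_
    linear_combination (a - x) * X₁ * hV - (1 - x) * hn1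
  have k2 : (b - x) * X₂ * (1 + v) = (1 - x) * (w ^ 2 + w * v) := by
    refine un.mul_left_cancel ?_
    linear_combination (b - x) * X₂ * hV - (1 - x) * hn2
  have hf : (1 + v) * (w + w ^ 2 * v) * (w ^ 2 + w * v) = -u ^ 3 := by
    refine ((un.pow 3).mul (uA.pow 3)).mul_left_cancel ?_
    have e3 : n * (1 + v) * (n * (w + w ^ 2 * v)) * (n * (w ^ 2 + w * v)) =
        3 * (1 - x) * (3 * ((a - x) * X₁)) * (3 * ((b - x) * X₂)) := by rw [hV, hn1, hn2]
    rw [e1, e2] at hu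
    generalize 1 + X₁ + X₂ = A, w + w ^ 2 * v = v₁, w ^ 2 + w * v = v₂, 1 + v = v₀ at *
    linear_combination A ^ 3 * e3 + hu
  obtain ⟨p, hp⟩ := exists_mul_eq_of_isUnit (uY.mul uV) ((x - c) * X₃ * (1 - x) * u)
  obtain ⟨q, hq⟩ := exists_mul_eq_of_isUnit (uY.mul uV) (-x * (1 + X₁ + X₂ + X₃) * (1 - x) * u)
  -- The inverse discrete Fourier transform of the triple `p, q, -p - q`.
  obtain ⟨y₁, hy₁⟩ := exists_mul_eq_of_isUnit h3 (p + w ^ 2 * q + w * (-p - q))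
  obtain ⟨y₂, hy₂⟩ := exists_mul_eq_of_isUnit h3 (p + w * q + w ^ 2 * (-p - q))
  have ep : y₁ + y₂ = p := h3.mul_left_cancel (by linear_combination hy₁ + hy₂ - p * hw)
  have eq : w * y₁ + w ^ 2 * y₂ = q := h3.mul_left_cancel (by
    linear_combination w * hy₁ + w ^ 2 * hy₂ + (w * (1 - w) * p + (-w ^ 2 + 3 * w - 3) * q) * hw)
  have k : Corresponds a b c w x y₁ y₂ u v X₁ X₂ X₃ Y :=
    ⟨by rw [← hx, mul_comm], k1, k2, by rw [ep, hp], by rw [eq, hq]⟩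
  have hB : IsUnit (branch a b c 1 x) := by
    simp only [branch, mul_one]
    exact (((ux.mul ux1).mul uxa).mul uxb).mul uxc
  refine ⟨x, y₁, y₂, v, k, ?_, ?_, ?_, uu, ?_⟩
  · have hM : IsUnit ((1 - x) ^ 2 * u ^ 3 *
        (X₃ * (1 + X₁ + X₂ + X₃) * (1 + a * X₁ + b * X₂ + c * X₃))) :=
      ((ux1'.pow 2).mul (uu.pow 3)).mul ((u3.mul uA3).mul uB3)
    have e := hM.mul_left_cancel (surface_relation_of_products k1 k2 k.eq_X₃ k.eq_X₃' (k.eq_sum hw)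
      hf h.cover)
    rw [mul_forms_eq hw] at e
    rw [e, branch]
    ring
  · have := mul_forms_eq hw 1 v
    linear_combination hf - this
  · exact hB.mul (isUnit_of_mul_eq (m := (1 + v) * Y)
      ((((ux.neg.mul uxc).mul uA).mul ux1').mul uu) (by linear_combination k.mul_lamForm))
  · rw [← k.mul_eq_mixedForm hw]
    exact ((uxa'.mul uxb').mul uV).mul uA

lemma Corresponds.rohde_unique {x' y₁' y₂' v' : T} (h : IsCoverPoint a b c w X₁ X₂ X₃ Y)
    (hw : 1 + w + w ^ 2 = 0) (h3 : IsUnit (3 : T))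
    (k : Corresponds a b c w x y₁ y₂ u v X₁ X₂ X₃ Y)
    (k' : Corresponds a b c w x' y₁' y₂' u v' X₁ X₂ X₃ Y) (uv : IsUnit (1 + v)) :
    x = x' ∧ y₁ = y₁' ∧ y₂ = y₂' ∧ v = v' := by
  obtain ⟨u1, u2, u3, uY, uA, uB, uA3, uB3, ub1, uba, ubb, ubc, uN⟩ := h.units
  have hx : x = x' := uA.mul_right_cancel (k.eq_x.trans k'.eq_x.symm)
  subst hx
  have e1 : scaleForm a b w X₁ X₂ =
      (1 + X₁ + X₂) * ((1 - x) + w ^ 2 * (a - x) * X₁ + w * (b - x) * X₂) := by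
    rw [scaleForm, ← k.eq_x]
    ring
  have un := isUnit_of_mul_eq uN e1.symm
  have hv : v = v' := by
    have := un.mul_right_cancel ((k.mul_scale hw).trans (k'.mul_scale hw).symm)
    exact add_left_cancel this
  subst hv
  have e4 : y₁ + y₂ = y₁' + y₂' := (uY.mul uv).mul_left_cancel (k.eq_X₃.symm.trans k'.eq_X₃)
  have e5 : w * y₁ + w ^ 2 * y₂ = w * y₁' + w ^ 2 * y₂' :=
    (uY.mul uv).mul_left_cancel (k.eq_X₃'.symm.trans k'.eq_X₃')
  refine ⟨rfl, h3.mul_left_cancel ?_, h3.mul_left_cancel ?_, rfl⟩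
  · linear_combination (1 - w) * e4 + (w ^ 2 - w) * e5 +
      ((2 - w) * (y₁ - y₁') + (1 - w) * (w - 1) * (y₂ - y₂')) * hw
  · linear_combination (1 - w ^ 2) * e4 + (w - w ^ 2) * e5 +
      ((w - 1) * (y₁ - y₁') + (w ^ 2 - 2 * w + 2) * (y₂ - y₂')) * hw

end Correspondence

/-! ### Universal points and invariants -/

section Universal

variable {A R S : Type} [CommRing A] [CommRing R] [CommRing S]

lemma IsCoverPoint.map {T T' : Type} [CommRing T] [CommRing T'] (F : T →+* T')
    {a b c w X₁ X₂ X₃ Y : T} (h : IsCoverPoint a b c w X₁ X₂ X₃ Y) :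
    IsCoverPoint (F a) (F b) (F c) (F w) (F X₁) (F X₂) (F X₃) (F Y) := by
  refine ⟨?_, ?_⟩
  · simpa using congrArg F h.cover
  · simpa [coverForm] using h.isUnit.map F

lemma Corresponds.map {T T' : Type} [CommRing T] [CommRing T'] (F : T →+* T')
    {a b c w x y₁ y₂ u v X₁ X₂ X₃ Y : T} (h : Corresponds a b c w x y₁ y₂ u v X₁ X₂ X₃ Y) :
    Corresponds (F a) (F b) (F c) (F w) (F x) (F y₁) (F y₂) (F u) (F v) (F X₁) (F X₂) (F X₃)
      (F Y) := by
  refine ⟨?_, ?_, ?_, ?_, ?_⟩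
  · simpa using congrArg F h.eq_x
  · simpa using congrArg F h.eq_X₁
  · simpa using congrArg F h.eq_X₂
  · simpa using congrArg F h.eq_X₃
  · simpa using congrArg F h.eq_X₃'

/-- The `A`-algebra `R` with the elements `x, y₁, y₂, u, v` represents the functor of all points in
the sense of `IsRohdePoint`. -/
structure IsUniversalRohde (a b c w : A) (α : A →+* R) (x y₁ y₂ u v : R) : Prop where
  point : IsRohdePoint (α a) (α b) (α c) (α w) x y₁ y₂ u v
  ext : ∀ {T : Type} [CommRing T] (F G : R →+* T), F.comp α = G.comp α → F x = G x →
    F y₁ = G y₁ → F y₂ = G y₂ → F u = G u → F v = G v → F = G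
  lift : ∀ {T : Type} [CommRing T] (β : A →+* T) (x' y₁' y₂' u' v' : T),
    IsRohdePoint (β a) (β b) (β c) (β w) x' y₁' y₂' u' v' →
    ∃ F : R →+* T, F.comp α = β ∧ F x = x' ∧ F y₁ = y₁' ∧ F y₂ = y₂' ∧ F u = u' ∧ F v = v'

/-- The `A`-algebra `S` with the elements `X₁, X₂, X₃, Y` represents the functor of all points in
the sense of `IsCoverPoint`. -/
structure IsUniversalCover (a b c w : A) (α : A →+* S) (X₁ X₂ X₃ Y : S) : Prop where
  point : IsCoverPoint (α a) (α b) (α c) (α w) X₁ X₂ X₃ Y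
  ext : ∀ {T : Type} [CommRing T] (F G : S →+* T), F.comp α = G.comp α → F X₁ = G X₁ →
    F X₂ = G X₂ → F X₃ = G X₃ → F Y = G Y → F = G
  lift : ∀ {T : Type} [CommRing T] (β : A →+* T) (X₁' X₂' X₃' Y' : T),
    IsCoverPoint (β a) (β b) (β c) (β w) X₁' X₂' X₃' Y' →
    ∃ F : S →+* T, F.comp α = β ∧ F X₁ = X₁' ∧ F X₂ = X₂' ∧ F X₃ = X₃' ∧ F Y = Y'

variable {a b c w : A} {α : A →+* R} {x y₁ y₂ u v : R} {α' : A →+* S} {X₁ X₂ X₃ Y : S}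

/-- The generator of the group acts on the points of `W × F`; as `u = z₀/z₁`, it multiplies `u` by
`w`. -/
lemma IsRohdePoint.twist {T : Type} [CommRing T] {a b c w x y₁ y₂ u v : T}
    (h : IsRohdePoint a b c w x y₁ y₂ u v) (hw : 1 + w + w ^ 2 = 0) :
    IsRohdePoint a b c w x (w * y₁) (w * y₂) (w * u) v := by
  have hw3 := cube_eq_one_of_sum hw
  have uw : IsUnit w := IsUnit.of_mul_eq_one (w ^ 2) (by linear_combination hw3)
  refine ⟨?_, ?_, ?_, uw.mul h.isUnit_u, h.isUnit_mixed⟩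
  · linear_combination h.surface + (y₁ ^ 3 + y₂ ^ 3) * hw3
  · linear_combination h.fermat + u ^ 3 * hw3
  · have : surfaceForm a b c w 1 x (w * y₁) (w * y₂) = w * surfaceForm a b c w 1 x y₁ y₂ := by
      rw [surfaceForm, surfaceForm, lamForm, lamForm]
      ring
    rw [this]
    exact uw.mul h.isUnit_surface

/-- The correspondence is invariant under the group. -/
lemma Corresponds.twist {T : Type} [CommRing T] {a b c w x y₁ y₂ u v X₁ X₂ X₃ Y : T}
    (k : Corresponds a b c w x y₁ y₂ u v X₁ X₂ X₃ Y) :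
    Corresponds a b c w x (w * y₁) (w * y₂) (w * u) v X₁ X₂ X₃ Y :=
  ⟨k.eq_x, k.eq_X₁, k.eq_X₂, by linear_combination w * k.eq_X₃,
    by linear_combination w * k.eq_X₃'⟩

/-- The action of the generator of the group on the universal ring. -/
lemma IsUniversalRohde.exists_aut (h : IsUniversalRohde a b c w α x y₁ y₂ u v)
    (hw : 1 + w + w ^ 2 = 0) :
    ∃ σ : R ≃+* R, σ ^ 3 = 1 ∧ (∀ z, σ (α z) = α z) ∧ σ x = x ∧ σ y₁ = α w * y₁ ∧
      σ y₂ = α w * y₂ ∧ σ u = α w * u ∧ σ v = v := by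
  have hw' : 1 + α w + α w ^ 2 = 0 := by simpa using congrArg α hw
  have hw3 := cube_eq_one_of_sum hw'
  obtain ⟨F, hα, hx, hy₁, hy₂, hu, hv⟩ := h.lift α _ _ _ _ _ (h.point.twist hw')
  have hα' : ∀ z, F (α z) = α z := fun z => RingHom.congr_fun hα z
  have h3 : (F.comp F).comp F = RingHom.id R := by
    refine h.ext _ _ ?_ ?_ ?_ ?_ ?_ ?_
    · ext z
      simp [hα']
    · simp [hx]
    · simp only [RingHom.comp_apply, hy₁, map_mul, hα', RingHom.id_apply]
      linear_combination y₁ * hw3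
    · simp only [RingHom.comp_apply, hy₂, map_mul, hα', RingHom.id_apply]
      linear_combination y₂ * hw3
    · simp only [RingHom.comp_apply, hu, map_mul, hα', RingHom.id_apply]
      linear_combination u * hw3
    · simp [hv]
  let σ : R ≃+* R := RingEquiv.ofRingHom F (F.comp F) (by rw [← RingHom.comp_assoc, h3]) h3
  refine ⟨σ, ?_, hα', hx, hy₁, hy₂, hu, hv⟩
  ext r
  exact RingHom.congr_fun h3 r

lemma adjoinRoot_of_injective (κ : S) :
    Function.Injective (AdjoinRoot.of (Polynomial.X ^ 3 - Polynomial.C κ)) := by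
  nontriviality S
  have hf := Polynomial.monic_X_pow_sub_C κ three_ne_zero
  rw [injective_iff_map_eq_zero]
  intro s hs
  have hs' : AdjoinRoot.mk (Polynomial.X ^ 3 - Polynomial.C κ) (Polynomial.C s) = 0 := hs
  rw [AdjoinRoot.mk_eq_zero] at hs'
  by_contra h0
  refine hf.not_dvd_of_degree_lt (by simpa using h0) ?_ hs'
  rw [Polynomial.degree_X_pow_sub_C three_pos]
  exact Polynomial.degree_C_le.trans_lt (by norm_num)

lemma adjoinRoot_exists_eq (κ : S) (t : AdjoinRoot (Polynomial.X ^ 3 - Polynomial.C κ)) :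
    ∃ s₀ s₁ s₂ : S, t = AdjoinRoot.of _ s₀ + AdjoinRoot.of _ s₁ * AdjoinRoot.root _ +
      AdjoinRoot.of _ s₂ * AdjoinRoot.root _ ^ 2 := by
  have hf := Polynomial.monic_X_pow_sub_C κ three_ne_zero
  obtain ⟨p, rfl⟩ := AdjoinRoot.mk_surjective t
  rcases subsingleton_or_nontrivial S with hS | hS
  · refine ⟨0, 0, 0, ?_⟩
    rw [Subsingleton.elim p 0]
    simp
  set f := Polynomial.X ^ 3 - Polynomial.C κ with hfdef
  have h1 : AdjoinRoot.mk f p = AdjoinRoot.mk f (p %ₘ f) := by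
    rw [AdjoinRoot.mk_eq_mk]
    exact ⟨p /ₘ f, by linear_combination (Polynomial.modByMonic_add_div p f).symm⟩
  have hd : (p %ₘ f).natDegree < 3 := by
    have h := Polynomial.natDegree_modByMonic_lt p hf (by
      intro h1
      have := congrArg Polynomial.natDegree h1
      rw [hfdef, Polynomial.natDegree_X_pow_sub_C, Polynomial.natDegree_one] at this
      exact absurd this (by norm_num))
    rwa [hfdef, Polynomial.natDegree_X_pow_sub_C] at h
  refine ⟨(p %ₘ f).coeff 0, (p %ₘ f).coeff 1, (p %ₘ f).coeff 2, ?_⟩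
  rw [h1]
  conv_lhs => rw [(p %ₘ f).as_sum_range_C_mul_X_pow' hd]
  simp [Finset.sum_range_succ, AdjoinRoot.mk_C, AdjoinRoot.mk_X]

/-- The universal ring of the points of the triple cover is the ring of invariants in the universal
ring of the points of `W × F`: the latter is obtained from the former by adjoining a cube root `u`
of the function `κ = cubeForm / scaleForm³`. -/
theorem IsUniversalRohde.exists_invariants (h : IsUniversalRohde a b c w α x y₁ y₂ u v)
    (h' : IsUniversalCover a b c w α' X₁ X₂ X₃ Y) (hw : 1 + w + w ^ 2 = 0) (h3 : IsUnit (3 : A)) :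
    ∃ φ : S →+* R, φ.comp α' = α ∧ Function.Injective φ ∧ ∀ σ : R →+* R, (∀ z, σ (α z) = α z) →
      σ x = x → σ y₁ = α w * y₁ → σ y₂ = α w * y₂ → σ u = α w * u → σ v = v →
      (∀ s, σ (φ s) = φ s) ∧ ∀ r, σ r = r → ∃ s, φ s = r := by
  have hwR : 1 + α w + α w ^ 2 = 0 := by simpa using congrArg α hw
  have hwS : 1 + α' w + α' w ^ 2 = 0 := by simpa using congrArg α' hw
  have h3R : IsUnit (3 : R) := by
    have := h3.map α
    rwa [map_ofNat] at this
  have h3S : IsUnit (3 : S) := by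
    have := h3.map α'
    rwa [map_ofNat] at this
  obtain ⟨Z₁, Z₂, Z₃, Z, k⟩ := h.point.exists_corresponds hwR
  obtain ⟨φ, hφα, hφ1, hφ2, hφ3, hφ4⟩ := h'.lift α _ _ _ _ (h.point.isCoverPoint k hwR h3R)
  have hφα' : ∀ z, φ (α' z) = α z := fun z => RingHom.congr_fun hφα z
  obtain ⟨-, -, -, -, -, -, -, -, -, -, -, -, uN⟩ := h'.point.units
  obtain ⟨κ, hκ⟩ := exists_mul_eq_of_isUnit (uN.pow 3) (cubeForm (α' a) (α' b) X₁ X₂)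
  let f : Polynomial S := Polynomial.X ^ 3 - Polynomial.C κ
  have hf : f.Monic := Polynomial.monic_X_pow_sub_C κ three_ne_zero
  let T := AdjoinRoot f
  let ι : S →+* T := AdjoinRoot.of f
  let U : T := AdjoinRoot.root f
  have hU : U ^ 3 = ι κ := by
    have := AdjoinRoot.eval₂_root f
    simpa [f, sub_eq_zero] using this
  have hwT : 1 + ι (α' w) + ι (α' w) ^ 2 = 0 := by simpa using congrArg ι hwS
  have h3T : IsUnit (3 : T) := by
    have := h3S.map ι
    rwa [map_ofNat] at this
  have hpT := h'.point.map ι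
  -- The universal point of the triple cover and the adjoined cube root give a homomorphism `ψ` from
  -- `R` to `T = S[u]/(u³ - κ)`; it turns out to be inverse to the obvious homomorphism `χ`.
  obtain ⟨x', y₁', y₂', v', kT, hT⟩ := hpT.exists_corresponds (u := U) hwT h3T (by
    rw [hU]
    have := congrArg ι hκ
    simp only [scaleForm, cubeForm, map_mul, map_pow, map_sub, map_add, map_one, map_neg,
      map_ofNat] at this ⊢
    rw [mul_comm]
    exact this)
  obtain ⟨ψ, hψα, hψx, hψy₁, hψy₂, hψu, hψv⟩ := h.lift (ι.comp α') _ _ _ _ _ hT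
  have hψα' : ∀ z, ψ (α z) = ι (α' z) := fun z => RingHom.congr_fun hψα z
  have hψφ : ψ.comp φ = ι := by
    have k' := k.map ψ
    simp only [hψα', hψx, hψy₁, hψy₂, hψu, hψv] at k'
    obtain ⟨e1, e2, e3, e4⟩ := k'.cover_unique hwT hT kT
    refine h'.ext _ _ ?_ ?_ ?_ ?_ ?_
    · ext z
      simp [hφα', hψα']
    all_goals simp only [RingHom.comp_apply, hφ1, hφ2, hφ3, hφ4, e1, e2, e3, e4]
  have hφκ : φ κ = u ^ 3 := by
    have e1 := h.point.cube_eq k hwR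
    have e2 := congrArg φ hκ
    simp only [scaleForm, cubeForm, map_mul, map_pow, map_sub, map_add, map_one, map_neg, hφα',
      hφ1, hφ2, map_ofNat] at e1 e2
    have uN' := uN.map φ
    simp only [scaleForm, map_mul, map_pow, map_sub, map_add, map_one, hφα', hφ1, hφ2] at uN'
    refine (uN'.pow 3).mul_left_cancel ?_
    rw [e2, ← e1, mul_comm]
  let χ : T →+* R := AdjoinRoot.lift φ u (by simp [f, hφκ])
  have hχι : ∀ s, χ (ι s) = φ s := fun s => AdjoinRoot.lift_of _
  have hχU : χ U = u := AdjoinRoot.lift_root _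
  have hχψ : χ.comp ψ = RingHom.id R := by
    have kT' := kT.map χ
    simp only [hχι, hχU, hφα', hφ1, hφ2, hφ3, hφ4] at kT'
    have uv := (hT.units hwT).2.2.2.2.2.2.1.map χ
    rw [map_add, map_one] at uv
    obtain ⟨e1, e2, e3, e4⟩ := kT'.rohde_unique (h.point.isCoverPoint k hwR h3R) hwR h3R k uv
    refine h.ext _ _ ?_ ?_ ?_ ?_ ?_ ?_
    · ext z
      simp [hψα', hχι, hφα']
    · simp [hψx, e1]
    · simp [hψy₁, e2]
    · simp [hψy₂, e3]
    · simp [hψu, hχU]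
    · simp [hψv, e4]
  refine ⟨φ, hφα, ?_, ?_⟩
  · have hι : Function.Injective ι := adjoinRoot_of_injective κ
    refine Function.Injective.of_comp (f := ψ) ?_
    rw [← RingHom.coe_comp, hψφ]
    exact hι
  · intro σ hσα hσx hσy₁ hσy₂ hσu hσv
    have hσφ : σ.comp φ = φ := by
      have k' := k.map σ
      simp only [hσα, hσx, hσy₁, hσy₂, hσu, hσv] at k'
      obtain ⟨e1, e2, e3, e4⟩ := k'.cover_unique hwR (h.point.twist hwR) k.twist
      refine h'.ext _ _ ?_ ?_ ?_ ?_ ?_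
      · ext z
        simp [hφα', hσα]
      all_goals simp only [RingHom.comp_apply, hφ1, hφ2, hφ3, hφ4, e1, e2, e3, e4]
    have hσφ' : ∀ s, σ (φ s) = φ s := fun s => RingHom.congr_fun hσφ s
    refine ⟨hσφ', fun r hr => ?_⟩
    obtain ⟨s₀, s₁, s₂, hs⟩ : ∃ s₀ s₁ s₂ : S, ψ r = ι s₀ + ι s₁ * U + ι s₂ * U ^ 2 :=
      adjoinRoot_exists_eq κ (ψ r)
    have hr' : r = φ s₀ + φ s₁ * u + φ s₂ * u ^ 2 := by
      have := RingHom.congr_fun hχψ r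
      rw [RingHom.comp_apply, hs] at this
      simpa [hχι, hχU] using this.symm
    have hσr := congrArg σ hr'
    simp only [map_add, map_mul, map_pow, hσφ', hσu, hr] at hσr
    have hσr2 := congrArg σ hσr
    simp only [map_add, map_mul, map_pow, hσφ', hσu, hr, hσα] at hσr2
    -- The sum of the equations for `r`, `σ r` and `σ (σ r)` eliminates `u` and `u²`.
    refine ⟨s₀, h3R.mul_left_cancel ?_⟩
    linear_combination -hr' - hσr - hσr2 -
      (φ s₁ * u + φ s₂ * u ^ 2 * (1 - α w + α w ^ 2)) * hwR

end Universal

/-! ### Coordinate rings of affine charts -/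

open scoped TensorProduct

section Charts

variable {ι A T : Type} [CommRing A] [CommRing T] {f : MvPolynomial ι A}

/-- The coordinate ring of the affine chart `x_k = 1` of the hypersurface `f = 0`. This is meant for
variables `x_k` of weight one; it is the dehomogenization of the homogeneous coordinate ring. -/
abbrev HChart (f : MvPolynomial ι A) (k : ι) : Type :=
  Dehomog (Ideal.Quotient.mk (Ideal.span {f}) (MvPolynomial.X k))

/-- The affine coordinate `x_i / x_k ^ (w i)`. -/
def hCoord (f : MvPolynomial ι A) (k i : ι) : HChart f k :=
  dehomog _ (Ideal.Quotient.mk _ (MvPolynomial.X i))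

lemma hCoord_self (f : MvPolynomial ι A) (k : ι) : hCoord f k k = 1 := dehomog_self _

lemma dehomog_mk (k : ι) (p : MvPolynomial ι A) :
    dehomog (Ideal.Quotient.mk (Ideal.span {f}) (MvPolynomial.X k)) (Ideal.Quotient.mk _ p) =
      p.eval₂ (algebraMap A (HChart f k)) (hCoord f k) := by
  induction p using MvPolynomial.induction_on with
  | C a => rw [MvPolynomial.eval₂_C]; rfl
  | add p q hp hq => rw [map_add, map_add, hp, hq, MvPolynomial.eval₂_add]
  | mul_X p i hp => rw [map_mul, map_mul, hp, MvPolynomial.eval₂_mul, MvPolynomial.eval₂_X]; rfl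

lemma eval₂_hCoord (f : MvPolynomial ι A) (k : ι) :
    f.eval₂ (algebraMap A (HChart f k)) (hCoord f k) = 0 := by
  rw [← dehomog_mk, Ideal.Quotient.eq_zero_iff_mem.2 (Ideal.mem_span_singleton_self f), map_zero]

/-- The chart represents the functor of points of the affine equation. -/
lemma exists_hChart_lift (k : ι) (α : A →+* T) (z : ι → T) (hf : f.eval₂ α z = 0) (hz : z k = 1) :
    ∃ F : HChart f k →+* T, F.comp (algebraMap A _) = α ∧ ∀ i, F (hCoord f k i) = z i := by
  let F₀ : HRing f →+* T := Ideal.Quotient.lift _ (MvPolynomial.eval₂Hom α z) (by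
    intro p hp
    obtain ⟨q, rfl⟩ := Ideal.mem_span_singleton'.1 hp
    rw [map_mul]
    change _ * f.eval₂ α z = 0
    rw [hf, mul_zero])
  have hF₀ : ∀ p, F₀ (Ideal.Quotient.mk _ p) = p.eval₂ α z := fun p => rfl
  let F : HChart f k →+* T := Ideal.Quotient.lift _ F₀ (by
    intro p hp
    obtain ⟨q, rfl⟩ := Ideal.mem_span_singleton'.1 hp
    rw [map_mul, map_sub, map_one, hF₀, MvPolynomial.eval₂_X, hz, sub_self, mul_zero])
  refine ⟨F, ?_, fun i => ?_⟩
  · ext a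
    exact (hF₀ (MvPolynomial.C a)).trans (MvPolynomial.eval₂_C _ _ _)
  · exact (hF₀ (MvPolynomial.X i)).trans (MvPolynomial.eval₂_X _ _ _)

lemma hChart_ext {k : ι} (F G : HChart f k →+* T)
    (h : F.comp (algebraMap A _) = G.comp (algebraMap A _))
    (h' : ∀ i, F (hCoord f k i) = G (hCoord f k i)) : F = G := by
  apply Ideal.Quotient.ringHom_ext
  apply Ideal.Quotient.ringHom_ext
  apply MvPolynomial.ringHom_ext
  · exact fun a => RingHom.congr_fun h a
  · exact h'

end Charts

/-- The equation of the universal surface. -/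
abbrev univSurfacePoly : MvPolynomial (Fin 4) PtRing :=
  surfacePoly (coord PtRing 0) (coord PtRing 1) (coord PtRing 2)

/-- The coordinate ring of the chart `x₀ = 1` of the family of surfaces. -/
abbrev SurfaceChart : Type := HChart univSurfacePoly 0

/-- The coordinate ring of the chart `z₁ = 1` of the Fermat curve. -/
abbrev FermatChart : Type := HChart fermatPoly 1

/-- The coordinate ring of the product of the charts of the family of surfaces and of the Fermat
curve. It is not reducible, to keep instance search away from the tensor product. -/
def ProductChart : Type := SurfaceChart ⊗[ℂ] FermatChart

instance : CommRing ProductChart := inferInstanceAs (CommRing (SurfaceChart ⊗[ℂ] FermatChart))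

/-- The coordinate ring of the chart `X₀ = 1` of the family of triple covers. -/
abbrev CoverChart : Type := HChart (coverPoly univPlanes) 0

section TensorProduct

variable {k B C T : Type} [CommRing k] [CommRing B] [CommRing C] [CommRing T] [Algebra k B]
  [Algebra k C]

lemma exists_tensor_lift (F : B →+* T) (G : C →+* T)
    (h : ∀ z : k, F (algebraMap k B z) = G (algebraMap k C z)) :
    ∃ H : B ⊗[k] C →+* T, (∀ x, H (x ⊗ₜ 1) = F x) ∧ ∀ x, H (1 ⊗ₜ x) = G x := by
  let _ : Algebra k T := (G.comp (algebraMap k C)).toAlgebra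
  let F' : B →ₐ[k] T := { F with commutes' := h }
  let G' : C →ₐ[k] T := { G with commutes' := fun _ => rfl }
  refine ⟨(Algebra.TensorProduct.lift F' G' fun _ _ => Commute.all _ _).toRingHom, fun x => ?_,
    fun x => ?_⟩
  · exact (Algebra.TensorProduct.lift_tmul _ _ _ x 1).trans (by rw [map_one, mul_one]; rfl)
  · exact (Algebra.TensorProduct.lift_tmul _ _ _ 1 x).trans (by rw [map_one, one_mul]; rfl)

lemma tensor_ext (F G : B ⊗[k] C →+* T) (h : ∀ x, F (x ⊗ₜ 1) = G (x ⊗ₜ 1))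
    (h' : ∀ x, F (1 ⊗ₜ x) = G (1 ⊗ₜ x)) : F = G := by
  refine RingHom.ext fun x => ?_
  induction x using TensorProduct.induction_on with
  | zero => rw [map_zero, map_zero]
  | tmul x y =>
    have e : x ⊗ₜ[k] y = (x ⊗ₜ 1) * (1 ⊗ₜ y) := by
      rw [Algebra.TensorProduct.tmul_mul_tmul, mul_one, one_mul]
    rw [e, map_mul, map_mul, h, h']
  | add x y hx hy => rw [map_add, map_add, hx, hy]

variable (k B C)

/-- The first inclusion, as a ring homomorphism. -/
def inclLeft : B →+* B ⊗[k] C :=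
  (Algebra.TensorProduct.includeLeft : B →ₐ[k] B ⊗[k] C).toRingHom

/-- The second inclusion, as a ring homomorphism. -/
def inclRight : C →+* B ⊗[k] C :=
  (Algebra.TensorProduct.includeRight : C →ₐ[k] B ⊗[k] C).toRingHom

lemma inclLeft_algebraMap (z : k) :
    inclLeft k B C (algebraMap k B z) = inclRight k B C (algebraMap k C z) :=
  ((Algebra.TensorProduct.includeLeft : B →ₐ[k] B ⊗[k] C).commutes z).trans
    ((Algebra.TensorProduct.includeRight : C →ₐ[k] B ⊗[k] C).commutes z).symm

/-- The universal property of the product of two charts. -/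
lemma exists_hChart_tensor_lift {A ι ι' : Type} [CommRing A] [Algebra k A]
    (f : MvPolynomial ι A) (p : ι) (f' : MvPolynomial ι' k) (q : ι') (β : A →+* T) (z : ι → T)
    (z' : ι' → T) (hf : f.eval₂ β z = 0) (hz : z p = 1)
    (hf' : f'.eval₂ (β.comp (algebraMap k A)) z' = 0) (hz' : z' q = 1) :
    ∃ H : HChart f p ⊗[k] HChart f' q →+* T,
      (∀ t, H (inclLeft k _ _ (algebraMap A _ t)) = β t) ∧
      (∀ i, H (inclLeft k _ _ (hCoord f p i)) = z i) ∧
      ∀ i, H (inclRight k _ _ (hCoord f' q i)) = z' i := by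
  obtain ⟨F, hF, hF'⟩ := exists_hChart_lift p β z hf hz
  obtain ⟨G, hG, hG'⟩ := exists_hChart_lift q _ z' hf' hz'
  obtain ⟨H, hH, hH'⟩ := exists_tensor_lift F G (fun z =>
    (RingHom.congr_fun hF (algebraMap k A z)).trans (RingHom.congr_fun hG z).symm)
  exact ⟨H, fun t => (hH _).trans (RingHom.congr_fun hF t), fun i => (hH _).trans (hF' i),
    fun i => (hH' _).trans (hG' i)⟩

end TensorProduct

/-- The pullback of functions along the projection to the chart of the family of surfaces. -/
def surfaceIncl : SurfaceChart →+* ProductChart := inclLeft ℂ SurfaceChart FermatChart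

/-- The pullback of functions along the projection to the chart of the Fermat curve. -/
def fermatIncl : FermatChart →+* ProductChart := inclRight ℂ SurfaceChart FermatChart

lemma surfaceIncl_algebraMap_eq (z : ℂ) : surfaceIncl (algebraMap PtRing _ (algebraMap ℂ _ z)) =
    fermatIncl (algebraMap ℂ _ z) := inclLeft_algebraMap ℂ SurfaceChart FermatChart z

lemma productChart_ext {T : Type} [CommRing T] (F G : ProductChart →+* T)
    (h : ∀ x, F (surfaceIncl x) = G (surfaceIncl x))
    (h' : ∀ x, F (fermatIncl x) = G (fermatIncl x)) : F = G := tensor_ext F G h h'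

section Localization

variable {A P : Type} [CommRing A] [CommRing P]

lemma map_surfaceForm {T T' : Type} [CommRing T] [CommRing T'] (F : T →+* T')
    (a b c w x₀ x₁ y₁ y₂ : T) : F (surfaceForm a b c w x₀ x₁ y₁ y₂) =
      surfaceForm (F a) (F b) (F c) (F w) (F x₀) (F x₁) (F y₁) (F y₂) := by
  simp [surfaceForm, branch, lamForm]

lemma map_mixedForm {T T' : Type} [CommRing T] [CommRing T'] (F : T →+* T')
    (a b w x₀ x₁ v : T) : F (mixedForm a b w x₀ x₁ v) =
      mixedForm (F a) (F b) (F w) (F x₀) (F x₁) (F v) := by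
  simp [mixedForm, alphaForm]

lemma map_branch {T T' : Type} [CommRing T] [CommRing T'] (F : T →+* T')
    (a b c x₀ x₁ : T) : F (branch a b c x₀ x₁) = branch (F a) (F b) (F c) (F x₀) (F x₁) := by
  simp [branch]

lemma map_coverForm {T T' : Type} [CommRing T] [CommRing T'] (F : T →+* T')
    (a b c w x₀ x₁ x₂ x₃ : T) : F (coverForm a b c w x₀ x₁ x₂ x₃) =
      coverForm (F a) (F b) (F c) (F w) (F x₀) (F x₁) (F x₂) (F x₃) := by
  simp [coverForm]

lemma map_surface_relation {T T' : Type} [CommRing T] [CommRing T'] (F : T →+* T')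
    {a b c x y₁ y₂ : T} (h : y₁ ^ 3 + y₂ ^ 3 + branch a b c 1 x = 0) :
    F y₁ ^ 3 + F y₂ ^ 3 + branch (F a) (F b) (F c) 1 (F x) = 0 := by
  simpa [branch] using congrArg F h

lemma map_fermat_relation {T T' : Type} [CommRing T] [CommRing T'] (F : T →+* T')
    {u v : T} (h : u ^ 3 + 1 + v ^ 3 = 0) : F u ^ 3 + 1 + F v ^ 3 = 0 := by
  simpa using congrArg F h

/-- The function on the product of the affine charts whose zeros are removed, in coordinates. -/
def rohdeLocus (a b c w x y₁ y₂ u v : P) : P :=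
  surfaceForm a b c w 1 x y₁ y₂ * (u * mixedForm a b w 1 x v)

/-- An algebra representing all affine points of `W × F` becomes universal for the points in the
sense of `IsRohdePoint` after localization. -/
lemma isUniversalRohde_away {a b c w : A} {α : A →+* P} {x y₁ y₂ u v : P}
    (surf : y₁ ^ 3 + y₂ ^ 3 + branch (α a) (α b) (α c) 1 x = 0) (fer : u ^ 3 + 1 + v ^ 3 = 0)
    (ext : ∀ {T : Type} [CommRing T] (F G : P →+* T), F.comp α = G.comp α → F x = G x →
      F y₁ = G y₁ → F y₂ = G y₂ → F u = G u → F v = G v → F = G)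
    (lift : ∀ {T : Type} [CommRing T] (β : A →+* T) (x' y₁' y₂' u' v' : T),
      y₁' ^ 3 + y₂' ^ 3 + branch (β a) (β b) (β c) 1 x' = 0 → u' ^ 3 + 1 + v' ^ 3 = 0 →
      ∃ F : P →+* T, F.comp α = β ∧ F x = x' ∧ F y₁ = y₁' ∧ F y₂ = y₂' ∧ F u = u' ∧ F v = v')
    (g : P) (hg : g = rohdeLocus (α a) (α b) (α c) (α w) x y₁ y₂ u v)
    (R : Type) [CommRing R] [Algebra P R] [IsLocalization.Away g R] :
    IsUniversalRohde a b c w ((algebraMap P R).comp α) (algebraMap P R x) (algebraMap P R y₁)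
      (algebraMap P R y₂) (algebraMap P R u) (algebraMap P R v) where
  point := by
    have hu : IsUnit (algebraMap P R g) := IsLocalization.Away.algebraMap_isUnit _
    rw [hg, rohdeLocus, map_mul, map_mul, IsUnit.mul_iff, IsUnit.mul_iff, map_surfaceForm,
      map_mixedForm, map_one] at hu
    refine ⟨?_, ?_, hu.1, hu.2.1, hu.2.2⟩
    · simpa [map_branch] using congrArg (algebraMap P R) surf
    · simpa using congrArg (algebraMap P R) fer
  ext := fun F G hα hx hy₁ hy₂ hu hv =>
    IsLocalization.ringHom_ext (Submonoid.powers g) (ext _ _ hα hx hy₁ hy₂ hu hv)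
  lift := by
    intro T _ β x' y₁' y₂' u' v' h
    obtain ⟨F, hF, h1, h2, h3, h4, h5⟩ := lift β x' y₁' y₂' u' v' h.surface h.fermat
    have hα : ∀ t, F (α t) = β t := RingHom.congr_fun hF
    have hu : IsUnit (F g) := by
      rw [hg, rohdeLocus, map_mul, map_mul, map_surfaceForm, map_mixedForm, map_one, hα, hα, hα,
        hα, h1, h2, h3, h4, h5]
      exact h.isUnit_surface.mul (h.isUnit_u.mul h.isUnit_mixed)
    exact ⟨IsLocalization.Away.lift g hu,
      RingHom.ext fun t => (IsLocalization.Away.lift_eq _ hu _).trans (hα t),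
      (IsLocalization.Away.lift_eq _ hu _).trans h1, (IsLocalization.Away.lift_eq _ hu _).trans h2,
      (IsLocalization.Away.lift_eq _ hu _).trans h3, (IsLocalization.Away.lift_eq _ hu _).trans h4,
      (IsLocalization.Away.lift_eq _ hu _).trans h5⟩

/-- An algebra representing all affine points of the triple cover becomes universal for the points
in the sense of `IsCoverPoint` after localization. -/
lemma isUniversalCover_away {a b c w : A} {α : A →+* P} {X₁ X₂ X₃ Y : P}
    (rel : Y ^ 3 = X₁ * X₂ * X₃ * (1 + X₁ + X₂ + X₃) *
      (1 + α a * X₁ + α b * X₂ + α c * X₃))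
    (ext : ∀ {T : Type} [CommRing T] (F G : P →+* T), F.comp α = G.comp α → F X₁ = G X₁ →
      F X₂ = G X₂ → F X₃ = G X₃ → F Y = G Y → F = G)
    (lift : ∀ {T : Type} [CommRing T] (β : A →+* T) (X₁' X₂' X₃' Y' : T),
      Y' ^ 3 = X₁' * X₂' * X₃' * (1 + X₁' + X₂' + X₃') *
        (1 + β a * X₁' + β b * X₂' + β c * X₃') →
      ∃ F : P →+* T, F.comp α = β ∧ F X₁ = X₁' ∧ F X₂ = X₂' ∧ F X₃ = X₃' ∧ F Y = Y')
    (g : P) (hg : g = coverForm (α a) (α b) (α c) (α w) 1 X₁ X₂ X₃)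
    (S : Type) [CommRing S] [Algebra P S] [IsLocalization.Away g S] :
    IsUniversalCover a b c w ((algebraMap P S).comp α) (algebraMap P S X₁) (algebraMap P S X₂)
      (algebraMap P S X₃) (algebraMap P S Y) where
  point := by
    have hu : IsUnit (algebraMap P S g) := IsLocalization.Away.algebraMap_isUnit _
    rw [hg, map_coverForm, map_one] at hu
    refine ⟨?_, hu⟩
    simpa using congrArg (algebraMap P S) rel
  ext := fun F G hα h1 h2 h3 h4 =>
    IsLocalization.ringHom_ext (Submonoid.powers g) (ext _ _ hα h1 h2 h3 h4)
  lift := by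
    intro T _ β X₁' X₂' X₃' Y' h
    obtain ⟨F, hF, h1, h2, h3, h4⟩ := lift β X₁' X₂' X₃' Y' h.cover
    have hα : ∀ t, F (α t) = β t := RingHom.congr_fun hF
    have hu : IsUnit (F g) := by
      rw [hg, map_coverForm, map_one, hα, hα, hα, hα, h1, h2, h3]
      exact h.isUnit
    exact ⟨IsLocalization.Away.lift g hu,
      RingHom.ext fun t => (IsLocalization.Away.lift_eq _ hu _).trans (hα t),
      (IsLocalization.Away.lift_eq _ hu _).trans h1, (IsLocalization.Away.lift_eq _ hu _).trans h2,
      (IsLocalization.Away.lift_eq _ hu _).trans h3, (IsLocalization.Away.lift_eq _ hu _).trans h4⟩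

end Localization

variable (ω : ℂ)

/-- The structure map from the coordinate ring of the moduli space to that of the chart of the
family of threefolds. -/
def productBase : PtRing →+* ProductChart := surfaceIncl.comp (algebraMap PtRing _)

/-- The function on the chart of the family of threefolds whose zeros are removed. -/
def productLocus : ProductChart :=
  rohdeLocus (productBase (coord PtRing 0)) (productBase (coord PtRing 1))
    (productBase (coord PtRing 2)) (productBase (algebraMap ℂ _ ω))
    (surfaceIncl (hCoord _ _ 1)) (surfaceIncl (hCoord _ _ 2)) (surfaceIncl (hCoord _ _ 3))
    (fermatIncl (hCoord _ _ 0)) (fermatIncl (hCoord _ _ 2))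

/-- The coordinate ring of the affine open subscheme of `W × F` whose quotient is compared with the
family of triple covers. -/
def RohdeRing : Type := Localization.Away (productLocus ω)

instance : CommRing (RohdeRing ω) := inferInstanceAs (CommRing (Localization.Away (productLocus ω)))

instance : Algebra ProductChart (RohdeRing ω) :=
  inferInstanceAs (Algebra ProductChart (Localization.Away (productLocus ω)))

instance : IsLocalization.Away (productLocus ω) (RohdeRing ω) :=
  inferInstanceAs (IsLocalization.Away (productLocus ω) (Localization.Away (productLocus ω)))

/-- The function on the chart of the family of triple covers whose zeros are removed. The
isomorphism `e` transports `a, b, c` and the root of unity to the moduli space of hyperplanes. -/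
def coverLocus (e : PlRing ≃ₐ[Param] PtRing) : CoverChart :=
  coverForm (algebraMap PlRing _ (e.symm (coord PtRing 0)))
    (algebraMap PlRing _ (e.symm (coord PtRing 1)))
    (algebraMap PlRing _ (e.symm (coord PtRing 2)))
    (algebraMap PlRing _ (e.symm (algebraMap ℂ _ ω))) 1 (hCoord _ _ 1) (hCoord _ _ 2) (hCoord _ _ 3)

/-- The coordinate ring of the affine open subscheme of the family of triple covers which is
identified with an open subspace of Rohde's family. -/
def CoverRing (e : PlRing ≃ₐ[Param] PtRing) : Type := Localization.Away (coverLocus ω e)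

instance (e : PlRing ≃ₐ[Param] PtRing) : CommRing (CoverRing ω e) :=
  inferInstanceAs (CommRing (Localization.Away (coverLocus ω e)))

instance (e : PlRing ≃ₐ[Param] PtRing) : Algebra CoverChart (CoverRing ω e) :=
  inferInstanceAs (Algebra CoverChart (Localization.Away (coverLocus ω e)))

instance (e : PlRing ≃ₐ[Param] PtRing) : IsLocalization.Away (coverLocus ω e) (CoverRing ω e) :=
  inferInstanceAs (IsLocalization.Away (coverLocus ω e) (Localization.Away (coverLocus ω e)))

lemma univSurfacePoly_eval₂ {T : Type} [CommRing T] (α : PtRing →+* T) (z : Fin 4 → T)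
    (hz : z 0 = 1) : univSurfacePoly.eval₂ α z = z 2 ^ 3 + z 3 ^ 3 +
      branch (α (coord PtRing 0)) (α (coord PtRing 1)) (α (coord PtRing 2)) 1 (z 1) := by
  simp [surfacePoly, hz, branch]

lemma fermatPoly_eval₂ {T : Type} [CommRing T] (α : ℂ →+* T) (z : Fin 3 → T)
    (hz : z 1 = 1) : fermatPoly.eval₂ α z = z 0 ^ 3 + 1 + z 2 ^ 3 := by
  simp [fermatPoly, hz]

lemma coverPoly_eval₂ {T : Type} [CommRing T] (α : PlRing →+* T) (z : Fin 5 → T) (hz : z 0 = 1) :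
    (coverPoly univPlanes).eval₂ α z = z 4 ^ 3 - z 1 * z 2 * z 3 * (1 + z 1 + z 2 + z 3) *
      (1 + α (coord PlRing 0) * z 1 + α (coord PlRing 1) * z 2 + α (coord PlRing 2) * z 3) := by
  rw [coverPoly, univPlanes]
  simp only [Fin.prod_univ_succ, Fin.sum_univ_succ, MvPolynomial.eval₂_sub,
    MvPolynomial.eval₂_pow, MvPolynomial.eval₂_mul, MvPolynomial.eval₂_add, MvPolynomial.eval₂_X,
    MvPolynomial.eval₂_C, planes]
  simp [hz]
  ring

lemma coverPoly_eval₂_eq_zero {T : Type} [CommRing T] {α : PlRing →+* T} {z : Fin 5 → T}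
    (hz : z 0 = 1) {a b c : T} (ha : α (coord PlRing 0) = a) (hb : α (coord PlRing 1) = b)
    (hc : α (coord PlRing 2) = c) : (coverPoly univPlanes).eval₂ α z = 0 ↔
      z 4 ^ 3 = z 1 * z 2 * z 3 * (1 + z 1 + z 2 + z 3) *
        (1 + a * z 1 + b * z 2 + c * z 3) := by
  rw [coverPoly_eval₂ _ _ hz, sub_eq_zero, ha, hb, hc]

lemma surfaceIncl_ext {T : Type} [CommRing T] (F G : ProductChart →+* T)
    (hα : F.comp productBase = G.comp productBase)
    (h : ∀ i, F (surfaceIncl (hCoord _ _ i)) = G (surfaceIncl (hCoord _ _ i)))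
    (h' : ∀ i, F (fermatIncl (hCoord _ _ i)) = G (fermatIncl (hCoord _ _ i))) : F = G := by
  apply productChart_ext
  · exact RingHom.congr_fun (hChart_ext (F.comp surfaceIncl) (G.comp surfaceIncl) hα h)
  · refine RingHom.congr_fun
      (hChart_ext (F.comp fermatIncl) (G.comp fermatIncl) (RingHom.ext fun z => ?_) h')
    have h := RingHom.congr_fun hα (algebraMap ℂ _ z)
    have e := surfaceIncl_algebraMap_eq z
    change F (fermatIncl _) = G (fermatIncl _)
    rw [← e]
    exact h

lemma ringHom_congr_of_eq_one {B P T : Type} [CommRing B] [CommRing P] [CommRing T] (i : B →+* P)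
    (F G : P →+* T) {x : B} (hx : x = 1) : F (i x) = G (i x) := by
  rw [hx, map_one, map_one, map_one]

theorem isUniversalRohde : IsUniversalRohde (coord PtRing 0) (coord PtRing 1) (coord PtRing 2)
    (algebraMap ℂ PtRing ω) ((algebraMap ProductChart (RohdeRing ω)).comp productBase)
    (algebraMap ProductChart _ (surfaceIncl (hCoord _ _ 1)))
    (algebraMap ProductChart _ (surfaceIncl (hCoord _ _ 2)))
    (algebraMap ProductChart _ (surfaceIncl (hCoord _ _ 3)))
    (algebraMap ProductChart _ (fermatIncl (hCoord _ _ 0)))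
    (algebraMap ProductChart _ (fermatIncl (hCoord _ _ 2))) := by
  refine isUniversalRohde_away ?_ ?_ ?_ ?_ (productLocus ω) rfl (RohdeRing ω)
  · have h := (univSurfacePoly_eval₂ _ _ (hCoord_self _ _)).symm.trans
      (eval₂_hCoord univSurfacePoly 0)
    exact map_surface_relation surfaceIncl h
  · have h := (fermatPoly_eval₂ _ _ (hCoord_self _ _)).symm.trans (eval₂_hCoord fermatPoly 1)
    exact map_fermat_relation fermatIncl h
  · intro T _ F G hα hx hy₁ hy₂ hu hv
    refine surfaceIncl_ext F G hα (fun i => ?_) (fun i => ?_)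
    · fin_cases i
      · exact ringHom_congr_of_eq_one surfaceIncl F G (hCoord_self _ _)
      · exact hx
      · exact hy₁
      · exact hy₂
    · fin_cases i
      · exact hu
      · exact ringHom_congr_of_eq_one fermatIncl F G (hCoord_self _ _)
      · exact hv
  · intro T _ β x y₁ y₂ u v h1 h2
    obtain ⟨H, h, h', h''⟩ := exists_hChart_tensor_lift ℂ univSurfacePoly 0 fermatPoly 1 β
      ![1, x, y₁, y₂] ![u, 1, v] ((univSurfacePoly_eval₂ _ _ rfl).trans h1) rfl
      ((fermatPoly_eval₂ _ _ rfl).trans h2) rfl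
    exact ⟨H, RingHom.ext h, h' 1, h' 2, h' 3, h'' 0, h'' 2⟩

lemma algEquiv_symm_coord (e : PlRing ≃ₐ[Param] PtRing) (i : Fin 3) :
    e.symm (coord PtRing i) = coord PlRing i := e.symm.commutes _

lemma coverChart_ext {T : Type} [CommRing T] (e : PlRing ≃ₐ[Param] PtRing) (F G : CoverChart →+* T)
    (hα : F.comp ((algebraMap PlRing CoverChart).comp (e.symm : PtRing →+* PlRing)) =
      G.comp ((algebraMap PlRing CoverChart).comp (e.symm : PtRing →+* PlRing)))
    (h : ∀ i, F (hCoord _ _ i) = G (hCoord _ _ i)) : F = G := by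
  refine hChart_ext F G (RingHom.ext fun t => ?_) h
  have h : F (algebraMap PlRing _ (e.symm (e t))) = G (algebraMap PlRing _ (e.symm (e t))) :=
    RingHom.congr_fun hα (e t)
  have h' : e.symm (e t) = t := e.symm_apply_apply t
  rwa [h'] at h

theorem isUniversalCover (e : PlRing ≃ₐ[Param] PtRing) :
    IsUniversalCover (coord PtRing 0) (coord PtRing 1) (coord PtRing 2) (algebraMap ℂ PtRing ω)
      ((algebraMap CoverChart (CoverRing ω e)).comp
        ((algebraMap PlRing CoverChart).comp (e.symm : PtRing →+* PlRing)))
      (algebraMap CoverChart _ (hCoord _ _ 1)) (algebraMap CoverChart _ (hCoord _ _ 2))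
      (algebraMap CoverChart _ (hCoord _ _ 3)) (algebraMap CoverChart _ (hCoord _ _ 4)) := by
  refine isUniversalCover_away
    (α := (algebraMap PlRing CoverChart).comp (e.symm : PtRing →+* PlRing))
    ?_ ?_ ?_ (coverLocus ω e) rfl (CoverRing ω e)
  · have he : ∀ i, algebraMap PlRing CoverChart (coord PlRing i) =
        algebraMap PlRing CoverChart (e.symm (coord PtRing i)) := fun i =>
      congrArg _ (algEquiv_symm_coord e i).symm
    exact (coverPoly_eval₂_eq_zero (hCoord_self _ _) (he 0) (he 1) (he 2)).1
      (eval₂_hCoord (coverPoly univPlanes) 0)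
  · intro T _ F G hα h1 h2 h3 h4
    refine coverChart_ext e F G hα fun i => ?_
    fin_cases i
    · change F (hCoord _ 0 0) = G (hCoord _ 0 0)
      rw [hCoord_self, map_one, map_one]
    · exact h1
    · exact h2
    · exact h3
    · exact h4
  · intro T _ β X₁ X₂ X₃ Y h
    obtain ⟨F, hF, hF'⟩ := exists_hChart_lift (f := coverPoly univPlanes) 0
      (β.comp (e : PlRing →+* PtRing)) ![1, X₁, X₂, X₃, Y] (by
        have he : ∀ i, (β.comp (e : PlRing →+* PtRing)) (coord PlRing i) = β (coord PtRing i) :=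
          fun i => congrArg β (e.commutes _)
        exact (coverPoly_eval₂_eq_zero rfl (he 0) (he 1) (he 2)).2 h) rfl
    refine ⟨F, RingHom.ext fun t => (RingHom.congr_fun hF (e.symm t)).trans ?_,
      hF' 1, hF' 2, hF' 3, hF' 4⟩
    exact congrArg β (e.apply_symm_apply t)

/-! ### Affine charts of hypersurfaces and of fibre products -/

section HypersurfaceChart

variable {ι A : Type} [CommRing A] {w : ι → ℕ} {f : MvPolynomial ι A} {d : ℕ}
  (hf : f.IsWeightedHomogeneous w d) {k : ι} (hk : w k = 1)

lemma mk_X_mem_hGrading (hk : w k = 1) :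
    Ideal.Quotient.mk (Ideal.span {f}) (MvPolynomial.X k) ∈ hGrading w f 1 :=
  mk_mem_hGrading w f (hk ▸ MvPolynomial.isWeightedHomogeneous_X A w k)

/-- The affine chart `x_k = 1` of a hypersurface, where `x_k` is a variable of weight one. -/
def hChartMap : Spec (.of (HChart f k)) ⟶ hypersurface hf :=
  letI := hGradedAlgebra hf
  dehomogChart (mk_X_mem_hGrading hk)

instance instIsOpenImmersionHChartMap : IsOpenImmersion (hChartMap hf hk) := by
  let _ := hGradedAlgebra hf
  exact inferInstanceAs (IsOpenImmersion (dehomogChart (mk_X_mem_hGrading (f := f) hk)))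

lemma hChartMap_toBase : hChartMap hf hk ≫ hypersurfaceToBase hf =
    Spec.map (CommRingCat.ofHom (algebraMap A (HChart f k))) := by
  let _ := hGradedAlgebra hf
  exact dehomogChart_toBase _

/-- A diagonal automorphism which fixes the variable `x_k` acts on the chart `x_k = 1`. -/
lemma exists_hChart_diag (ζ : ι → Aˣ) (hζ : diagSubst ζ f = f) (hζk : ζ k = 1) :
    ∃ γ : HChart f k →+* HChart f k, γ.comp (algebraMap A _) = algebraMap A _ ∧
      (∀ i, γ (hCoord f k i) = algebraMap A _ (ζ i) * hCoord f k i) ∧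
      hChartMap hf hk ≫ hypersurfaceDiag hf ζ hζ =
        Spec.map (CommRingCat.ofHom γ) ≫ hChartMap hf hk := by
  let _ := hGradedAlgebra hf
  have h0 : ((MvPolynomial.eval₂Hom (algebraMap A (HChart f k)) (hCoord f k)).comp
      (diagSubst ζ).toRingHom) = MvPolynomial.eval₂Hom (algebraMap A (HChart f k))
        (fun i => algebraMap A _ (ζ i) * hCoord f k i) := by
    apply MvPolynomial.ringHom_ext
    · intro a
      simp [diagSubst]
    · intro i
      simp [diagSubst]
  obtain ⟨γ, hγ, hγ'⟩ := exists_hChart_lift (f := f) k (algebraMap A (HChart f k))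
    (fun i => algebraMap A _ (ζ i) * hCoord f k i) (by
      have h := RingHom.congr_fun h0 f
      change MvPolynomial.eval₂ _ _ (diagSubst ζ f) = MvPolynomial.eval₂ _ _ f at h
      rw [← h, hζ, eval₂_hCoord]) (by
      rw [hζk, hCoord_self, Units.val_one, map_one, mul_one])
  refine ⟨γ, hγ, hγ', ?_⟩
  refine dehomogChart_comp_map (mk_X_mem_hGrading hk) (hDiag w ζ hζ)
    (irrelevant_le_map_hDiag hf ζ hζ) (mk_X_mem_hGrading hk) ?_ γ ?_
  · change Ideal.Quotient.mk (Ideal.span {f}) (diagSubst ζ (MvPolynomial.X k)) = _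
    simp [diagSubst, hζk]
  · intro x
    obtain ⟨p, rfl⟩ := Ideal.Quotient.mk_surjective x
    change γ _ = dehomog _ (Ideal.Quotient.mk (Ideal.span {f}) (diagSubst ζ p))
    rw [dehomog_mk, dehomog_mk]
    have h := RingHom.congr_fun h0 p
    change MvPolynomial.eval₂ _ _ (diagSubst ζ p) = MvPolynomial.eval₂ _ _ p at h
    rw [h, MvPolynomial.hom_eval₂, hγ]
    congr 1
    exact funext hγ'

end HypersurfaceChart

section ProductChart

variable {k B C : Type} [CommRing k] [CommRing B] [CommRing C] [Algebra k B] [Algebra k C]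
  {X Y : Scheme.{0}} (f : X ⟶ Spec (.of k)) (g : Y ⟶ Spec (.of k))
  (i : Spec (.of B) ⟶ X) (i' : Spec (.of C) ⟶ Y)
  (hi : i ≫ f = Spec.map (CommRingCat.ofHom (algebraMap k B)))
  (hi' : i' ≫ g = Spec.map (CommRingCat.ofHom (algebraMap k C)))

/-- The affine chart of a fibre product given by charts of the factors. -/
def tensorChart : Spec (.of (B ⊗[k] C)) ⟶ pullback f g :=
  pullback.lift (Spec.map (CommRingCat.ofHom (inclLeft k B C)) ≫ i)
    (Spec.map (CommRingCat.ofHom (inclRight k B C)) ≫ i') (by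
      rw [Category.assoc, Category.assoc, hi, hi', ← Spec.map_comp, ← Spec.map_comp]
      congr 1
      ext z
      exact inclLeft_algebraMap k B C z)

lemma tensorChart_fst : tensorChart f g i i' hi hi' ≫ pullback.fst f g =
    Spec.map (CommRingCat.ofHom (inclLeft k B C)) ≫ i := pullback.lift_fst _ _ _

lemma tensorChart_snd : tensorChart f g i i' hi hi' ≫ pullback.snd f g =
    Spec.map (CommRingCat.ofHom (inclRight k B C)) ≫ i' := pullback.lift_snd _ _ _

lemma tensorChart_eq : tensorChart f g i i' hi hi' = (pullbackSpecIso k B C).inv ≫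
    pullback.map _ _ f g i i' (𝟙 _) (by rw [Category.comp_id, hi])
      (by rw [Category.comp_id, hi']) := by
  apply pullback.hom_ext
  · rw [tensorChart_fst, Category.assoc, pullback.map, pullback.lift_fst, ← Category.assoc,
      pullbackSpecIso_inv_fst]
    rfl
  · rw [tensorChart_snd, Category.assoc, pullback.map, pullback.lift_snd, ← Category.assoc,
      pullbackSpecIso_inv_snd]
    rfl

lemma isOpenImmersion_tensorChart [IsOpenImmersion i] [IsOpenImmersion i'] :
    IsOpenImmersion (tensorChart f g i i' hi hi') := by
  rw [tensorChart_eq]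
  infer_instance

end ProductChart

/-! ### The chart of the family of threefolds and the group action -/

section Order

variable {ι A : Type} [CommRing A] {w : ι → ℕ} {f : MvPolynomial ι A} {d : ℕ}

lemma projMap_eq_id {R B : Type} [CommRing R] [CommRing B] [Algebra R B]
    {𝒜 : ℕ → Submodule R B} [GradedAlgebra 𝒜] (g : GradedRingHom 𝒜 𝒜)
    (hg : HomogeneousIdeal.irrelevant 𝒜 ≤ (HomogeneousIdeal.irrelevant 𝒜).map g)
    (h : ∀ x, g x = x) : Proj.map g hg = 𝟙 (Proj 𝒜) := by
  obtain rfl : g = .id 𝒜 := GradedRingHom.ext h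
  exact Proj.map_id

lemma hypersurfaceDiag_pow_three (hf : f.IsWeightedHomogeneous w d) (ζ : ι → Aˣ)
    (hζ : diagSubst ζ f = f) (h3 : ∀ i, (ζ i : A) ^ 3 = 1) :
    hypersurfaceDiag hf ζ hζ ≫ hypersurfaceDiag hf ζ hζ ≫ hypersurfaceDiag hf ζ hζ =
      𝟙 (hypersurface hf) := by
  let _ := hGradedAlgebra hf
  have h0 : ((diagSubst ζ).comp (diagSubst ζ)).comp (diagSubst ζ) = AlgHom.id A _ := by
    apply MvPolynomial.algHom_ext
    intro i
    have h := congrArg (MvPolynomial.C (σ := ι)) (h3 i)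
    rw [map_pow, map_one] at h
    simp only [diagSubst, AlgHom.comp_apply, MvPolynomial.aeval_X, map_mul, MvPolynomial.aeval_C,
      MvPolynomial.algebraMap_eq, AlgHom.id_apply]
    linear_combination MvPolynomial.X i * h
  change Proj.map _ _ ≫ Proj.map _ _ ≫ Proj.map _ _ = 𝟙 (Proj (hGrading w f))
  rw [← Proj.map_comp, ← Proj.map_comp]
  refine projMap_eq_id _ _ fun x => ?_
  obtain ⟨p, rfl⟩ := Ideal.Quotient.mk_surjective x
  exact congrArg (Ideal.Quotient.mk (Ideal.span {f})) (AlgHom.congr_fun h0 p)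

lemma map_eq_mul {B R : Type} [CommRing B] [CommRing R] (i : B →+* R) {x y z : B}
    (h : x = y * z) : i x = i y * i z := by rw [h, map_mul]

lemma hChart_equivariant {R : Type} [CommRing R] {k : ι} (i : HChart f k →+* R) (σ : R →+* R)
    (γ : HChart f k →+* HChart f k) (ζ : ι → Aˣ)
    (hγ : γ.comp (algebraMap A _) = algebraMap A _)
    (hγ' : ∀ j, γ (hCoord f k j) = algebraMap A _ (ζ j) * hCoord f k j)
    (hσ : ∀ t, σ (i (algebraMap A _ t)) = i (algebraMap A _ t))
    (hσ' : ∀ j, σ (i (hCoord f k j)) = i (algebraMap A _ (ζ j)) * i (hCoord f k j)) :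
    σ.comp i = i.comp γ := by
  refine hChart_ext _ _ (RingHom.ext fun t => (hσ t).trans ?_) fun j => (hσ' j).trans ?_
  · exact congrArg i (RingHom.congr_fun hγ t).symm
  · exact (map_eq_mul i (hγ' j)).symm

/-- Equivariance of a chart of a product, after composition with a projection, follows from that of
the chart of the factor. -/
lemma chart_equivariant {B P R : Type} [CommRing B] [CommRing P] [CommRing R] {Z X : Scheme.{0}}
    {c : Spec (.of P) ⟶ Z} {p : Z ⟶ X} {c' : Spec (.of B) ⟶ X} {i : B →+* P}
    (hc : c ≫ p = Spec.map (CommRingCat.ofHom i) ≫ c') {τ : Z ⟶ Z} {τ' : X ⟶ X}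
    (hτ : τ ≫ p = p ≫ τ') {γ : B →+* B} (hγ : c' ≫ τ' = Spec.map (CommRingCat.ofHom γ) ≫ c')
    (l : P →+* R) (σ : R →+* R) (hσ : σ.comp (l.comp i) = (l.comp i).comp γ) :
    (Spec.map (CommRingCat.ofHom σ) ≫ Spec.map (CommRingCat.ofHom l) ≫ c) ≫ p =
      ((Spec.map (CommRingCat.ofHom l) ≫ c) ≫ τ) ≫ p := by
  simp only [Category.assoc, hτ, reassoc_of% hc, hγ, hc]
  simp only [← Category.assoc, ← Spec.map_comp, ← CommRingCat.ofHom_comp]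
  rw [RingHom.comp_assoc] at hσ
  rw [hσ]

/-- An open subscheme mapped to itself by an automorphism of order dividing three is stable under
it. -/
lemma preimage_range_of_comp_eq {Z X : Scheme.{0}} {j : Z ⟶ X} {s : Z ⟶ Z} {τ : X ⟶ X}
    (h : s ≫ j = j ≫ τ) (h3 : τ ≫ τ ≫ τ = 𝟙 X) :
    τ.base ⁻¹' Set.range j.base = Set.range j.base := by
  have hmem : ∀ z ∈ Set.range j.base, τ.base z ∈ Set.range j.base := by
    rintro _ ⟨t, rfl⟩
    exact ⟨_, congrArg (fun k => k.base t) h⟩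
  refine Set.Subset.antisymm (fun z hz => ?_) hmem
  have e : τ.base (τ.base (τ.base z)) = z := congrArg (fun k => k.base z) h3
  rw [← e]
  exact hmem _ (hmem _ hz)

end Order

section Chart

/-- The chart `x₀ = 1` of the family of surfaces. -/
def surfaceChartMap : Spec (.of SurfaceChart) ⟶ surface :=
  hChartMap (surfacePoly_homogeneous (coord PtRing 0) (coord PtRing 1) (coord PtRing 2))
    (k := 0) rfl

/-- The chart `z₁ = 1` of the Fermat curve. -/
def fermatChartMap : Spec (.of FermatChart) ⟶ fermat :=
  hChartMap fermatPoly_homogeneous (k := 1) rfl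

instance : IsOpenImmersion surfaceChartMap :=
  instIsOpenImmersionHChartMap
    (surfacePoly_homogeneous (coord PtRing 0) (coord PtRing 1) (coord PtRing 2)) (k := 0) rfl

instance : IsOpenImmersion fermatChartMap :=
  inferInstanceAs (IsOpenImmersion (hChartMap _ _))

lemma surfaceChartMap_toBase : surfaceChartMap ≫ surfaceToBase =
    Spec.map (CommRingCat.ofHom (algebraMap PtRing SurfaceChart)) := hChartMap_toBase _ _

lemma surfaceChartMap_toC : surfaceChartMap ≫ surfaceToBase ≫ MPtToC =
    Spec.map (CommRingCat.ofHom (algebraMap ℂ SurfaceChart)) := by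
  rw [← Category.assoc, surfaceChartMap_toBase]
  exact (Spec.map_comp _ _).symm

lemma fermatChartMap_toBase : fermatChartMap ≫ fermatToBase =
    Spec.map (CommRingCat.ofHom (algebraMap ℂ FermatChart)) := hChartMap_toBase _ _

/-- The projection of the family of threefolds to the family of surfaces. -/
def productFst : productFamily ⟶ surface := pullback.fst (surfaceToBase ≫ MPtToC) fermatToBase

/-- The projection of the family of threefolds to the Fermat curve. -/
def productSnd : productFamily ⟶ fermat := pullback.snd (surfaceToBase ≫ MPtToC) fermatToBase

lemma productFamily_hom_ext {Z : Scheme.{0}} {f g : Z ⟶ productFamily}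
    (h : f ≫ productFst = g ≫ productFst) (h' : f ≫ productSnd = g ≫ productSnd) : f = g :=
  pullback.hom_ext h h'

lemma productFst_toBase : productFst ≫ surfaceToBase = productToBase := rfl

/-- The chart `x₀ = 1`, `z₁ = 1` of the family of threefolds. -/
def productChartMap : Spec (.of ProductChart) ⟶ productFamily :=
  tensorChart (surfaceToBase ≫ MPtToC) fermatToBase surfaceChartMap fermatChartMap
    surfaceChartMap_toC fermatChartMap_toBase

instance : IsOpenImmersion productChartMap := isOpenImmersion_tensorChart _ _ _ _ _ _

lemma productChartMap_fst : productChartMap ≫ productFst =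
    Spec.map (CommRingCat.ofHom surfaceIncl) ≫ surfaceChartMap := tensorChart_fst _ _ _ _ _ _

lemma productChartMap_snd : productChartMap ≫ productSnd =
    Spec.map (CommRingCat.ofHom fermatIncl) ≫ fermatChartMap := tensorChart_snd _ _ _ _ _ _

lemma productChartMap_toBase : productChartMap ≫ productToBase =
    Spec.map (CommRingCat.ofHom productBase) := by
  rw [← productFst_toBase, ← Category.assoc, productChartMap_fst, Category.assoc,
    surfaceChartMap_toBase]
  exact (Spec.map_comp _ _).symm

variable {ω : ℂ} (hω : IsPrimitiveRoot ω 3)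

/-- The affine open subscheme of the family of threefolds with coordinate ring `RohdeRing`. -/
def rohdeChart (ω : ℂ) : Spec (.of (RohdeRing ω)) ⟶ productFamily :=
  Spec.map (CommRingCat.ofHom (algebraMap ProductChart (RohdeRing ω))) ≫ productChartMap

instance : IsOpenImmersion (rohdeChart ω) := by
  have : IsOpenImmersion (Spec.map (CommRingCat.ofHom
      (algebraMap ProductChart (RohdeRing ω)))) :=
    IsOpenImmersion.of_isLocalization (productLocus ω)
  rw [rohdeChart]
  infer_instance

lemma productAut_comp_fst : productAut hω ≫ productFst = productFst ≫ surfaceAut hω :=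
  pullback.lift_fst _ _ _

lemma productAut_comp_snd : productAut hω ≫ productSnd = productSnd ≫ fermatAut hω :=
  pullback.lift_snd _ _ _

lemma productAut_pow_three :
    productAut hω ≫ productAut hω ≫ productAut hω = 𝟙 productFamily := by
  have h1 : surfaceAut hω ≫ surfaceAut hω ≫ surfaceAut hω = 𝟙 surface := by
    refine hypersurfaceDiag_pow_three _ _ _ fun i => ?_
    fin_cases i
    · exact one_pow 3
    · exact one_pow 3
    · exact rootUnit_pow hω _
    · exact rootUnit_pow hω _
  have h2 : fermatAut hω ≫ fermatAut hω ≫ fermatAut hω = 𝟙 fermat := by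
    refine hypersurfaceDiag_pow_three _ _ _ fun i => ?_
    fin_cases i
    · exact rootUnit_pow hω _
    · exact one_pow 3
    · exact one_pow 3
  apply productFamily_hom_ext
  · have h := productAut_comp_fst hω
    rw [Category.assoc, Category.assoc, h, reassoc_of% h, reassoc_of% h, h1, Category.comp_id,
      Category.id_comp]
  · have h := productAut_comp_snd hω
    rw [Category.assoc, Category.assoc, h, reassoc_of% h, reassoc_of% h, h2, Category.comp_id,
      Category.id_comp]

/-- An automorphism of the coordinate ring which acts on the coordinates as the generator of the
group does makes the chart equivariant. -/
lemma rohdeChart_equivariant (σ : RohdeRing ω →+* RohdeRing ω)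
    (hσ : σ.comp ((algebraMap ProductChart (RohdeRing ω)).comp productBase) =
      (algebraMap ProductChart (RohdeRing ω)).comp productBase)
    (hx : ∀ i, σ (algebraMap ProductChart _ (surfaceIncl (hCoord _ _ i))) =
      algebraMap ProductChart _ (productBase
        (![1, 1, rootUnit hω PtRing, rootUnit hω PtRing] i : PtRingˣ)) *
      algebraMap ProductChart _ (surfaceIncl (hCoord _ _ i)))
    (hz : ∀ i, σ (algebraMap ProductChart _ (fermatIncl (hCoord _ _ i))) =
      algebraMap ProductChart _ (fermatIncl (algebraMap ℂ _ (![rootUnit hω ℂ, 1, 1] i : ℂˣ))) *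
      algebraMap ProductChart _ (fermatIncl (hCoord _ _ i))) :
    Spec.map (CommRingCat.ofHom σ) ≫ rohdeChart ω = rohdeChart ω ≫ productAut hω := by
  obtain ⟨γ, hγ, hγ', e⟩ := exists_hChart_diag
    (surfacePoly_homogeneous (coord PtRing 0) (coord PtRing 1) (coord PtRing 2))
    (k := 0) rfl ![1, 1, rootUnit hω PtRing, rootUnit hω PtRing] (surfacePoly_invariant hω _ _ _)
    rfl
  obtain ⟨δ, hδ, hδ', e'⟩ := exists_hChart_diag fermatPoly_homogeneous (k := 1) rfl
    ![rootUnit hω ℂ, 1, 1] (fermatPoly_invariant hω) rfl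
  have h1 : σ.comp ((algebraMap ProductChart (RohdeRing ω)).comp surfaceIncl) =
      ((algebraMap ProductChart (RohdeRing ω)).comp surfaceIncl).comp γ :=
    hChart_equivariant _ σ γ _ hγ hγ' (RingHom.congr_fun hσ) hx
  have h2 : σ.comp ((algebraMap ProductChart (RohdeRing ω)).comp fermatIncl) =
      ((algebraMap ProductChart (RohdeRing ω)).comp fermatIncl).comp δ :=
    hChart_equivariant _ σ δ _ hδ hδ' (fun z => by
      have h : σ (algebraMap ProductChart _
          (surfaceIncl (algebraMap PtRing _ (algebraMap ℂ _ z)))) = algebraMap ProductChart _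
          (surfaceIncl (algebraMap PtRing _ (algebraMap ℂ _ z))) :=
        RingHom.congr_fun hσ (algebraMap ℂ _ z)
      rw [surfaceIncl_algebraMap_eq] at h
      exact h) hz
  have e1 : surfaceChartMap ≫ surfaceAut hω = Spec.map (CommRingCat.ofHom γ) ≫ surfaceChartMap := e
  have e2 : fermatChartMap ≫ fermatAut hω = Spec.map (CommRingCat.ofHom δ) ≫ fermatChartMap := e'
  exact productFamily_hom_ext
    (chart_equivariant productChartMap_fst (productAut_comp_fst hω) e1 _ σ h1)
    (chart_equivariant productChartMap_snd (productAut_comp_snd hω) e2 _ σ h2)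

end Chart

/-! ### Generizations in the product with a hypersurface -/

open scoped nonZeroDivisors

section NonZeroDivisors

lemma dehomog_mem_nonZeroDivisors {R A : Type} [CommRing R] [CommRing A] [Algebra R A]
    {𝒜 : ℕ → Submodule R A} [GradedAlgebra 𝒜] {s : A} (hs : s ∈ 𝒜 1) (hs' : s ∈ A⁰)
    {g : A} {n : ℕ} (hg : g ∈ 𝒜 n) (hg' : g ∈ A⁰) : dehomog s g ∈ (Dehomog s)⁰ := by
  rw [mem_nonZeroDivisors_iff_right]
  intro y hy
  obtain ⟨z, rfl⟩ := (awayToDehomog_bijective hs).2 y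
  obtain ⟨i, x, hx, rfl⟩ := HomogeneousLocalization.Away.mk_surjective 𝒜 hs z
  rw [awayToDehomog_mk, ← map_mul] at hy
  have hxg : x * g ∈ 𝒜 ((i + n) • 1) := by
    have := SetLike.mul_mem_graded hx hg
    rwa [smul_eq_mul, mul_one] at this ⊢
  rw [← awayToDehomog_mk hs (i + n) (x * g) hxg, ← map_zero (awayToDehomog 𝒜 s)] at hy
  have h1 := congrArg HomogeneousLocalization.val ((awayToDehomog_bijective hs).1 hy)
  rw [HomogeneousLocalization.Away.val_mk, HomogeneousLocalization.val_zero,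
    Localization.mk_eq_mk', IsLocalization.mk'_eq_zero_iff] at h1
  obtain ⟨⟨_, m, rfl⟩, h2⟩ := h1
  have h3 : x * g = 0 := (mem_nonZeroDivisors_iff_right.1 (pow_mem hs' m)) _
      (by rw [mul_comm]; exact h2)
  have h4 : x = 0 := (mem_nonZeroDivisors_iff_right.1 hg') _ h3
  rw [awayToDehomog_mk, h4, map_zero]

variable {ι : Type} {w : ι → ℕ} {d : ℕ}

lemma RegularMod.mk_mem_nonZeroDivisors {D : Type} [CommRing D] {f g : MvPolynomial ι D}
    (h : RegularMod f g) : Ideal.Quotient.mk (Ideal.span {f}) g ∈ (HRing f)⁰ := by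
  refine mem_nonZeroDivisors_iff_right.2 fun y hy => ?_
  obtain ⟨y, rfl⟩ := Ideal.Quotient.mk_surjective y
  rw [← map_mul, Ideal.Quotient.eq_zero_iff_mem, Ideal.mem_span_singleton, mul_comm] at hy
  rw [Ideal.Quotient.eq_zero_iff_mem, Ideal.mem_span_singleton]
  exact h _ hy

lemma RegularMod.dehomog_mem_nonZeroDivisors {D : Type} [CommRing D] {f g : MvPolynomial ι D}
    (hf : f.IsWeightedHomogeneous w d) {j : ι} (hj : w j = 1)
    (hX : RegularMod f (MvPolynomial.X j)) {n : ℕ} (hg : g.IsWeightedHomogeneous w n)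
    (h : RegularMod f g) :
    g.eval₂ (algebraMap D (HChart f j)) (hCoord f j) ∈ (HChart f j)⁰ := by
  let _ := hGradedAlgebra hf
  rw [← dehomog_mk]
  exact RohdeCY.dehomog_mem_nonZeroDivisors (mk_X_mem_hGrading hj) hX.mk_mem_nonZeroDivisors
    (mk_mem_hGrading w f hg) h.mk_mem_nonZeroDivisors

lemma _root_.MvPolynomial.IsWeightedHomogeneous.map {D D' : Type} [CommRing D] [CommRing D']
    {f : MvPolynomial ι D} (hf : f.IsWeightedHomogeneous w d) (φ : D →+* D') :
    (f.map φ).IsWeightedHomogeneous w d := fun m hm => hf fun h => hm (by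
  rw [MvPolynomial.coeff_map, h, map_zero])

lemma eval₂_eq_zero_of_map {D T T' : Type} [CommRing D] [CommRing T] [CommRing T']
    {f : MvPolynomial ι D} {α : D →+* T} {z : ι → T} (h : f.eval₂ α z = 0) (F : T →+* T')
    {α' : D →+* T'} {z' : ι → T'} (hα : ∀ a, F (α a) = α' a) (hz : ∀ i, F (z i) = z' i) :
    f.eval₂ α' z' = 0 := by
  obtain rfl : F.comp α = α' := RingHom.ext hα
  obtain rfl : F ∘ z = z' := funext hz
  have h' := congrArg F h
  rwa [MvPolynomial.hom_eval₂, map_zero] at h'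

/-- Let `B` be an algebra over `k` and let `P` be a point of the product of `Spec B` with an affine
chart of a hypersurface. There is a more general point with the same projection to `Spec B` outside
the zeros of the function given by `G`, if `G` is not a zero divisor modulo the equation of the
hypersurface over the residue ring `B / p` of that projection. -/
lemma exists_prime_le_tensor {k B : Type} [CommRing k] [CommRing B] [Algebra k B]
    {f : MvPolynomial ι k} (hf : f.IsWeightedHomogeneous w d) {j : ι} (hj : w j = 1)
    (P : Ideal (B ⊗[k] HChart f j)) [P.IsPrime] (p : Ideal B)
    (hp : P.comap (inclLeft k B (HChart f j)) = p)
    (hX : RegularMod (f.map ((Ideal.Quotient.mk p).comp (algebraMap k B))) (MvPolynomial.X j))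
    (G : MvPolynomial ι B) {n : ℕ} (hG : G.IsWeightedHomogeneous w n)
    (hG' : RegularMod (f.map ((Ideal.Quotient.mk p).comp (algebraMap k B)))
      (G.map (Ideal.Quotient.mk p))) :
    ∃ Q : Ideal (B ⊗[k] HChart f j), Q.IsPrime ∧ Q ≤ P ∧
      Q.comap (inclLeft k B (HChart f j)) = p ∧
      G.eval₂ (inclLeft k B (HChart f j)) (fun i => inclRight k B _ (hCoord f j i)) ∉ Q := by
  -- Comparison of `B ⊗ k[x]/(f)` with the chart over `B / p`, through which the quotient by
  -- `P` factors; the required prime ideal is the preimage of a minimal prime of that chart,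
  -- and minimal primes consist of zero divisors.
  subst hp
  set p := P.comap (inclLeft k B (HChart f j))
  set f' := f.map ((Ideal.Quotient.mk p).comp (algebraMap k B)) with hf'
  have hf'h : f'.IsWeightedHomogeneous w d := hf.map _
  obtain ⟨F, hF, hF'⟩ := exists_hChart_lift (f := f) j
    ((algebraMap (B ⧸ p) (HChart f' j)).comp ((Ideal.Quotient.mk p).comp (algebraMap k B)))
    (hCoord f' j) (by
      have h := eval₂_hCoord f' j
      rwa [hf', MvPolynomial.eval₂_map] at h) (hCoord_self _ _)
  obtain ⟨θ, hθ, hθ'⟩ := exists_tensor_lift (k := k) ((algebraMap (B ⧸ p) (HChart f' j)).comp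
    (Ideal.Quotient.mk p)) F fun z => (RingHom.congr_fun hF z).symm
  let ψ₀ : B ⧸ p →+* (B ⊗[k] HChart f j) ⧸ P :=
    Ideal.quotientMap P (inclLeft k B (HChart f j)) le_rfl
  obtain ⟨ψ, hψ, hψ'⟩ := exists_hChart_lift (f := f') j ψ₀
    (fun i => Ideal.Quotient.mk P (inclRight k B _ (hCoord f j i))) (by
      rw [hf', MvPolynomial.eval₂_map]
      exact eval₂_eq_zero_of_map (eval₂_hCoord f j) ((Ideal.Quotient.mk P).comp (inclRight k B _))
        (fun z => congrArg (Ideal.Quotient.mk P) (inclLeft_algebraMap k B (HChart f j) z).symm)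
        fun _ => rfl) (by
      rw [hCoord_self, map_one, map_one])
  have hcomp : ψ.comp θ = Ideal.Quotient.mk P := by
    refine tensor_ext _ _ (fun x => ?_) fun x => ?_
    · exact (congrArg ψ (hθ x)).trans (RingHom.congr_fun hψ (Ideal.Quotient.mk p x))
    · have h : (ψ.comp F) = (Ideal.Quotient.mk P).comp (inclRight k B _) := by
        refine hChart_ext _ _ (RingHom.ext fun z => ?_) fun i => ?_
        · refine (congrArg ψ (RingHom.congr_fun hF z)).trans ((RingHom.congr_fun hψ _).trans ?_)
          exact congrArg (Ideal.Quotient.mk P) (inclLeft_algebraMap k B (HChart f j) z)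
        · exact (congrArg ψ (hF' i)).trans (hψ' i)
      exact (congrArg ψ (hθ' x)).trans (RingHom.congr_fun h x)
  have hker : (RingHom.ker ψ).IsPrime := RingHom.ker_isPrime ψ
  obtain ⟨q, hq, hqP⟩ := Ideal.exists_minimalPrimes_le (I := ⊥) (J := RingHom.ker ψ) bot_le
  have hqp : q.IsPrime := hq.1.1
  have hdisj := Set.disjoint_left.1 (Ideal.disjoint_nonZeroDivisors_of_mem_minimalPrimes hq)
  have hle : q.comap θ ≤ P := by
    intro x hx
    have h : ψ (θ x) = 0 := hqP hx
    rw [← RingHom.comp_apply, hcomp] at h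
    exact Ideal.Quotient.eq_zero_iff_mem.1 h
  refine ⟨q.comap θ, hqp.comap θ, hle, le_antisymm (Ideal.comap_mono hle) fun b hb => ?_, ?_⟩
  · rw [Ideal.mem_comap, Ideal.mem_comap]
    have h : θ (inclLeft k B (HChart f j) b) = 0 := by
      refine (hθ b).trans ?_
      rw [RingHom.comp_apply, Ideal.Quotient.eq_zero_iff_mem.2 hb, map_zero]
    rw [h]
    exact q.zero_mem
  · intro hmem
    refine hdisj (Ideal.mem_comap.1 hmem) ?_
    have h := hX.dehomog_mem_nonZeroDivisors hf'h hj (hG.map _) hG'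
    have e : θ (G.eval₂ (inclLeft k B (HChart f j)) (fun i => inclRight k B _ (hCoord f j i))) =
        (G.map (Ideal.Quotient.mk p)).eval₂ (algebraMap (B ⧸ p) (HChart f' j)) (hCoord f' j) := by
      rw [MvPolynomial.hom_eval₂, MvPolynomial.eval₂_map]
      congr 1
      · exact RingHom.ext hθ
      · exact funext fun i => (hθ' _).trans (hF' i)
    rw [e]
    exact h

end NonZeroDivisors

/-! ### Regular elements modulo the equations of the two families -/

section Regularity

lemma map_alphaForm {T T' : Type} [CommRing T] [CommRing T'] (F : T →+* T')
    (a b w x₀ x₁ : T) : F (alphaForm a b w x₀ x₁) = alphaForm (F a) (F b) (F w) (F x₀) (F x₁) := by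
  simp [alphaForm]

lemma ne_zero_of_map_ne_zero {R S : Type} [CommRing R] [CommRing S] (F : R →+* S) {x : R}
    (h : F x ≠ 0) : x ≠ 0 := fun e => h (by rw [e, map_zero])

/-- Over a domain, the nonzero polynomials which do not involve `x_k` are regular modulo a
polynomial which is monic of degree three in `x_k`. -/
lemma regularMod_of_monic {D : Type} [CommRing D] [IsDomain D] {ι : Type} [DecidableEq ι] (k : ι)
    {f g : MvPolynomial ι D} (r n : MvPolynomial {i // i ≠ k} D)
    (hf : f = MvPolynomial.X k ^ 3 + MvPolynomial.rename Subtype.val r)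
    (hg : g = MvPolynomial.rename Subtype.val n) (hn : n ≠ 0) : RegularMod f g := by
  subst hf hg
  exact fun p hp => dvd_of_dvd_mul_of_monic k hn hp

lemma map_fermatPoly {D : Type} [CommRing D] (φ : ℂ →+* D) : fermatPoly.map φ =
    MvPolynomial.X 0 ^ 3 + MvPolynomial.X 1 ^ 3 + MvPolynomial.X 2 ^ 3 := by
  simp [fermatPoly]

lemma regularMod_fermatPoly_X {D : Type} [CommRing D] [IsDomain D] (φ : ℂ →+* D) (i : Fin 3) :
    RegularMod (fermatPoly.map φ) (MvPolynomial.X i) := by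
  rw [map_fermatPoly]
  by_cases hi : i = 0
  · subst hi
    exact regularMod_of_monic 1
      (MvPolynomial.X ⟨0, by decide⟩ ^ 3 + MvPolynomial.X ⟨2, by decide⟩ ^ 3)
      (MvPolynomial.X ⟨0, by decide⟩) (by simp; ring) (by simp) (MvPolynomial.X_ne_zero _)
  · exact regularMod_of_monic 0
      (MvPolynomial.X ⟨1, by decide⟩ ^ 3 + MvPolynomial.X ⟨2, by decide⟩ ^ 3)
      (MvPolynomial.X ⟨i, hi⟩) (by simp; ring) (by simp) (MvPolynomial.X_ne_zero _)

lemma regularMod_fermatPoly_linear {D : Type} [CommRing D] [IsDomain D] (φ : ℂ →+* D) {s t : D}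
    (hs : s ≠ 0) : RegularMod (fermatPoly.map φ)
      (MvPolynomial.C s * MvPolynomial.X 1 + MvPolynomial.C t * MvPolynomial.X 2) := by
  rw [map_fermatPoly]
  refine regularMod_of_monic 0
      (MvPolynomial.X ⟨1, by decide⟩ ^ 3 + MvPolynomial.X ⟨2, by decide⟩ ^ 3)
      (MvPolynomial.C s * MvPolynomial.X ⟨1, by decide⟩ +
        MvPolynomial.C t * MvPolynomial.X ⟨2, by decide⟩) (by simp; ring) (by simp) ?_
  refine ne_zero_of_map_ne_zero (MvPolynomial.eval fun i => ![0, 1, 0] i.1) ?_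
  simpa using hs

lemma one_sub_sq_ne_zero {D : Type} [CommRing D] {w : D}
    (hw : 1 + w + w ^ 2 = 0) (h3 : (3 : D) ≠ 0) : 1 - w ^ 2 ≠ 0 := fun h =>
  h3 (by linear_combination (1 - w) * h - (w - 2) * hw)

/-- Each factor of `coverForm` is not zero, as it does not vanish at every point. -/
lemma coverForm_ne_zero {D P : Type} [CommRing D] [IsDomain D] [CommRing P] [IsDomain P]
    {α : D →+* P} {x₀ x₁ x₂ x₃ : P}
    (hP : ∀ v₀ v₁ v₂ v₃ : D, ∃ F : P →+* D, (∀ z, F (α z) = z) ∧ F x₀ = v₀ ∧ F x₁ = v₁ ∧ F x₂ = v₂ ∧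
      F x₃ = v₃)
    {a b c w : D} (h : Separated a b c) (hw : 1 + w + w ^ 2 = 0) (h3 : (3 : D) ≠ 0) :
    coverForm (α a) (α b) (α c) (α w) x₀ x₁ x₂ x₃ ≠ 0 := by
  obtain ⟨F₀, hF₀, p0, p1, p2, p3⟩ := hP 1 0 0 0
  obtain ⟨F₁, hF₁, q0, q1, q2, q3⟩ := hP 0 1 0 0
  obtain ⟨F₂, hF₂, r0, r1, r2, r3⟩ := hP 0 0 1 0
  obtain ⟨F₃, hF₃, s0, s1, s2, s3⟩ := hP 0 0 0 1
  obtain ⟨F, hF, t0, t1, t2, t3⟩ := hP 1 1 0 0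
  obtain ⟨-, -, -, ha, hb, hc, -, -, -⟩ := h
  have ha' : (1 : D) - a ≠ 0 := by rw [← neg_sub]; exact ha.neg.ne_zero
  have hb' : (1 : D) - b ≠ 0 := by rw [← neg_sub]; exact hb.neg.ne_zero
  have hc' : (1 : D) - c ≠ 0 := by rw [← neg_sub]; exact hc.neg.ne_zero
  rw [coverForm]
  refine mul_ne_zero (mul_ne_zero (mul_ne_zero (mul_ne_zero (mul_ne_zero (mul_ne_zero
    (mul_ne_zero (mul_ne_zero (mul_ne_zero (mul_ne_zero (mul_ne_zero ?_ ?_) ?_) ?_) ?_) ?_) ?_)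
    ?_) ?_) ?_) ?_) ?_
  · exact ne_zero_of_map_ne_zero F₁ (by simp [q1])
  · exact ne_zero_of_map_ne_zero F₂ (by simp [r2])
  · exact ne_zero_of_map_ne_zero F₃ (by simp [s3])
  · exact ne_zero_of_map_ne_zero F₀ (by simp [p0, p1, p2])
  · exact ne_zero_of_map_ne_zero F₀ (by simp [p0, p1, p2])
  · exact ne_zero_of_map_ne_zero F₀ (by simp [p0, p1, p2, p3])
  · exact ne_zero_of_map_ne_zero F₀ (by simp [p0, p1, p2, p3])
  · exact ne_zero_of_map_ne_zero F₁ (by simpa [q0, q1, q2, hF₁] using ha.ne_zero)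
  · exact ne_zero_of_map_ne_zero F₀ (by simpa [p0, p1, p2, hF₀] using ha')
  · exact ne_zero_of_map_ne_zero F₀ (by simpa [p0, p1, p2, hF₀] using hb')
  · exact ne_zero_of_map_ne_zero F₀ (by simpa [p0, p1, p2, hF₀] using hc')
  · refine ne_zero_of_map_ne_zero F ?_
    have e := mul_ne_zero ha' (one_sub_sq_ne_zero hw h3)
    intro h
    refine e ?_
    simp only [map_add, map_mul, map_sub, map_pow, hF, t0, t1, t2] at h
    linear_combination h

lemma Separated.map {A B : Type} [CommRing A] [CommRing B] {a b c : A} (h : Separated a b c)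
    (F : A →+* B) : Separated (F a) (F b) (F c) := by
  obtain ⟨h1, h2, h3, h4, h5, h6, h7, h8, h9⟩ := h
  refine ⟨h1.map F, h2.map F, h3.map F, ?_, ?_, ?_, ?_, ?_, ?_⟩
  · simpa using h4.map F
  · simpa using h5.map F
  · simpa using h6.map F
  · simpa using h7.map F
  · simpa using h8.map F
  · simpa using h9.map F

lemma map_coverPoly {A B : Type} [CommRing A] [CommRing B] (H : Matrix (Fin 4) (Fin 6) A)
    (φ : A →+* B) : (coverPoly H).map φ = coverPoly (H.map φ) := by
  simp [coverPoly, map_prod]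

/-- The coordinates `X₀, …, X₃` as polynomials which do not involve `y`. -/
def coverVar {D : Type} [CommRing D] (i : Fin 4) : MvPolynomial {i : Fin 5 // i ≠ 4} D :=
  MvPolynomial.X ⟨i.castSucc, (Fin.castSucc_lt_last i).ne⟩

lemma coverPoly_eq {D : Type} [CommRing D] (H : Matrix (Fin 4) (Fin 6) D) : coverPoly H =
    MvPolynomial.X 4 ^ 3 + MvPolynomial.rename Subtype.val
      (-∏ j : Fin 6, ∑ i : Fin 4, MvPolynomial.C (H i j) * coverVar i) := by
  simp [coverPoly, coverVar, map_prod, sub_eq_add_neg]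

lemma regularMod_coverPoly {D : Type} [CommRing D] [IsDomain D] (H : Matrix (Fin 4) (Fin 6) D)
    {a b c w : D} (h : Separated a b c) (hw : 1 + w + w ^ 2 = 0) (h3 : (3 : D) ≠ 0) :
    RegularMod (coverPoly H) (MvPolynomial.X 0 *
      coverForm (MvPolynomial.C a) (MvPolynomial.C b) (MvPolynomial.C c) (MvPolynomial.C w)
        (MvPolynomial.X 0) (MvPolynomial.X 1) (MvPolynomial.X 2) (MvPolynomial.X 3)) := by
  refine regularMod_of_monic 4 _ (coverVar 0 * coverForm (MvPolynomial.C a) (MvPolynomial.C b)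
    (MvPolynomial.C c) (MvPolynomial.C w) (coverVar 0) (coverVar 1) (coverVar 2) (coverVar 3))
    (coverPoly_eq H) ?_ (mul_ne_zero (MvPolynomial.X_ne_zero _)
      (coverForm_ne_zero (fun v₀ v₁ v₂ v₃ => ?_) h hw h3))
  · rw [map_mul]
    refine congrArg₂ _ ?_ ?_
    · simp [coverVar]
    · simp [coverVar, coverForm]
  · refine ⟨MvPolynomial.eval fun i => ![v₀, v₁, v₂, v₃, 0] i.1, fun z => MvPolynomial.eval_C _, ?_,
      ?_, ?_, ?_⟩ <;> exact MvPolynomial.eval_X _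

lemma fibrewiseRegular_coverPoly {a b c w : PlRing} (h : Separated a b c)
    (hw : 1 + w + w ^ 2 = 0) (h3 : IsUnit (3 : PlRing)) :
    FibrewiseRegular (coverPoly univPlanes) (MvPolynomial.X 0 *
      coverForm (MvPolynomial.C a) (MvPolynomial.C b) (MvPolynomial.C c) (MvPolynomial.C w)
        (MvPolynomial.X 0) (MvPolynomial.X 1) (MvPolynomial.X 2) (MvPolynomial.X 3)) := by
  intro b _
  rw [map_mul, map_coverForm, map_coverPoly]
  simp only [MvPolynomial.map_X, MvPolynomial.map_C]
  refine regularMod_coverPoly _ (h.map _) ?_ ?_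
  · simpa using congrArg (Ideal.Quotient.mk b) hw
  · have h := (h3.map (Ideal.Quotient.mk b)).ne_zero
    rwa [map_ofNat] at h

lemma map_surfacePoly {A B : Type} [CommRing A] [CommRing B] (a b c : A)
    (φ : A →+* B) : (surfacePoly a b c).map φ = surfacePoly (φ a) (φ b) (φ c) := by
  simp [surfacePoly]

/-- The coordinates `x₀, x₁, y₁` as polynomials which do not involve `y₂`. -/
def surfaceVar {D : Type} [CommRing D] (i : Fin 3) : MvPolynomial {i : Fin 4 // i ≠ 3} D :=
  MvPolynomial.X ⟨i.castSucc, (Fin.castSucc_lt_last i).ne⟩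

lemma surfacePoly_eq {D : Type} [CommRing D] (a b c : D) : surfacePoly a b c =
    MvPolynomial.X 3 ^ 3 + MvPolynomial.rename Subtype.val
      (surfaceVar 2 ^ 3 + surfaceVar 0 * branch (MvPolynomial.C a) (MvPolynomial.C b)
        (MvPolynomial.C c) (surfaceVar 0) (surfaceVar 1)) := by
  simp [surfacePoly, surfaceVar, branch]
  ring

lemma regularMod_surfacePoly_X {D : Type} [CommRing D] [IsDomain D] (a b c : D) :
    RegularMod (surfacePoly a b c) (MvPolynomial.X 0) :=
  regularMod_of_monic 3 _ (surfaceVar 0) (surfacePoly_eq a b c) (by simp [surfaceVar])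
    (MvPolynomial.X_ne_zero _)

lemma regularMod_surfacePoly_branch {D : Type} [CommRing D] [IsDomain D] (a b c : D) :
    RegularMod (surfacePoly a b c) (branch (MvPolynomial.C a) (MvPolynomial.C b)
        (MvPolynomial.C c) (MvPolynomial.X 0) (MvPolynomial.X 1)) := by
  refine regularMod_of_monic 3 _ (branch (MvPolynomial.C a) (MvPolynomial.C b)
        (MvPolynomial.C c) (surfaceVar 0) (surfaceVar 1)) (surfacePoly_eq a b c)
    (by simp [surfaceVar, branch])
    (ne_zero_of_map_ne_zero (MvPolynomial.eval fun i => ![0, 1, 0, 0] i.1) ?_)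
  simp [branch, surfaceVar]

lemma regularMod_surfacePoly_alphaForm {D : Type} [CommRing D] [IsDomain D] {a b c : D} (w : D)
    (h : Separated a b c) :
    RegularMod (surfacePoly a b c) (alphaForm (MvPolynomial.C a) (MvPolynomial.C b)
        (MvPolynomial.C w) (MvPolynomial.X 0) (MvPolynomial.X 1)) := by
  refine regularMod_of_monic 3 _ (alphaForm (MvPolynomial.C a) (MvPolynomial.C b)
        (MvPolynomial.C w) (surfaceVar 0) (surfaceVar 1)) (surfacePoly_eq a b c)
    (by simp [surfaceVar, alphaForm])
    (ne_zero_of_map_ne_zero (MvPolynomial.eval fun i => ![1, 1, 0, 0] i.1) ?_)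
  simpa [alphaForm, surfaceVar] using ⟨h.2.2.2.1.ne_zero, h.2.2.2.2.1.ne_zero⟩

/-- Write `lamForm = p y₁ + q y₂`. The norm `p³ y₁³ + q³ y₂³` is a multiple of it, and modulo the
equation of the surface it is congruent to a polynomial without `y₂`. -/
lemma regularMod_surfacePoly_lamForm {D : Type} [CommRing D] [IsDomain D] (a b c : D) {w : D}
    (hw : 1 + w + w ^ 2 = 0) :
    RegularMod (surfacePoly a b c) (lamForm (MvPolynomial.C c) (MvPolynomial.C w)
      (MvPolynomial.X 0) (MvPolynomial.X 1) (MvPolynomial.X 2) (MvPolynomial.X 3)) := by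
  set p : MvPolynomial (Fin 4) D := (MvPolynomial.X 1 - MvPolynomial.C c * MvPolynomial.X 0) *
    MvPolynomial.C w + MvPolynomial.X 1 with hp
  set q : MvPolynomial (Fin 4) D := (MvPolynomial.X 1 - MvPolynomial.C c * MvPolynomial.X 0) *
    MvPolynomial.C w ^ 2 + MvPolynomial.X 1 with hq
  have hreg : RegularMod (surfacePoly a b c) ((p ^ 3 - q ^ 3) * MvPolynomial.X 2 ^ 3 -
      q ^ 3 * (MvPolynomial.X 0 * branch (MvPolynomial.C a) (MvPolynomial.C b)
        (MvPolynomial.C c) (MvPolynomial.X 0) (MvPolynomial.X 1))) := by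
    set p' : MvPolynomial {i : Fin 4 // i ≠ 3} D :=
      (surfaceVar 1 - MvPolynomial.C c * surfaceVar 0) * MvPolynomial.C w + surfaceVar 1 with hp'
    set q' : MvPolynomial {i : Fin 4 // i ≠ 3} D :=
      (surfaceVar 1 - MvPolynomial.C c * surfaceVar 0) * MvPolynomial.C w ^ 2 + surfaceVar 1
      with hq'
    refine regularMod_of_monic 3 _ ((p' ^ 3 - q' ^ 3) * surfaceVar 2 ^ 3 -
      q' ^ 3 * (surfaceVar 0 * branch (MvPolynomial.C a) (MvPolynomial.C b)
        (MvPolynomial.C c) (surfaceVar 0) (surfaceVar 1))) (surfacePoly_eq a b c) ?_ ?_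
    · simp [hp, hq, hp', hq', surfaceVar, branch]
    · refine ne_zero_of_map_ne_zero
        (MvPolynomial.eval₂Hom Polynomial.C fun i => ![Polynomial.X, 1, 0, 0] i.1) ?_
      have e : (MvPolynomial.eval₂Hom Polynomial.C fun i : {i : Fin 4 // i ≠ 3} =>
          ![Polynomial.X, 1, 0, 0] i.1) ((p' ^ 3 - q' ^ 3) * surfaceVar 2 ^ 3 -
          q' ^ 3 * (surfaceVar 0 * branch (MvPolynomial.C a) (MvPolynomial.C b)
          (MvPolynomial.C c) (surfaceVar 0) (surfaceVar 1))) =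
          -(((1 - Polynomial.C c * Polynomial.X) * Polynomial.C w ^ 2 + 1) ^ 3 * (Polynomial.X *
            branch (Polynomial.C a) (Polynomial.C b) (Polynomial.C c) Polynomial.X 1)) := by
        simp [hp', hq', surfaceVar, branch]
      rw [e, neg_ne_zero]
      have hw0 : w ^ 2 + 1 ≠ 0 := fun h => by
        have h0 : w = 0 := by linear_combination hw - h
        rw [h0] at h
        simp at h
      refine mul_ne_zero (pow_ne_zero 3 (ne_zero_of_map_ne_zero (Polynomial.evalRingHom 0) ?_))
        (mul_ne_zero Polynomial.X_ne_zero (ne_zero_of_map_ne_zero (Polynomial.evalRingHom 0) ?_))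
      · simpa using hw0
      · simp [branch]
  intro t ht
  refine hreg t ?_
  have hF : surfacePoly a b c = MvPolynomial.X 2 ^ 3 + MvPolynomial.X 3 ^ 3 +
      MvPolynomial.X 0 * branch (MvPolynomial.C a) (MvPolynomial.C b)
        (MvPolynomial.C c) (MvPolynomial.X 0) (MvPolynomial.X 1) := by
    simp [surfacePoly, branch]
    ring
  have hl : lamForm (MvPolynomial.C c) (MvPolynomial.C w)
      (MvPolynomial.X 0) (MvPolynomial.X 1) (MvPolynomial.X 2) (MvPolynomial.X 3) =
      p * MvPolynomial.X 2 + q * MvPolynomial.X 3 := by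
    rw [lamForm, hp, hq]
    ring
  rw [hl] at ht
  have e : ((p ^ 3 - q ^ 3) * MvPolynomial.X 2 ^ 3 -
      q ^ 3 * (MvPolynomial.X 0 * branch (MvPolynomial.C a) (MvPolynomial.C b)
        (MvPolynomial.C c) (MvPolynomial.X 0) (MvPolynomial.X 1))) * t =
      (p ^ 2 * MvPolynomial.X 2 ^ 2 - p * q * MvPolynomial.X 2 * MvPolynomial.X 3 +
        q ^ 2 * MvPolynomial.X 3 ^ 2) * ((p * MvPolynomial.X 2 + q * MvPolynomial.X 3) * t) -
      surfacePoly a b c * (q ^ 3 * t) := by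
    rw [hF]
    ring
  rw [e]
  exact dvd_sub (ht.mul_left _) (dvd_mul_right _ _)

lemma fibrewiseRegular_surfacePoly {a b c w : PtRing} (h : Separated a b c)
    (hw : 1 + w + w ^ 2 = 0) :
    FibrewiseRegular (surfacePoly a b c) (MvPolynomial.X 0 *
      (surfaceForm (MvPolynomial.C a) (MvPolynomial.C b) (MvPolynomial.C c) (MvPolynomial.C w)
        (MvPolynomial.X 0) (MvPolynomial.X 1) (MvPolynomial.X 2) (MvPolynomial.X 3) *
      alphaForm (MvPolynomial.C a) (MvPolynomial.C b) (MvPolynomial.C w)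
        (MvPolynomial.X 0) (MvPolynomial.X 1))) := by
  intro b _
  rw [map_mul, map_mul, map_surfaceForm, map_alphaForm, map_surfacePoly]
  simp only [MvPolynomial.map_X, MvPolynomial.map_C]
  refine (regularMod_surfacePoly_X _ _ _).mul (((regularMod_surfacePoly_branch _ _ _).mul
    (regularMod_surfacePoly_lamForm _ _ _ ?_)).mul (regularMod_surfacePoly_alphaForm _ (h.map _)))
  simpa using congrArg (Ideal.Quotient.mk b) hw

end Regularity

/-! ### The Fermat curve and the points of the charts -/

section BasicOpen

variable {ι A : Type} [CommRing A] {w : ι → ℕ} {f : MvPolynomial ι A} {d : ℕ}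
  (hf : f.IsWeightedHomogeneous w d)

/-- The open subset of a hypersurface where the polynomial `g` does not vanish. -/
def hBasicOpen (g : MvPolynomial ι A) : (hypersurface hf).Opens :=
  letI := hGradedAlgebra hf
  Proj.basicOpen (hGrading w f) (Ideal.Quotient.mk _ g)

lemma mem_hBasicOpen_mul {g g' : MvPolynomial ι A} (x : hypersurface hf) :
    x ∈ hBasicOpen hf (g * g') ↔ x ∈ hBasicOpen hf g ∧ x ∈ hBasicOpen hf g' := by
  let _ := hGradedAlgebra hf
  have h : hBasicOpen hf (g * g') = hBasicOpen hf g ⊓ hBasicOpen hf g' := by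
    change Proj.basicOpen (hGrading w f) _ = _
    rw [map_mul, Proj.basicOpen_mul]
    rfl
  rw [h]
  rfl

variable {k : ι} (hk : w k = 1)

lemma range_hChartMap :
    Set.range (hChartMap hf hk).base =
      (hBasicOpen hf (MvPolynomial.X k) : Set (hypersurface hf)) := by
  let _ := hGradedAlgebra hf
  exact congrArg (fun U : (Proj (hGrading w f)).Opens => (U : Set (Proj (hGrading w f))))
    (opensRange_dehomogChart (mk_X_mem_hGrading (f := f) hk))

lemma hChartMap_mem_hBasicOpen {g : MvPolynomial ι A} {n : ℕ} (hn : 0 < n)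
    (hg : g.IsWeightedHomogeneous w n) (t : Spec (.of (HChart f k))) :
    (hChartMap hf hk).base t ∈ hBasicOpen hf g ↔
      g.eval₂ (algebraMap A (HChart f k)) (hCoord f k) ∉ t.asIdeal := by
  let _ := hGradedAlgebra hf
  have h := dehomogChart_preimage_basicOpen (mk_X_mem_hGrading (f := f) hk) hn
    (mk_mem_hGrading w f hg)
  rw [dehomog_mk] at h
  exact iff_of_eq (congrArg (fun U : (Spec (.of (HChart f k))).Opens => t ∈ U) h)

/-- A point of a weighted projective space has a nonzero coordinate. -/
lemma exists_mem_hBasicOpen_X (x : hypersurface hf) :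
    ∃ i, x ∈ hBasicOpen hf (MvPolynomial.X i) := by
  let _ := hGradedAlgebra hf
  let x' : ProjectiveSpectrum (hGrading w f) := x
  by_contra! hcon
  refine x'.not_irrelevant_le ?_
  rw [HomogeneousIdeal.irrelevant_le]
  rintro n hn _ ⟨p, hp, rfl⟩
  have hX : ∀ i, Ideal.Quotient.mk (Ideal.span {f}) (MvPolynomial.X i) ∈
      x'.asHomogeneousIdeal.toIdeal := fun i => not_not.1 (hcon i)
  have hp' : p ∈ Ideal.span (MvPolynomial.X '' Set.univ) := by
    rw [MvPolynomial.mem_ideal_span_X_image]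
    intro m hm
    have h1 : Finsupp.weight w m = n := hp (MvPolynomial.mem_support_iff.1 hm)
    have h2 : m ≠ 0 := by
      rintro rfl
      rw [map_zero] at h1
      exact hn.ne h1
    obtain ⟨i, hi⟩ := Finsupp.ne_iff.1 h2
    exact ⟨i, trivial, hi⟩
  have hle : Ideal.span (MvPolynomial.X '' Set.univ) ≤
      x'.asHomogeneousIdeal.toIdeal.comap (Ideal.Quotient.mk (Ideal.span {f})) := by
    rw [Ideal.span_le]
    rintro _ ⟨i, -, rfl⟩
    exact hX i
  exact hle hp'

lemma exists_specializes_hBasicOpen {g : MvPolynomial ι A}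
    (hg : FibrewiseRegular f g) (x : hypersurface hf) :
    ∃ y : hypersurface hf, y ⤳ x ∧
      (hypersurfaceToBase hf).base y = (hypersurfaceToBase hf).base x ∧ y ∈ hBasicOpen hf g :=
  exists_specializes_hypersurface hf hg x

end BasicOpen

section TensorChart

variable {k B C : Type} [CommRing k] [CommRing B] [CommRing C] [Algebra k B] [Algebra k C]
  {X Y : Scheme.{0}} (f : X ⟶ Spec (.of k)) (g : Y ⟶ Spec (.of k))
  (i : Spec (.of B) ⟶ X) (i' : Spec (.of C) ⟶ Y)
  (hi : i ≫ f = Spec.map (CommRingCat.ofHom (algebraMap k B)))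
  (hi' : i' ≫ g = Spec.map (CommRingCat.ofHom (algebraMap k C)))

lemma range_tensorChart : Set.range (tensorChart f g i i' hi hi').base =
    (pullback.fst f g).base ⁻¹' Set.range i.base ∩
      (pullback.snd f g).base ⁻¹' Set.range i'.base := by
  have h : Set.range (tensorChart f g i i' hi hi').base =
      Set.range (pullback.map _ _ f g i i' (𝟙 _) (by rw [Category.comp_id, hi])
        (by rw [Category.comp_id, hi'])).base := by
    rw [tensorChart_eq]
    have hs : Function.Surjective (pullbackSpecIso k B C).inv.base :=
      (pullbackSpecIso k B C).inv.surjective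
    refine Set.Subset.antisymm ?_ ?_
    · rintro _ ⟨t, rfl⟩
      exact ⟨_, rfl⟩
    · rintro _ ⟨t, rfl⟩
      obtain ⟨t, rfl⟩ := hs t
      exact ⟨t, rfl⟩
  rw [h]
  exact Scheme.Pullback.range_map _ _ _ _ _ _ _ _ _

end TensorChart

section Density

/-- The chart `z_j = 1` of the Fermat curve. -/
def fermatChartMapAt (j : Fin 3) : Spec (.of (HChart fermatPoly j)) ⟶ fermat :=
  hChartMap fermatPoly_homogeneous (k := j) rfl

/-- The chart `x₀ = 1`, `z_j = 1` of the family of threefolds. -/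
def productChartMapAt (j : Fin 3) :
    Spec (.of (SurfaceChart ⊗[ℂ] HChart fermatPoly j)) ⟶ productFamily :=
  tensorChart (surfaceToBase ≫ MPtToC) fermatToBase surfaceChartMap (fermatChartMapAt j)
    surfaceChartMap_toC (hChartMap_toBase _ _)

lemma productChartMapAt_fst (j : Fin 3) : productChartMapAt j ≫ productFst =
    Spec.map (CommRingCat.ofHom (inclLeft ℂ _ _)) ≫ surfaceChartMap := tensorChart_fst _ _ _ _ _ _

lemma productChartMapAt_snd (j : Fin 3) : productChartMapAt j ≫ productSnd =
    Spec.map (CommRingCat.ofHom (inclRight ℂ _ _)) ≫ fermatChartMapAt j :=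
  tensorChart_snd _ _ _ _ _ _

/-- The open subset of the Fermat curve where the polynomial `g` does not vanish. -/
def fermatBasicOpen (g : MvPolynomial (Fin 3) ℂ) : fermat.Opens :=
  hBasicOpen fermatPoly_homogeneous g

lemma range_fermatChartMapAt (j : Fin 3) :
    Set.range (fermatChartMapAt j).base = (fermatBasicOpen (MvPolynomial.X j) : Set fermat) :=
  range_hChartMap fermatPoly_homogeneous _

lemma fermatChartMapAt_mem {j : Fin 3} {g : MvPolynomial (Fin 3) ℂ} {n : ℕ} (hn : 0 < n)
    (hg : g.IsWeightedHomogeneous (fun _ => 1) n) (t : Spec (.of (HChart fermatPoly j))) :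
    (fermatChartMapAt j).base t ∈ fermatBasicOpen g ↔
      g.eval₂ (algebraMap ℂ (HChart fermatPoly j)) (hCoord fermatPoly j) ∉ t.asIdeal :=
  hChartMap_mem_hBasicOpen fermatPoly_homogeneous _ hn hg t

lemma range_productChartMapAt (j : Fin 3) : Set.range (productChartMapAt j).base =
    productFst.base ⁻¹' Set.range surfaceChartMap.base ∩
      productSnd.base ⁻¹' (fermatBasicOpen (MvPolynomial.X j) : Set fermat) := by
  have h : Set.range (productChartMapAt j).base =
    productFst.base ⁻¹' Set.range surfaceChartMap.base ∩
      productSnd.base ⁻¹' Set.range (fermatChartMapAt j).base := range_tensorChart _ _ _ _ _ _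
  rw [h, range_fermatChartMapAt]

/-- Outside a divisor which does not contain the fibre of the projection to the first factor through
a given point, one finds a generization of this point in the same fibre. -/
lemma exists_specializes_spec_tensor {ι k B : Type} [CommRing k] [CommRing B] [Algebra k B]
    {w : ι → ℕ} {d : ℕ} {f : MvPolynomial ι k} (hf : f.IsWeightedHomogeneous w d) {j : ι}
    (hj : w j = 1) (t : Spec (.of (B ⊗[k] HChart f j)))
    (hX : ∀ {D : Type} [CommRing D] [IsDomain D] (φ : k →+* D),
      RegularMod (f.map φ) (MvPolynomial.X j))
    (G : MvPolynomial ι B) {n : ℕ} (hG : G.IsWeightedHomogeneous w n)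
    (hG' : ∀ {D : Type} [CommRing D] [IsDomain D] (φ : B →+* D),
      RingHom.ker φ = t.asIdeal.comap (inclLeft k B (HChart f j)) →
      RegularMod (f.map (φ.comp (algebraMap k B))) (G.map φ)) :
    ∃ t' : Spec (.of (B ⊗[k] HChart f j)), t' ⤳ t ∧
      (Spec.map (CommRingCat.ofHom (inclLeft k B (HChart f j)))).base t' =
        (Spec.map (CommRingCat.ofHom (inclLeft k B (HChart f j)))).base t ∧
      G.eval₂ (inclLeft k B _) (fun i => inclRight k B _ (hCoord f j i)) ∉ t'.asIdeal := by
  let t₀ : PrimeSpectrum (B ⊗[k] HChart f j) := t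
  have := t₀.isPrime
  have : (t₀.asIdeal.comap (inclLeft k B (HChart f j))).IsPrime := Ideal.comap_isPrime _ _
  obtain ⟨Q, hQ, hQP, hQp, hQG⟩ := exists_prime_le_tensor hf hj t₀.asIdeal _ rfl (hX _) G hG
    (hG' _ Ideal.mk_ker)
  let t' : PrimeSpectrum (B ⊗[k] HChart f j) := ⟨Q, hQ⟩
  exact ⟨t', (PrimeSpectrum.le_iff_specializes t' t₀).1 hQP, PrimeSpectrum.ext hQp, hQG⟩

lemma eval₂_inclLeft_map {ι k B C : Type} [CommRing k] [CommRing B] [CommRing C] [Algebra k B]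
    [Algebra k C] (g : MvPolynomial ι k) (z : ι → C) :
    (g.map (algebraMap k B)).eval₂ (inclLeft k B C) (fun i => inclRight k B C (z i)) =
      inclRight k B C (g.eval₂ (algebraMap k C) z) := by
  rw [MvPolynomial.eval₂_map, MvPolynomial.hom_eval₂]
  congr 1
  exact RingHom.ext fun x => inclLeft_algebraMap k B C x

lemma exists_specializes_spec_fermat {B : Type} [CommRing B] [Algebra ℂ B] (j : Fin 3)
    (t : Spec (.of (B ⊗[ℂ] HChart fermatPoly j))) :
    ∃ t' : Spec (.of (B ⊗[ℂ] HChart fermatPoly j)), t' ⤳ t ∧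
      (Spec.map (CommRingCat.ofHom (inclLeft ℂ B (HChart fermatPoly j)))).base t' =
        (Spec.map (CommRingCat.ofHom (inclLeft ℂ B (HChart fermatPoly j)))).base t ∧
      (fermatChartMapAt j).base ((Spec.map (CommRingCat.ofHom (inclRight ℂ B _))).base t') ∈
        fermatBasicOpen (MvPolynomial.X 0 * MvPolynomial.X 1) := by
  have hG : (MvPolynomial.X 0 * MvPolynomial.X 1 : MvPolynomial (Fin 3) ℂ).IsWeightedHomogeneous
      (fun _ => 1) 2 := (MvPolynomial.isWeightedHomogeneous_X ℂ (fun _ => 1) 0).mul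
    (MvPolynomial.isWeightedHomogeneous_X ℂ (fun _ => 1) 1)
  obtain ⟨t', ht, hf, hn⟩ := exists_specializes_spec_tensor (B := B) fermatPoly_homogeneous
    (j := j) rfl t (fun φ => regularMod_fermatPoly_X φ j)
    ((MvPolynomial.X 0 * MvPolynomial.X 1 : MvPolynomial (Fin 3) ℂ).map (algebraMap ℂ _))
    (hG.map _) (fun φ _ => by
      rw [map_mul, map_mul, MvPolynomial.map_X, MvPolynomial.map_X, MvPolynomial.map_X,
        MvPolynomial.map_X]
      exact (regularMod_fermatPoly_X _ 0).mul (regularMod_fermatPoly_X _ 1))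
  refine ⟨t', ht, hf, (fermatChartMapAt_mem two_pos hG _).2 fun hmem => hn ?_⟩
  rw [eval₂_inclLeft_map]
  exact hmem

/-- A point of the family of threefolds in the chart `x₀ = 1` is a specialization of a point in the
same fibre of the projection to the surface at which `z₀` and `z₁` do not vanish. -/
lemma exists_specializes_coordinates (z : productFamily)
    (hz : productFst.base z ∈ Set.range surfaceChartMap.base) :
    ∃ y : productFamily, y ⤳ z ∧ productFst.base y = productFst.base z ∧
      productSnd.base y ∈ fermatBasicOpen (MvPolynomial.X 0 * MvPolynomial.X 1) := by
  obtain ⟨j, hj⟩ := exists_mem_hBasicOpen_X fermatPoly_homogeneous (productSnd.base z)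
  obtain ⟨t, rfl⟩ : z ∈ Set.range (productChartMapAt j).base := by
    rw [range_productChartMapAt]
    exact ⟨hz, hj⟩
  obtain ⟨t', ht, hf, hn⟩ := exists_specializes_spec_fermat j t
  refine ⟨(productChartMapAt j).base t', ht.map (productChartMapAt j).continuous, ?_, ?_⟩
  · have h := productChartMapAt_fst j
    exact (congrArg (fun k => k.base t') h).trans ((congrArg surfaceChartMap.base hf).trans
      (congrArg (fun k => k.base t) h).symm)
  · have h : productSnd.base ((productChartMapAt j).base t') = (fermatChartMapAt j).base
        ((Spec.map (CommRingCat.ofHom (inclRight ℂ SurfaceChart _))).base t') :=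
      congrArg (fun k => k.base t') (productChartMapAt_snd j)
    rw [h]
    exact hn

end Density

/-! ### Density of the chart in the family of threefolds -/

section Homogeneity

open MvPolynomial

variable {ι D : Type} [CommRing D] {w : ι → ℕ} {x₀ x₁ x₂ x₃ y₁ y₂ : MvPolynomial ι D}

lemma isWeightedHomogeneous_C_pow (w : ι → ℕ) (s : D) (n : ℕ) :
    (C s ^ n : MvPolynomial ι D).IsWeightedHomogeneous w 0 := by
  rw [← map_pow]
  exact isWeightedHomogeneous_C w _

lemma branch_homogeneous (h₀ : x₀.IsWeightedHomogeneous w 1) (h₁ : x₁.IsWeightedHomogeneous w 1)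
    (a b c : D) : (branch (C a) (C b) (C c) x₀ x₁).IsWeightedHomogeneous w 5 :=
  (((h₁.mul (h₁.sub h₀)).mul (h₁.sub (h₀.C_mul a))).mul (h₁.sub (h₀.C_mul b))).mul
    (h₁.sub (h₀.C_mul c))

lemma lamForm_homogeneous (h₀ : x₀.IsWeightedHomogeneous w 1) (h₁ : x₁.IsWeightedHomogeneous w 1)
    (k₁ : y₁.IsWeightedHomogeneous w 2) (k₂ : y₂.IsWeightedHomogeneous w 2) (c z : D) :
    (lamForm (C c) (C z) x₀ x₁ y₁ y₂).IsWeightedHomogeneous w 3 := by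
  have k₂' := (isWeightedHomogeneous_C_pow w z 2).mul k₂
  rw [zero_add] at k₂'
  exact ((h₁.sub (h₀.C_mul c)).mul ((k₁.C_mul z).add k₂')).add (h₁.mul (k₁.add k₂))

lemma alphaForm_homogeneous (h₀ : x₀.IsWeightedHomogeneous w 1)
    (h₁ : x₁.IsWeightedHomogeneous w 1) (a b z : D) :
    (alphaForm (C a) (C b) (C z) x₀ x₁).IsWeightedHomogeneous w 2 := by
  have k := (isWeightedHomogeneous_C_pow w z 2).mul
    ((h₀.sub h₁).mul ((h₀.C_mul a).sub h₁))
  rw [zero_add] at k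
  exact ((((h₀.C_mul a).sub h₁).mul ((h₀.C_mul b).sub h₁)).add
    (((h₀.sub h₁).mul ((h₀.C_mul b).sub h₁)).C_mul z)).add k

lemma coverForm_homogeneous (h₀ : x₀.IsWeightedHomogeneous w 1)
    (h₁ : x₁.IsWeightedHomogeneous w 1) (h₂ : x₂.IsWeightedHomogeneous w 1)
    (h₃ : x₃.IsWeightedHomogeneous w 1) (a b c z : D) :
    (coverForm (C a) (C b) (C c) (C z) x₀ x₁ x₂ x₃).IsWeightedHomogeneous w 13 := by
  have s := (h₀.add h₁).add h₂
  have q := (h₀.add (h₁.C_mul a)).add (h₂.C_mul b)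
  have k := ((isWeightedHomogeneous_C_pow w z 2).mul ((s.C_mul a).sub q)).mul h₁
  rw [zero_add] at k
  exact (((((((((((h₁.mul h₂).mul h₃).mul s).mul q).mul (s.add h₃)).mul (q.add (h₃.C_mul c))).mul
    (q.sub s)).mul (q.sub (s.C_mul a))).mul (q.sub (s.C_mul b))).mul (q.sub (s.C_mul c))).mul
    ((((s.sub q).mul h₀).add k).add ((((s.C_mul b).sub q).C_mul z).mul h₂)))

end Homogeneity

section SurfaceForms

variable {A : Type} [CommRing A] (a b c w : A)

/-- The product of the forms on the surface which have to be avoided: besides `surfaceForm` it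
contains the constant coefficient of `mixedForm`, so that outside the zeros `mixedForm` does not
vanish identically on the fibre of `W × F ⟶ W`. -/
def surfaceLocusPoly : MvPolynomial (Fin 4) A :=
  surfaceForm (MvPolynomial.C a) (MvPolynomial.C b) (MvPolynomial.C c) (MvPolynomial.C w)
    (MvPolynomial.X 0) (MvPolynomial.X 1) (MvPolynomial.X 2) (MvPolynomial.X 3) *
  alphaForm (MvPolynomial.C a) (MvPolynomial.C b) (MvPolynomial.C w)
    (MvPolynomial.X 0) (MvPolynomial.X 1)

lemma surfaceLocusPoly_homogeneous :
    (surfaceLocusPoly a b c w).IsWeightedHomogeneous ![1, 1, 2, 2] 10 := by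
  have hX : ∀ i : Fin 4, (MvPolynomial.X i : MvPolynomial (Fin 4) A).IsWeightedHomogeneous
      ![1, 1, 2, 2] (![1, 1, 2, 2] i) := MvPolynomial.isWeightedHomogeneous_X A _
  exact ((branch_homogeneous (hX 0) (hX 1) a b c).mul
    (lamForm_homogeneous (hX 0) (hX 1) (hX 2) (hX 3) c w)).mul
    (alphaForm_homogeneous (hX 0) (hX 1) a b w)

lemma surfaceLocusPoly_eval₂ {T : Type} [CommRing T] (α : A →+* T) (z : Fin 4 → T) (hz : z 0 = 1) :
    (surfaceLocusPoly a b c w).eval₂ α z =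
      surfaceForm (α a) (α b) (α c) (α w) 1 (z 1) (z 2) (z 3) *
        alphaForm (α a) (α b) (α w) 1 (z 1) := by
  change MvPolynomial.eval₂Hom α z (_ * _) = _
  rw [map_mul, map_surfaceForm, map_alphaForm]
  simp [hz]

end SurfaceForms

section Density

/-- If `s` does not vanish at the projection of `t`, then `t` has a generization in the same fibre
of the projection at which `s + r v` does not vanish, where `v = z₂/z₁` is a coordinate of the
Fermat curve. -/
lemma exists_specializes_spec_linear {B : Type} [CommRing B] [Algebra ℂ B]
    (t : Spec (.of (B ⊗[ℂ] HChart fermatPoly 1))) {s : B} (r : B)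
    (hs : s ∉ t.asIdeal.comap (inclLeft ℂ B (HChart fermatPoly 1))) :
    ∃ t' : Spec (.of (B ⊗[ℂ] HChart fermatPoly 1)), t' ⤳ t ∧
      (Spec.map (CommRingCat.ofHom (inclLeft ℂ B (HChart fermatPoly 1)))).base t' =
        (Spec.map (CommRingCat.ofHom (inclLeft ℂ B (HChart fermatPoly 1)))).base t ∧
      inclLeft ℂ B (HChart fermatPoly 1) s + inclLeft ℂ B (HChart fermatPoly 1) r *
        inclRight ℂ B (HChart fermatPoly 1) (hCoord fermatPoly 1 2) ∉ t'.asIdeal := by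
  have hX := MvPolynomial.isWeightedHomogeneous_X B (fun _ : Fin 3 => 1)
  obtain ⟨t', ht, hf, hn⟩ := exists_specializes_spec_tensor (B := B) fermatPoly_homogeneous
    (j := 1) rfl t (fun φ => regularMod_fermatPoly_X φ 1)
    (MvPolynomial.C s * MvPolynomial.X 1 + MvPolynomial.C r * MvPolynomial.X 2)
    (((hX 1).C_mul s).add ((hX 2).C_mul r)) (fun φ hφ => by
      simp only [map_add, map_mul, MvPolynomial.map_X, MvPolynomial.map_C]
      exact regularMod_fermatPoly_linear _ fun h => hs (hφ ▸ h))
  refine ⟨t', ht, hf, fun hmem => hn ?_⟩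
  simpa [hCoord_self] using hmem

lemma exists_specializes_productChart (t : Spec (.of ProductChart)) {s : SurfaceChart}
    (r : SurfaceChart)
    (hs : s ∉ t.asIdeal.comap surfaceIncl) :
    ∃ t' : Spec (.of ProductChart), t' ⤳ t ∧
      (Spec.map (CommRingCat.ofHom surfaceIncl)).base t' =
        (Spec.map (CommRingCat.ofHom surfaceIncl)).base t ∧
      surfaceIncl s + surfaceIncl r * fermatIncl (hCoord fermatPoly 1 2) ∉ t'.asIdeal :=
  exists_specializes_spec_linear t r hs

lemma productChartMap_mem_range {ω : ℂ} {t : Spec (.of ProductChart)}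
    (h : productLocus ω ∉ t.asIdeal) :
    productChartMap.base t ∈ Set.range (rohdeChart ω).base := by
  let t₀ : PrimeSpectrum ProductChart := t
  have h' : t₀ ∈ Set.range (PrimeSpectrum.comap (algebraMap ProductChart (RohdeRing ω))) := by
    rw [PrimeSpectrum.localization_away_comap_range (RohdeRing ω) (productLocus ω)]
    exact h
  obtain ⟨u, hu⟩ := h'
  exact ⟨u, congrArg productChartMap.base hu⟩

lemma rohdeLocus_map {B P : Type} [CommRing B] [CommRing P] (i : B →+* P) (a b c w x y₁ y₂ : B)
    (u v : P) : rohdeLocus (i a) (i b) (i c) (i w) (i x) (i y₁) (i y₂) u v =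
      i (surfaceForm a b c w 1 x y₁ y₂) *
        (u * (i (alphaForm a b w 1 x) + i (alphaForm a b (w ^ 2) 1 x) * v)) := by
  rw [map_surfaceForm, map_alphaForm, map_alphaForm, map_pow, map_one]
  rfl

lemma productLocus_eq (ω : ℂ) : productLocus ω =
    surfaceIncl (surfaceForm (algebraMap PtRing _ (coord PtRing 0))
      (algebraMap PtRing _ (coord PtRing 1))
      (algebraMap PtRing _ (coord PtRing 2)) (algebraMap PtRing _ (algebraMap ℂ _ ω)) 1
      (hCoord univSurfacePoly 0 1) (hCoord _ _ 2) (hCoord _ _ 3)) *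
    (fermatIncl (hCoord _ _ 0) *
      (surfaceIncl (alphaForm (algebraMap PtRing _ (coord PtRing 0))
        (algebraMap PtRing _ (coord PtRing 1)) (algebraMap PtRing _ (algebraMap ℂ _ ω)) 1
        (hCoord univSurfacePoly 0 1)) +
      surfaceIncl (alphaForm (algebraMap PtRing _ (coord PtRing 0))
        (algebraMap PtRing _ (coord PtRing 1)) (algebraMap PtRing _ (algebraMap ℂ _ ω) ^ 2) 1
        (hCoord univSurfacePoly 0 1)) * fermatIncl (hCoord _ _ 2))) :=
  rohdeLocus_map surfaceIncl _ _ _ _ _ _ _ _ _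

lemma separated_univPoints : Separated (coord PtRing 0) (coord PtRing 1) (coord PtRing 2) :=
  (generalPosition_points_iff _ _ _).1 isModuliSpace_univPoints.1

instance : Flat productFst := by
  have : Flat fermatToBase := inferInstance
  exact inferInstanceAs (Flat (pullback.fst (surfaceToBase ≫ MPtToC) fermatToBase))

/-- Going down for the flat projection to the surface. -/
lemma surface_eq_of_specializes {z : productFamily} {x : surface} (h : x ⤳ productFst.base z) :
    ∃ y : productFamily, y ⤳ z ∧ productFst.base y = x := Flat.generalizingMap productFst h

lemma surfaceChartMap_mem {n : ℕ} (hn : 0 < n) {g : MvPolynomial (Fin 4) PtRing}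
    (hg : g.IsWeightedHomogeneous ![1, 1, 2, 2] n) (t : Spec (.of SurfaceChart)) :
    surfaceChartMap.base t ∈ hBasicOpen (surfacePoly_homogeneous (coord PtRing 0) (coord PtRing 1)
      (coord PtRing 2)) g ↔
      g.eval₂ (algebraMap PtRing SurfaceChart) (hCoord univSurfacePoly 0) ∉ t.asIdeal :=
  hChartMap_mem_hBasicOpen (surfacePoly_homogeneous (coord PtRing 0) (coord PtRing 1)
      (coord PtRing 2)) (k := 0) rfl hn hg t

/-- Every point of the family of threefolds is a specialization, within its fibre over the moduli
space, of a point of the chart `rohdeChart`. -/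
lemma exists_specializes_rohdeChart {ω : ℂ}
    (hw : 1 + algebraMap ℂ PtRing ω + algebraMap ℂ PtRing ω ^ 2 = 0)
    (z : productFamily) :
    ∃ y : productFamily, y ⤳ z ∧ productToBase.base y = productToBase.base z ∧
      y ∈ Set.range (rohdeChart ω).base := by
  -- Three generizations: in the direction of the surface, then along the fibre of the projection to
  -- the surface to make `z₀` and `z₁` invertible, and along this fibre again for `mixedForm`.
  obtain ⟨x, hx, hxb, hxl⟩ := exists_specializes_hBasicOpen
    (surfacePoly_homogeneous (coord PtRing 0) (coord PtRing 1) (coord PtRing 2))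
    (fibrewiseRegular_surfacePoly separated_univPoints hw) (productFst.base z)
  obtain ⟨hx0, hxl⟩ := (mem_hBasicOpen_mul _ _).1 hxl
  obtain ⟨y₁, hy₁, rfl⟩ := surface_eq_of_specializes hx
  have hch : productFst.base y₁ ∈ Set.range surfaceChartMap.base := by
    have h := range_hChartMap (surfacePoly_homogeneous (coord PtRing 0) (coord PtRing 1)
      (coord PtRing 2)) (k := 0) rfl
    exact h ▸ hx0
  obtain ⟨y₂, hy₂, hy₂', hz₂⟩ := exists_specializes_coordinates y₁ hch
  have hy₂c : y₂ ∈ Set.range (productChartMapAt 1).base := by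
    rw [range_productChartMapAt]
    exact ⟨by rw [Set.mem_preimage, hy₂']; exact hch, ((mem_hBasicOpen_mul _ _).1 hz₂).2⟩
  obtain ⟨t, ht⟩ := hy₂c
  let t' : Spec (.of ProductChart) := t
  have ht' : productChartMap.base t' = y₂ := ht
  have hfst : ∀ s : Spec (.of ProductChart), productFst.base (productChartMap.base s) =
      surfaceChartMap.base ((Spec.map (CommRingCat.ofHom surfaceIncl)).base s) :=
    fun s => congrArg (fun k => k.base s) productChartMap_fst
  have hsnd : ∀ s : Spec (.of ProductChart), productSnd.base (productChartMap.base s) =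
      (fermatChartMapAt 1).base ((Spec.map (CommRingCat.ofHom fermatIncl)).base s) :=
    fun s => congrArg (fun k => k.base s) productChartMap_snd
  have hxl' := hxl
  rw [← hy₂', ← ht', hfst] at hxl'
  have hloc := (surfaceChartMap_mem (by norm_num) (surfaceLocusPoly_homogeneous _ _ _ _) _).1 hxl'
  rw [surfaceLocusPoly_eval₂ _ _ _ _ _ _ (hCoord_self _ _)] at hloc
  obtain ⟨t'', hs, hs', hn⟩ := exists_specializes_productChart t'
    (alphaForm (algebraMap PtRing _ (coord PtRing 0))
        (algebraMap PtRing _ (coord PtRing 1)) (algebraMap PtRing _ (algebraMap ℂ _ ω) ^ 2) 1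
        (hCoord univSurfacePoly 0 1)) (fun h => hloc (Ideal.mul_mem_left _ _ h))
  have hspec : productChartMap.base t'' ⤳ y₂ := by
    rw [← ht']
    exact hs.map productChartMap.continuous
  have hpt : productFst.base (productChartMap.base t'') = productFst.base y₁ := by
    rw [hfst, hs', ← hfst, ht', hy₂']
  refine ⟨productChartMap.base t'', hspec.trans (hy₂.trans hy₁), ?_, productChartMap_mem_range ?_⟩
  · have hb : ∀ s, productToBase.base s = surfaceToBase.base (productFst.base s) := fun s => rfl
    rw [hb, hb, hpt]
    exact hxb
  · let t₀ : PrimeSpectrum ProductChart := t''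
    have hp : t₀.asIdeal.IsPrime := t₀.isPrime
    have h0 : productSnd.base (productChartMap.base t'') ∈ fermatBasicOpen (MvPolynomial.X 0) :=
      (hspec.map productSnd.continuous).mem_open (fermatBasicOpen (MvPolynomial.X 0)).isOpen
        ((mem_hBasicOpen_mul _ _).1 hz₂).1
    rw [hsnd] at h0
    have h0' := (fermatChartMapAt_mem one_pos
      (MvPolynomial.isWeightedHomogeneous_X ℂ (fun _ => 1) 0) _).1 h0
    rw [MvPolynomial.eval₂_X] at h0'
    rw [← hs'] at hloc
    rw [productLocus_eq]
    refine fun hmem => (hp.mem_or_mem hmem).elim (fun h => hloc (Ideal.mul_mem_right _ _ h))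
      fun h =>
      (hp.mem_or_mem h).elim h0' hn

end Density

/-! ### Density of the chart in the family of triple covers -/

section Cover

variable {ω : ℂ} (e : PlRing ≃ₐ[Param] PtRing)

/-- The chart `X₀ = 1` of the family of triple covers. -/
def coverChartMap : Spec (.of CoverChart) ⟶ tripleCover univPlanes :=
  hChartMap (coverPoly_homogeneous univPlanes) (k := 0) rfl

instance : IsOpenImmersion coverChartMap :=
  instIsOpenImmersionHChartMap (coverPoly_homogeneous univPlanes) (k := 0) rfl

/-- The affine open subscheme of the family of triple covers with coordinate ring `CoverRing`. -/
def coverRingChart (ω : ℂ) : Spec (.of (CoverRing ω e)) ⟶ tripleCover univPlanes :=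
  Spec.map (CommRingCat.ofHom (algebraMap CoverChart (CoverRing ω e))) ≫ coverChartMap

instance : IsOpenImmersion (coverRingChart e ω) := by
  have : IsOpenImmersion (Spec.map (CommRingCat.ofHom
      (algebraMap CoverChart (CoverRing ω e)))) :=
    IsOpenImmersion.of_isLocalization (coverLocus ω e)
  rw [coverRingChart]
  infer_instance

lemma coverRingChart_toBase : coverRingChart e ω ≫ coverFamily =
    Spec.map (CommRingCat.ofHom
      ((algebraMap CoverChart (CoverRing ω e)).comp (algebraMap PlRing CoverChart))) := by
  have h : coverChartMap ≫ coverFamily =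
    Spec.map (CommRingCat.ofHom (algebraMap PlRing CoverChart)) := hChartMap_toBase _ _
  rw [coverRingChart, Category.assoc, h]
  exact (Spec.map_comp _ _).symm

lemma coverChartMap_mem_range {t : Spec (.of CoverChart)} (h : coverLocus ω e ∉ t.asIdeal) :
    coverChartMap.base t ∈ Set.range (coverRingChart e ω).base := by
  let t₀ : PrimeSpectrum CoverChart := t
  have h' : t₀ ∈ Set.range (PrimeSpectrum.comap (algebraMap CoverChart (CoverRing ω e))) := by
    rw [PrimeSpectrum.localization_away_comap_range (CoverRing ω e) (coverLocus ω e)]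
    exact h
  obtain ⟨u, hu⟩ := h'
  exact ⟨u, congrArg coverChartMap.base hu⟩

lemma isUnit_three {A : Type} [CommRing A] [Algebra ℂ A] : IsUnit (3 : A) := by
  have h := (isUnit_iff_ne_zero.2 (three_ne_zero : (3 : ℂ) ≠ 0)).map (algebraMap ℂ A)
  rwa [map_ofNat] at h

lemma coverForm_eval₂ {A T : Type} [CommRing A] [CommRing T] (a b c w : A) (α : A →+* T)
    (z : Fin 5 → T) (hz : z 0 = 1) :
    (coverForm (MvPolynomial.C a) (MvPolynomial.C b) (MvPolynomial.C c) (MvPolynomial.C w)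
      (MvPolynomial.X 0) (MvPolynomial.X 1) (MvPolynomial.X 2) (MvPolynomial.X 3)).eval₂ α z =
      coverForm (α a) (α b) (α c) (α w) 1 (z 1) (z 2) (z 3) := by
  change MvPolynomial.eval₂Hom α z _ = _
  rw [map_coverForm]
  simp [hz]

/-- Every point of the family of triple covers is a specialization, within its fibre over the moduli
space, of a point of the chart `coverRingChart`. -/
lemma exists_specializes_coverRingChart
    (hw : 1 + algebraMap ℂ PtRing ω + algebraMap ℂ PtRing ω ^ 2 = 0)
    (z : tripleCover univPlanes) :
    ∃ y : tripleCover univPlanes, y ⤳ z ∧ coverFamily.base y = coverFamily.base z ∧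
      y ∈ Set.range (coverRingChart e ω).base := by
  have hX : ∀ i : Fin 5, (MvPolynomial.X i : MvPolynomial (Fin 5) PlRing).IsWeightedHomogeneous
      ![1, 1, 1, 1, 2] (![1, 1, 1, 1, 2] i) := MvPolynomial.isWeightedHomogeneous_X PlRing _
  have hw' : 1 + e.symm (algebraMap ℂ PtRing ω) + e.symm (algebraMap ℂ PtRing ω) ^ 2 = 0 := by
    rw [← map_pow, ← map_one e.symm, ← map_add, ← map_add, hw, map_zero]
  obtain ⟨y, hy, hyb, hyl⟩ := exists_specializes_hBasicOpen (coverPoly_homogeneous univPlanes)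
    (fibrewiseRegular_coverPoly (separated_univPoints.map (e.symm : PtRing →+* PlRing)) hw'
      isUnit_three) z
  obtain ⟨hy0, hyl⟩ := (mem_hBasicOpen_mul _ _).1 hyl
  refine ⟨y, hy, hyb, ?_⟩
  have h := range_hChartMap (coverPoly_homogeneous univPlanes) (k := 0) rfl
  obtain ⟨t, rfl⟩ : y ∈ Set.range
      (hChartMap (coverPoly_homogeneous univPlanes) (k := 0) rfl).base :=
    h ▸ hy0
  have hl := (hChartMap_mem_hBasicOpen (coverPoly_homogeneous univPlanes) (k := 0) rfl (by norm_num)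
    (coverForm_homogeneous (hX 0) (hX 1) (hX 2) (hX 3) _ _ _ _) t).1 hyl
  rw [coverForm_eval₂ _ _ _ _ _ _ (hCoord_self _ _)] at hl
  exact coverChartMap_mem_range e hl

end Cover

section Topology

/-- A set is dense in the total space and in every fibre if it contains a generization of every
point within its fibre. -/
lemma dense_of_specializes {X B : Type*} [TopologicalSpace X] (p : X → B) (U : Set X)
    (h : ∀ z, ∃ y, y ⤳ z ∧ p y = p z ∧ y ∈ U) :
    Dense U ∧ ∀ b, p ⁻¹' {b} ⊆ closure (U ∩ p ⁻¹' {b}) := by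
  refine ⟨fun z => ?_, fun b z hz => ?_⟩
  · obtain ⟨y, hy, -, hyU⟩ := h z
    exact closure_mono (Set.singleton_subset_iff.2 hyU) (specializes_iff_mem_closure.1 hy)
  · obtain ⟨y, hy, hyp, hyU⟩ := h z
    exact closure_mono (Set.singleton_subset_iff.2
      (show y ∈ U ∩ p ⁻¹' {b} from ⟨hyU, hyp.trans hz⟩))
      (specializes_iff_mem_closure.1 hy)

end Topology

section LocallyRinged

lemma exists_restrict_iso {X Y : LocallyRingedSpace.{0}} (j : X ⟶ Y)
    [LocallyRingedSpace.IsOpenImmersion j] :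
    ∃ (V : Opens Y.toTopCat) (h : X ≅ Y.restrict V.isOpenEmbedding),
      (V : Set Y.toTopCat) = Set.range j.base ∧ h.hom ≫ Y.ofRestrict V.isOpenEmbedding = j := by
  let V : Opens Y.toTopCat := ⟨Set.range j.base,
    (PresheafedSpace.IsOpenImmersion.base_open (f := j.toHom)).isOpen_range⟩
  have h1 : Set.range (Y.ofRestrict V.isOpenEmbedding).base = Set.range j.base := Subtype.range_coe
  refine ⟨V, ⟨LocallyRingedSpace.IsOpenImmersion.lift _ j h1.ge,
    LocallyRingedSpace.IsOpenImmersion.lift j _ h1.le, ?_, ?_⟩, rfl,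
    LocallyRingedSpace.IsOpenImmersion.lift_fac _ _ h1.ge⟩
  · rw [← cancel_mono j, Category.assoc, LocallyRingedSpace.IsOpenImmersion.lift_fac,
      LocallyRingedSpace.IsOpenImmersion.lift_fac, Category.id_comp]
  · rw [← cancel_mono (Y.ofRestrict V.isOpenEmbedding), Category.assoc,
      LocallyRingedSpace.IsOpenImmersion.lift_fac, LocallyRingedSpace.IsOpenImmersion.lift_fac,
      Category.id_comp]

lemma spec_hom_ext_of_injective {S R P : CommRingCat.{0}} (φ : S ⟶ R) (hφ : Function.Injective φ)
    (a b : Spec S ⟶ Spec P) (h : Spec.map φ ≫ a = Spec.map φ ≫ b) : a = b := by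
  rw [← Spec.map_preimage a, ← Spec.map_preimage b, ← Spec.map_comp, ← Spec.map_comp] at h
  have h' := Spec.map_injective h
  rw [← Spec.map_preimage a, ← Spec.map_preimage b]
  congr 1
  ext x
  exact hφ (ConcreteCategory.congr_hom h' x)

end LocallyRinged

/-! ### The birational equivalence -/

variable {ω : ℂ} (hω : IsPrimitiveRoot ω 3)

lemma one_add_add_sq_eq_zero (hω : IsPrimitiveRoot ω 3) {A : Type} [CommRing A] [Algebra ℂ A] :
    1 + algebraMap ℂ A ω + algebraMap ℂ A ω ^ 2 = 0 := by
  have h : 1 + ω + ω ^ 2 = 0 := by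
    have h1 : (ω - 1) * (1 + ω + ω ^ 2) = 0 := by linear_combination hω.pow_eq_one
    exact (mul_eq_zero.1 h1).resolve_left (sub_ne_zero.2 (hω.ne_one (by norm_num)))
  have h' := congrArg (algebraMap ℂ A) h
  rwa [map_add, map_add, map_pow, map_one, map_zero] at h'

lemma mul_eq_of_eq_one {B P R : Type} [CommRing B] [CommRing P] [CommRing R] (i : B →+* P)
    (l : P →+* R) (σ : R →+* R) {x : B} (hx : x = 1) {r : R} (hr : r = 1) :
    σ (l (i x)) = r * l (i x) := by
  rw [hx, hr, map_one, map_one, map_one, one_mul]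

lemma eq_mul_of_eq_one {R : Type} [CommRing R] {x y r : R} (h : y = x) (hr : r = 1) :
    y = r * x := by
  rw [h, hr, one_mul]

lemma map_map_one {B P R : Type} [CommRing B] [CommRing P] [CommRing R] (i : B →+* P)
    (l : P →+* R) : l (i 1) = 1 := by rw [map_one, map_one]

/-- The generator of the group acts on the coordinate ring of the chart of the family of threefolds,
the chart is equivariant, and the invariants are the coordinate ring of the chart of the family of
triple covers. -/
lemma exists_chart_aut : ∃ σ : RohdeRing ω ≃+* RohdeRing ω, σ ^ 3 = 1 ∧
    Spec.map (CommRingCat.ofHom (σ : RohdeRing ω →+* RohdeRing ω)) ≫ rohdeChart ω =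
      rohdeChart ω ≫ productAut hω ∧
    (∀ e : PlRing ≃ₐ[Param] PtRing, ∃ φ : CoverRing ω e →+* RohdeRing ω,
      φ.comp ((algebraMap CoverChart (CoverRing ω e)).comp
        ((algebraMap PlRing CoverChart).comp (e.symm : PtRing →+* PlRing))) =
        (algebraMap ProductChart (RohdeRing ω)).comp productBase ∧
      Function.Injective φ ∧ (∀ s, σ (φ s) = φ s) ∧ ∀ r, σ r = r → ∃ s, φ s = r) := by
  have hw := one_add_add_sq_eq_zero hω (A := PtRing)
  obtain ⟨σ, h3, hα, hx, hy₁, hy₂, hu, hv⟩ := (isUniversalRohde ω).exists_aut hw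
  refine ⟨σ, h3, ?_, fun e => ?_⟩
  · refine rohdeChart_equivariant hω σ (RingHom.ext hα) (fun i => ?_) fun i => ?_
    · fin_cases i
      · exact mul_eq_of_eq_one surfaceIncl _ (σ : RohdeRing ω →+* RohdeRing ω) (hCoord_self _ _)
          (map_map_one productBase _)
      · exact eq_mul_of_eq_one hx (map_map_one productBase _)
      · exact hy₁
      · exact hy₂
    · fin_cases i
      · refine hu.trans (congrArg (fun t => algebraMap ProductChart (RohdeRing ω) t * _) ?_)
        exact surfaceIncl_algebraMap_eq ω
      · exact mul_eq_of_eq_one fermatIncl _ (σ : RohdeRing ω →+* RohdeRing ω) (hCoord_self _ _)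
          (map_map_one (fermatIncl.comp (algebraMap ℂ _)) _)
      · exact eq_mul_of_eq_one hv (map_map_one (fermatIncl.comp (algebraMap ℂ _)) _)
  · obtain ⟨φ, hφ, hinj, h⟩ := (isUniversalRohde ω).exists_invariants (isUniversalCover ω e) hw
      isUnit_three
    exact ⟨φ, hφ, hinj, h σ hα hx hy₁ hy₂ hu hv⟩

lemma rohdeChart_toBase : rohdeChart ω ≫ productToBase = Spec.map (CommRingCat.ofHom
    ((algebraMap ProductChart (RohdeRing ω)).comp productBase)) := by
  rw [rohdeChart, Category.assoc, productChartMap_toBase]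
  exact (Spec.map_comp _ _).symm

/-- The image of the chart contains a generization of every point of Rohde's family within its
fibre. -/
lemma coequalizer_dense {U : Set (rohdeTotal hω).toTopCat}
    (hU : U =
      (coequalizer.π (productAut hω).toLRSHom (𝟙 productFamily.toLocallyRingedSpace)).base ''
        Set.range (rohdeChart ω).base) (z : (rohdeTotal hω).toTopCat) :
    ∃ y, y ⤳ z ∧ (rohdeFamily hω).base y = (rohdeFamily hω).base z ∧ y ∈ U := by
  obtain ⟨z, rfl⟩ := (coequalizer_isQuotientMap (productAut hω).toLRSHom).surjective z
  obtain ⟨y, hy, hyb, hyU⟩ := exists_specializes_rohdeChart (one_add_add_sq_eq_zero hω) z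
  refine ⟨_, hy.map (coequalizer.π (productAut hω).toLRSHom
    (𝟙 productFamily.toLocallyRingedSpace)).base.hom.continuous, ?_, ?_⟩
  · have h : coequalizer.π (productAut hω).toLRSHom (𝟙 productFamily.toLocallyRingedSpace) ≫
        rohdeFamily hω = productToBase.toLRSHom := coequalizer.π_desc _ _
    have h' : ∀ t : productFamily, (rohdeFamily hω).base
        ((coequalizer.π (productAut hω).toLRSHom (𝟙 productFamily.toLocallyRingedSpace)).base t) =
        productToBase.base t := fun t => ConcreteCategory.congr_hom (congrArg (fun f => f.base) h) t
    exact (h' y).trans (hyb.trans (h' z).symm)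
  · rw [hU]
    exact ⟨y, hyU, rfl⟩

/-- Compatibility of an isomorphism with the projections to the base can be checked after pullback
to the chart `R` upstairs. -/
lemma iso_comp_eq {C : Type*} [Category C] {Q B B' Y T R X Q' Y' : C} (g : Q' ≅ T) (k : T ≅ Y')
    {i : Q' ⟶ Q} {i' : Y' ⟶ Y} {ρ : R ⟶ Q'} {j : R ⟶ X} {π : X ⟶ Q} {s : T ⟶ Y} {φ : R ⟶ T}
    {p : Q ⟶ B} {q : Y ⟶ B'} {m : B ⟶ B'} {P : X ⟶ B} (hρ : ρ ≫ i = j ≫ π) (hg : ρ ≫ g.hom = φ)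
    (hπ : π ≫ p = P) (hk : k.hom ≫ i' = s) (h : φ ≫ s ≫ q = j ≫ P ≫ m)
    (hext : ∀ a b : T ⟶ B', φ ≫ a = φ ≫ b → a = b) : (g ≪≫ k).hom ≫ i' ≫ q = i ≫ p ≫ m := by
  have h' : s ≫ q = g.inv ≫ i ≫ p ≫ m := by
    refine hext _ _ ?_
    rw [h, ← hg, Category.assoc, Iso.hom_inv_id_assoc, reassoc_of% hρ, reassoc_of% hπ]
  rw [Iso.trans_hom, Category.assoc, reassoc_of% hk, h', Iso.hom_inv_id_assoc]

theorem birationalFamilies (e : PlRing ≃ₐ[Param] PtRing) :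
    BirationalFamilies (rohdeFamily hω) coverFamily.toLRSHom (moduliMap e).toLRSHom := by
  obtain ⟨σ, h3, hj, h⟩ := exists_chart_aut hω
  obtain ⟨φ, hφ, hinj, hσ, hinv⟩ := h e
  obtain ⟨U, g, ρ, hU, hρ, hg⟩ := exists_quotient_iso (CommRingCat.ofHom φ) hinj σ h3 hσ hinv
    (productAut hω) (rohdeChart ω) hj (preimage_range_of_comp_eq hj (productAut_pow_three hω))
  have : LocallyRingedSpace.IsOpenImmersion (coverRingChart e ω).toLRSHom :=
    inferInstanceAs (IsOpenImmersion (coverRingChart e ω))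
  obtain ⟨V, k, hV, hk⟩ := exists_restrict_iso (coverRingChart e ω).toLRSHom
  have dU := dense_of_specializes (rohdeFamily hω).base (SetLike.coe U) (coequalizer_dense hω hU)
  have dV := dense_of_specializes coverFamily.toLRSHom.base (SetLike.coe V) (fun z => by
    rw [hV]
    exact exists_specializes_coverRingChart e (one_add_add_sq_eq_zero hω) z)
  refine ⟨U, V, g ≪≫ k, dU.1, dV.1, dU.2, dV.2, ?_⟩
  refine iso_comp_eq g k hρ hg (coequalizer.π_desc _ _) hk ?_ fun a b hab =>
    congrArg Scheme.Hom.toLRSHom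
      (spec_hom_ext_of_injective (CommRingCat.ofHom φ) hinj ⟨a⟩ ⟨b⟩ (Scheme.Hom.ext' hab))
  -- The two projections to the moduli space agree on the chart `Spec R` upstairs, and the
  -- coordinate ring of the quotient injects into `R`.
  have hring : ((φ.comp ((algebraMap CoverChart (CoverRing ω e)).comp
        (algebraMap PlRing CoverChart))) :
      PlRing →+* RohdeRing ω) =
      ((algebraMap ProductChart (RohdeRing ω)).comp productBase).comp (e : PlRing →+* PtRing) := by
    rw [← hφ]
    refine RingHom.ext fun t => ?_
    have h := e.symm_apply_apply t
    exact congrArg (fun t => φ (algebraMap CoverChart (CoverRing ω e)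
      (algebraMap PlRing CoverChart t))) h.symm
  have h1 : Spec.map (CommRingCat.ofHom φ) ≫ coverRingChart e ω ≫ coverFamily =
      rohdeChart ω ≫ productToBase ≫ moduliMap e := by
    rw [coverRingChart_toBase, ← Category.assoc (rohdeChart ω), rohdeChart_toBase]
    refine (Spec.map_comp _ _).symm.trans (Eq.trans ?_ (Spec.map_comp _ _))
    exact congrArg (fun t => Spec.map (CommRingCat.ofHom t)) hring
  exact congrArg Scheme.Hom.toLRSHom h1

end RohdeCY

end

theorem propositionA4 {ω : ℂ} (hω : IsPrimitiveRoot ω 3) :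
    RohdeCY.IsModuliSpace RohdeCY.univPoints ∧ RohdeCY.IsModuliSpace RohdeCY.univPlanes ∧
    ∃ e : RohdeCY.PlRing ≃ₐ[RohdeCY.Param] RohdeCY.PtRing,
      RohdeCY.BirationalFamilies (RohdeCY.rohdeFamily hω) RohdeCY.coverFamily.toLRSHom
        (RohdeCY.moduliMap e).toLRSHom := by
  obtain ⟨e⟩ := RohdeCY.exists_algEquiv_moduli
  exact ⟨RohdeCY.isModuliSpace_univPoints, RohdeCY.isModuliSpace_univPlanes, e,
    RohdeCY.birationalFamilies hω e⟩
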